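/- For a lattice $M$ with $\langle M,M\rangle\subseteq 2\mathbb Z$ let $V_M=M(1)\otimes\mathbb C[M]$ be its lattice vertex operator algebra (with trivial cocycle), and for a coset $M+\lambda$ in the dual lattice let $V_{M+\lambda}=M(1)\otimes\mathbb C[M+\lambda]$ be the corresponding $V_M$-module. Let $\mathbb Z\alpha$ be the lattice with $\langle\alpha,\alpha\rangle=2$, and let $L=\mathbb Z\alpha_1\oplus\mathbb Z\alpha_2\oplus\mathbb Z\alpha_3$ with $\langle\alpha_i,\alpha_j\rangle=2\delta_{ij}$ (that is, $L=A_1^{\oplus 3}$), so that $V_L=V_{\mathbb Z\alpha_1}\otimes V_{\mathbb Z\alpha_2}\otimes V_{\mathbb Z\alpha_3}$. Put $$\sqrt2\beta_1=\alpha_1+\alpha_2,\quad \sqrt2\beta_2=-\alpha_2+\alpha_3,\quad \sqrt2\beta_3=-\alpha_1+\alpha_2,\quad \gamma=-\alpha_1+\alpha_2+\alpha_3,$$ $$N=\sum_{i,j=1}^3\mathbb Z(\alpha_i\pm\alpha_j),\quad E=\mathbb Z\sqrt2\beta_1+\mathbb Z\sqrt2\beta_2,\quad F=\mathbb Z\gamma,\quad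 D=E\oplus F\subseteq L .$$ For a subspace $U$ of one of these vertex operator algebras that is stable under the automorphism $\psi_2$ induced by the isometry $\beta\mapsto-\beta$ ($h(-n)\mapsto -h(-n)$, $e^\beta\mapsto e^{-\beta}$), write $U^\pm=\{u\in U:\psi_2(u)=\pm u\}$. (a) $\sqrt2\beta_1,\sqrt2\beta_2,\sqrt2\beta_3$ form a basis of $N$ whose Gram matrix is twice the Cartan matrix of type $A_3$, so $N\cong\sqrt2A_3$, and this isometry induces an isomorphism of vertex operator algebras from $V_{\sqrt2A_3}$ onto $V_N\subseteq V_L$. (b) There is a unique automorphism $\sigma$ of the vertex operator algebra $V_{\mathbb Z\alpha}$ with $\sigma(\alpha(-1))=e^{\alpha}+e^{-\alpha}$, $\sigma(e^\alpha+e^{-\alpha})=\alpha(-1)$ and $\sigma(e^\alpha-e^{-\alpha})=-(e^\alpha-e^{-\alpha})$. The map $\tau=\sigma\otimes\sigma\otimes\sigma$ is an automorphism of the vertex operator algebra $V_L$, and $$\tau(V_N)=V_L^+ .$$ (c) $E\cong\sqrt2A_2$, $\langle\gamma,\gamma\rangle=6$, $E\perp F$, and $V_D=V_E\otimes V_F$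 as vertex operator algebras. Moreover: 1. $V_L^+\cong V_D^+\oplus V_{D+\alpha_2}$ as $V_D^+$-modules. 2. $V_D^+=(V_E^+\otimes V_F^+)\oplus(V_E^-\otimes V_F^-)$. 3. $V_{D+\alpha_2}=V_{E+\sqrt2(\beta_1-\beta_2)/3}\otimes V_{F+\gamma/3}$, as modules for $V_D=V_E\otimes V_F$. Hence, as $V_D^+$-modules, $$V_L^+\cong(V_E^+\otimes V_F^+)\oplus(V_E^-\otimes V_F^-)\oplus\bigl(V_{E+\sqrt2(\beta_1-\beta_2)/3}\otimes V_{F+\gamma/3}\bigr).$$ -/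

import Mathlib

open scoped TensorProduct

noncomputable section

namespace LatticeVOA

/-! ### Fock spaces

A lattice with `ℤ`-basis `(α i)`, `i : ι`, is given by its Gram matrix `G i j = ⟨α i, α j⟩`.
Vectors of `ℚ ⊗ L` are written in coordinates, as functions `ι → ℚ`.
All lattices on which the vertex operators below are used satisfy `⟨L, L⟩ ⊆ 2ℤ`, so that the
central extension `L^` splits and the cocycle is trivial: `e_β (u ⊗ e^γ) = u ⊗ e^(β + γ)`. -/

/-- `M(1) = ℂ[h(-n) : h ∈ 𝔥, n > 0]`; the variable `X (i, m)` is `α i (-m-1)`. -/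
abbrev Heis (ι : Type) := MvPolynomial (ι × ℕ) ℂ

/-- The ambient space `M(1) ⊗ ℂ[ℚ ⊗ L]`, in which all `V_X = M(1) ⊗ ℂ[X]`, `X ⊆ ℚ ⊗ L`, live;
`single β p` is `p ⊗ e^β`. It is also used as a commutative algebra
(`(p ⊗ e^β) * (q ⊗ e^γ) = pq ⊗ e^(β+γ)`). -/
abbrev Fock (ι : Type) := AddMonoidAlgebra (Heis ι) (ι → ℚ)

/-- `p ⊗ e^β`. -/
abbrev vec {ι : Type} (β : ι → ℚ) (p : Heis ι) : Fock ι := AddMonoidAlgebra.single β p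

/-- The coefficients `M(1)((z))` of vertex operators. -/
abbrev Ser (ι : Type) := LaurentSeries (Heis ι)

/-- `c z^k`. -/
abbrev zmon {ι : Type} (k : ℤ) (c : ℂ) : Ser ι := HahnSeries.single k (MvPolynomial.C c)

section Vertex

variable {ι : Type} [Fintype ι] [DecidableEq ι]

/-- The bilinear form `⟨β, γ⟩`, extended to `ℚ ⊗ L`. -/
def pairing (G : Matrix ι ι ℚ) (β γ : ι → ℚ) : ℚ := β ⬝ᵥ G.mulVec γ

/-- Creation part of `(1/m!) (d/dz)^m α_i(z)`, where `α_i(z) = ∑ α_i(n) z^(-n-1)`: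
`∑_{n < 0} binom(-n-1, m) α_i(n) z^(-n-1-m)`, i.e. `∑_{k ≥ 0} binom(k+m, m) α_i(-k-m-1) z^k`. -/
def creation (x : ι × ℕ) : Ser ι :=
  HahnSeries.ofPowerSeries ℤ (Heis ι)
    (PowerSeries.mk fun k => MvPolynomial.C (((k + x.2).choose x.2 : ℕ) : ℂ) *
      MvPolynomial.X (x.1, k + x.2))

/-- The `n > 0` part of `(1/m!) (d/dz)^m α_i(z)`, namely
`∑_{n > 0} (-1)^m binom(n+m, m) α_i(n) z^(-n-1-m)`. Here `α_i(n)` is the derivation with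
`α_i(n) α_j(-n) = n ⟨α_i, α_j⟩` that kills `α_j(-k)` for `k ≠ n`.
It acts on polynomials in the `α_j(-k)` with coefficients in `M(1)((z))`. -/
def annihilation (G : Matrix ι ι ℚ) (x : ι × ℕ) :
    Derivation (Ser ι) (MvPolynomial (ι × ℕ) (Ser ι)) (MvPolynomial (ι × ℕ) (Ser ι)) :=
  MvPolynomial.mkDerivation (Ser ι) fun y =>
    MvPolynomial.C (zmon (-((y.2 : ℤ) + 1) - 1 - x.2)
      ((-1) ^ x.2 * (((y.2 + 1 + x.2).choose x.2 : ℕ) : ℂ) * (((y.2 + 1 : ℕ) : ℂ) *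
        ((G x.1 y.1 : ℚ) : ℂ))))

/-- The `n = 0` part `(-1)^m α_i(0) z^(-1-m)` on `M(1) ⊗ e^γ`, where `α_i(0) = ⟨α_i, γ⟩`. -/
def zeroMode (G : Matrix ι ι ℚ) (γ : ι → ℚ) (x : ι × ℕ) : Ser ι :=
  zmon (-1 - (x.2 : ℤ)) ((-1) ^ x.2 * ((G.mulVec γ x.1 : ℚ) : ℂ))

/-- One factor of a normally ordered product. The argument `f` lies in `M(1)((z))[α_j(-k)]`: its
variables are those of the vector acted upon, while creation operators that already stand on the
left are recorded in the coefficients `M(1)((z))`, where annihilation operators do not see them. -/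
def normalStep (G : Matrix ι ι ℚ) (γ : ι → ℚ) (x : ι × ℕ)
    (f : MvPolynomial (ι × ℕ) (Ser ι)) : MvPolynomial (ι × ℕ) (Ser ι) :=
  creation x • f + (annihilation G x f + zeroMode G γ x • f)

set_option linter.unusedSectionVars false in
theorem annihilation_comm (G : Matrix ι ι ℚ) (x y : ι × ℕ) (f : MvPolynomial (ι × ℕ) (Ser ι)) :
    annihilation G x (annihilation G y f) = annihilation G y (annihilation G x f) := by
  have key : ∀ (z : ι × ℕ) (i : ι × ℕ), ∃ c : Ser ι,
      annihilation G z (MvPolynomial.X i) = MvPolynomial.C c := fun z i =>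
    ⟨_, MvPolynomial.mkDerivation_X _ _ _⟩
  induction f using MvPolynomial.induction_on with
  | C a => simp
  | add p q hp hq => simp [map_add, hp, hq]
  | mul_X p i hp =>
    obtain ⟨c, hc⟩ := key x i
    obtain ⟨d, hd⟩ := key y i
    simp only [Derivation.leibniz, map_add, hc, hd, hp, smul_eq_mul, MvPolynomial.derivation_C]
    ring

instance normalStep_leftComm (G : Matrix ι ι ℚ) (γ : ι → ℚ) :
    LeftCommutative (normalStep G γ) where
  left_comm x y f := by
    simp only [normalStep, map_add, Derivation.map_smul, smul_add, annihilation_comm G x y f,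
      smul_comm (creation x) (creation y), smul_comm (creation x) (zeroMode G γ y),
      smul_comm (zeroMode G γ x) (zeroMode G γ y), smul_comm (zeroMode G γ x) (creation y)]
    abel

/-- `exp (∑_{n < 0} (β(n) / (-n)) z^(-n)) = exp (∑_{n > 0} (β(-n) / n) z^n)`. -/
def expCreation (β : ι → ℚ) : Ser ι :=
  HahnSeries.ofPowerSeries ℤ (Heis ι)
    ((PowerSeries.exp (Heis ι)).subst
      (PowerSeries.mk fun n : ℕ =>
        if n = 0 then (0 : Heis ι)
        else MvPolynomial.C ((n : ℂ)⁻¹) * ∑ i, MvPolynomial.C ((β i : ℚ) : ℂ) *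
          MvPolynomial.X (i, n - 1)))

/-- `exp (∑_{n > 0} (β(n) / (-n)) z^(-n))`: the exponential of a derivation, hence the algebra
homomorphism with `α_j(-n) ↦ α_j(-n) - ⟨β, α_j⟩ z^(-n)`. -/
def expAnnihilation (G : Matrix ι ι ℚ) (β : ι → ℚ) :
    MvPolynomial (ι × ℕ) (Ser ι) →ₐ[Ser ι] Ser ι :=
  MvPolynomial.aeval fun y =>
    HahnSeries.single (0 : ℤ) (MvPolynomial.X y) -
      zmon (-((y.2 : ℤ) + 1)) ((G.mulVec β y.1 : ℚ) : ℂ)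

/-- `z^r` for an integer `r`. For a non-integral rational `r` the powers of `z` in
`Y(u, z) v` are not integers, and there is no contribution to the modes `u_n`, `n ∈ ℤ`. -/
def zpowRat (r : ℚ) : Ser ι := if r.den = 1 then zmon r.num 1 else 0

/-- The series `f(z)` with `Y(p ⊗ e^β, z) (q ⊗ e^γ) = f(z) ⊗ e^(β+γ)`. For a monomial
`p = α_{i_1}(-m_1-1) ⋯ α_{i_k}(-m_k-1)` the vertex operator is the normally ordered product
`: (1/m_1!) ∂^{m_1} α_{i_1}(z) ⋯ (1/m_k!) ∂^{m_k} α_{i_k}(z) Y(e^β, z) :`, with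
`Y(e^β, z) = exp(∑_{n<0} (β(n)/(-n)) z^(-n)) exp(∑_{n>0} (β(n)/(-n)) z^(-n)) e_β z^β`. -/
def vertexSeries (G : Matrix ι ι ℚ) (β γ : ι → ℚ) (p q : Heis ι) : Ser ι :=
  ∑ s ∈ p.support, zmon 0 (p.coeff s) *
    (expCreation β * zpowRat (pairing G β γ) *
      expAnnihilation G β
        (Multiset.foldr (normalStep G γ)
          (MvPolynomial.map (algebraMap ℂ (Ser ι)) q) (Finsupp.toMultiset s)))

/-- The `n`-th product `u_n v`, where `Y(u, z) v = ∑ u_n v z^(-n-1)`. -/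
def mode (G : Matrix ι ι ℚ) (n : ℤ) (u v : Fock ι) : Fock ι :=
  u.coeff.sum fun β p => v.coeff.sum fun γ q =>
    vec (β + γ) ((vertexSeries G β γ p q).coeff (-n - 1))

/-- The vacuum vector `1 ⊗ e^0`. -/
def vacuum : Fock ι := vec 0 1

/-- `α_i(-1) = α_i(-1) ⊗ e^0`. -/
def cartanVec (i : ι) : Fock ι := vec 0 (MvPolynomial.X (i, 0))

/-- The Virasoro element `½ ∑ β_i(-1)^2` (`(β_i)` an orthonormal basis of `𝔥`), written in the
basis `α` as `½ ∑ (G⁻¹)_{ij} α_i(-1) α_j(-1)`. -/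
def virasoro (G : Matrix ι ι ℚ) : Fock ι :=
  vec 0 (MvPolynomial.C (1 / 2 : ℂ) * ∑ i, ∑ j, MvPolynomial.C ((G⁻¹ i j : ℚ) : ℂ) *
    (MvPolynomial.X (i, 0) * MvPolynomial.X (j, 0)))

end Vertex

/-! ### The spaces `V_X` and maps between them -/

/-- `V_X = M(1) ⊗ ℂ[X]`, as the subspace of vectors supported on `X`. -/
def V {ι : Type} (X : Set (ι → ℚ)) : Submodule ℂ (Fock ι) where
  carrier := {u | ∀ β, u.coeff β ≠ 0 → β ∈ X}
  zero_mem' := by intro β h; simp at h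
  add_mem' := by
    intro u v hu hv β h
    by_cases h1 : u.coeff β = 0
    · by_cases h2 : v.coeff β = 0
      · exact absurd (by simp [h1, h2]) h
      · exact hv β h2
    · exact hu β h1
  smul_mem' := by
    intro c u hu β h
    refine hu β fun h0 => h ?_
    simp [h0]

/-- The lattice `L = ⊕ ℤ α_i` itself. -/
def intLattice (ι : Type) [DecidableEq ι] : AddSubgroup (ι → ℚ) :=
  AddSubgroup.closure (Set.range fun i => Pi.single i (1 : ℚ))

/-- The coset `M + x`. -/
def coset {ι : Type} (M : AddSubgroup (ι → ℚ)) (x : ι → ℚ) : Set (ι → ℚ) := {y | y - x ∈ M}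

/-- The map induced by a linear map `A` of the underlying spaces:
`h(-n) ↦ (A h)(-n)`, `e^β ↦ e^(A β)`. -/
def inducedMap {ι κ : Type} [Fintype ι] [DecidableEq ι] [Fintype κ] (A : Matrix κ ι ℚ) :
    Fock ι →ₐ[ℂ] Fock κ :=
  (AddMonoidAlgebra.mapDomainAlgHom ℂ (Heis κ) A.mulVecLin.toAddMonoidHom).comp
    (AddMonoidAlgebra.mapAlgHom (ι → ℚ)
      (MvPolynomial.aeval fun x : ι × ℕ =>
        ∑ k, MvPolynomial.C ((A k x.1 : ℚ) : ℂ) * (MvPolynomial.X (k, x.2) : Heis κ)))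

/-- The automorphism induced by the isometry `β ↦ -β`. -/
def negLift {ι : Type} [Fintype ι] [DecidableEq ι] : Fock ι →ₐ[ℂ] Fock ι :=
  inducedMap (-1 : Matrix ι ι ℚ)

/-- `U⁺`, the fixed points in `U` of the lift of `-1`. -/
def plus {ι : Type} [Fintype ι] [DecidableEq ι] (U : Submodule ℂ (Fock ι)) :
    Submodule ℂ (Fock ι) :=
  U ⊓ LinearMap.eqLocus (negLift (ι := ι)).toLinearMap LinearMap.id

/-- `U⁻`, the `-1`-eigenvectors in `U` of the lift of `-1`. -/
def minus {ι : Type} [Fintype ι] [DecidableEq ι] (U : Submodule ℂ (Fock ι)) :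
    Submodule ℂ (Fock ι) :=
  U ⊓ LinearMap.eqLocus (negLift (ι := ι)).toLinearMap (-LinearMap.id)

/-- `f : U → W` is an isomorphism of vertex operator algebras: a linear bijection that preserves
all products `u_n v` (under which `U` is closed), the vacuum and the Virasoro element. -/
structure IsVOAIso {ι κ : Type} [Fintype ι] [DecidableEq ι] [Fintype κ] [DecidableEq κ]
    (G : Matrix ι ι ℚ) (H : Matrix κ κ ℚ) {U : Submodule ℂ (Fock ι)} {W : Submodule ℂ (Fock κ)}
    (f : U ≃ₗ[ℂ] W) : Prop where
  map_mode : ∀ (n : ℤ) (u v : U), ∃ w : U, (w : Fock ι) = mode G n u v ∧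
    (f w : Fock κ) = mode H n (f u) (f v)
  map_vacuum : ∃ w : U, (w : Fock ι) = vacuum ∧ (f w : Fock κ) = vacuum
  map_virasoro : ∃ w : U, (w : Fock ι) = virasoro G ∧ (f w : Fock κ) = virasoro H

/-- The map `U ⊗ W → Fock υ`, `u ⊗ w ↦ u w`, induced by linear maps `A`, `B` of the
underlying spaces. When these identify an orthogonal sum of two lattices with a sublattice of a
third, it is the usual identification `V_X ⊗ V_Y = V_{X + Y}`,
`(p ⊗ e^β) ⊗ (q ⊗ e^γ) ↦ pq ⊗ e^(β+γ)`. -/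
def tensorMap {ι κ υ : Type} [Fintype ι] [DecidableEq ι] [Fintype κ] [DecidableEq κ] [Fintype υ]
    (A : Matrix υ ι ℚ) (B : Matrix υ κ ℚ) (U : Submodule ℂ (Fock ι))
    (W : Submodule ℂ (Fock κ)) : U ⊗[ℂ] W →ₗ[ℂ] Fock υ :=
  TensorProduct.lift
    (((LinearMap.mul ℂ (Fock υ)).compl₁₂ (inducedMap A).toLinearMap (inducedMap B).toLinearMap).domRestrict₁₂
      U W)

/-- The algebra `U ⊗ U'` acts on `W ⊗ W'` by `Y(u ⊗ u', z) = Y(u, z) ⊗ Y(u', z)`, and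
`u ⊗ w ↦ u w` identifies `W ⊗ W'`, together with this action, with `Z`.
(With `W = U`, `W' = U'`: `Z` is the tensor product vertex algebra `U ⊗ U'`.) -/
structure IsTensorModule {ι κ υ : Type} [Fintype ι] [DecidableEq ι] [Fintype κ] [DecidableEq κ]
    [Fintype υ] [DecidableEq υ] (G : Matrix ι ι ℚ) (H : Matrix κ κ ℚ) (K : Matrix υ υ ℚ)
    (A : Matrix υ ι ℚ) (B : Matrix υ κ ℚ) (U W : Submodule ℂ (Fock ι))
    (U' W' : Submodule ℂ (Fock κ)) (Z : Submodule ℂ (Fock υ)) : Prop where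
  injective : Function.Injective (tensorMap A B W W')
  range_eq : LinearMap.range (tensorMap A B W W') = Z
  left_mem : ∀ (n : ℤ), ∀ u ∈ U, ∀ w ∈ W, mode G n u w ∈ W
  right_mem : ∀ (n : ℤ), ∀ u ∈ U', ∀ w ∈ W', mode H n u w ∈ W'
  finite_support : ∀ (n : ℤ), ∀ u ∈ U, ∀ u' ∈ U', ∀ w ∈ W, ∀ w' ∈ W',
    {i : ℤ | inducedMap A (mode G i u w) * inducedMap B (mode H (n - 1 - i) u' w') ≠ 0}.Finite
  mode_eq : ∀ (n : ℤ), ∀ u ∈ U, ∀ u' ∈ U', ∀ w ∈ W, ∀ w' ∈ W',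
    mode K n (inducedMap A u * inducedMap B u') (inducedMap A w * inducedMap B w') =
      ∑ᶠ i : ℤ, inducedMap A (mode G i u w) * inducedMap B (mode H (n - 1 - i) u' w')

/-! ### The lattices -/

/-- Gram matrix of `ℤα` with `⟨α, α⟩ = 2`. -/
def gramA1 : Matrix (Fin 1) (Fin 1) ℚ := !![2]

/-- Gram matrix of `L = ℤα₁ ⊕ ℤα₂ ⊕ ℤα₃` with `⟨α_i, α_j⟩ = 2 δ_ij`. -/
def gramL : Matrix (Fin 3) (Fin 3) ℚ := (2 : ℚ) • 1

/-- Gram matrix of `√2 A_l` (in the basis of `√2` times the simple roots). -/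
def gramSqrtTwoA (l : ℕ) : Matrix (Fin l) (Fin l) ℚ :=
  (2 : ℚ) • (CartanMatrix.A l).map (fun a : ℤ => (a : ℚ))

/-- Gram matrix of `ℤγ` with `⟨γ, γ⟩ = 6`. -/
def gramF : Matrix (Fin 1) (Fin 1) ℚ := !![6]

/-- The columns are `√2β₁ = α₁ + α₂`, `√2β₂ = -α₂ + α₃`, `√2β₃ = -α₁ + α₂`. -/
def basisN : Matrix (Fin 3) (Fin 3) ℚ := !![1, 0, -1; 1, -1, 1; 0, 1, 0]

/-- The columns are `√2β₁ = α₁ + α₂` and `√2β₂ = -α₂ + α₃`. -/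
def basisE : Matrix (Fin 3) (Fin 2) ℚ := !![1, 0; 1, -1; 0, 1]

/-- The column is `γ = -α₁ + α₂ + α₃`. -/
def basisF : Matrix (Fin 3) (Fin 1) ℚ := !![-1; 1; 1]

/-- The column is `α_i`: the inclusion `ℤα → L`, `α ↦ α_i`. -/
def inclA1 (i : Fin 3) : Matrix (Fin 3) (Fin 1) ℚ := Matrix.of fun k _ => if k = i then 1 else 0

/-- `N = ∑_{i,j} ℤ(α_i ± α_j)`. -/
def latN : AddSubgroup (Fin 3 → ℚ) :=
  AddSubgroup.closure
    {x | ∃ i j : Fin 3, x = Pi.single i 1 + Pi.single j 1 ∨ x = Pi.single i 1 - Pi.single j 1}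

/-- `D = E + F ⊆ L`, with `E = ℤ√2β₁ + ℤ√2β₂` and `F = ℤγ`. -/
def latD : AddSubgroup (Fin 3 → ℚ) :=
  AddSubgroup.closure (Set.range basisE.transpose) ⊔
    AddSubgroup.closure (Set.range basisF.transpose)

/-- `V_{ℤα}`; as a space it is also `V_F`, `F = ℤγ`, with generator `γ` in place of `α`
(the vertex operators are those of the respective Gram matrix). -/
abbrev V1 : Submodule ℂ (Fock (Fin 1)) := V (intLattice (Fin 1))

/-- `V_L`. -/
abbrev VL : Submodule ℂ (Fock (Fin 3)) := V (intLattice (Fin 3))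

/-- `V_N ⊆ V_L`. -/
abbrev VN : Submodule ℂ (Fock (Fin 3)) := V latN

/-- `V_D ⊆ V_L`. -/
abbrev VD : Submodule ℂ (Fock (Fin 3)) := V latD

/-- `V_{D + α₂} ⊆ V_L`. -/
abbrev VDa : Submodule ℂ (Fock (Fin 3)) := V (coset latD (Pi.single 1 1))

/-- `V_E`, in the basis `√2β₁, √2β₂` of `E`. -/
abbrev VE : Submodule ℂ (Fock (Fin 2)) := V (intLattice (Fin 2))

/-- `V_{E + √2(β₁ - β₂)/3}`, in the basis `√2β₁, √2β₂` of `E`. -/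
abbrev VEa : Submodule ℂ (Fock (Fin 2)) := V (coset (intLattice (Fin 2)) ![1 / 3, -1 / 3])

/-- `V_F`, in the basis `γ` of `F`. -/
abbrev VF : Submodule ℂ (Fock (Fin 1)) := V (intLattice (Fin 1))

/-- `V_{F + γ/3}`, in the basis `γ` of `F`. -/
abbrev VFa : Submodule ℂ (Fock (Fin 1)) := V (coset (intLattice (Fin 1)) ![1 / 3])

/-- `(V_E⁺ ⊗ V_F⁺) ⊕ (V_E⁻ ⊗ V_F⁻) → V_L`. -/
def evenMap :
    (plus VE ⊗[ℂ] plus VF) × (minus VE ⊗[ℂ] minus VF) →ₗ[ℂ] Fock (Fin 3) :=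
  (tensorMap basisE basisF (plus VE) (plus VF)).coprod
    (tensorMap basisE basisF (minus VE) (minus VF))

/-- `V_{E + √2(β₁ - β₂)/3} ⊗ V_{F + γ/3} → V_L`. -/
def cosetMap : VEa ⊗[ℂ] VFa →ₗ[ℂ] Fock (Fin 3) := tensorMap basisE basisF VEa VFa

/-! ### The automorphisms -/

/-- `e^{kα}` in `V_{ℤα}`. -/
def expA1 (k : ℤ) : Fock (Fin 1) := vec (fun _ => (k : ℚ)) 1

/-- `σ` is an automorphism of the vertex operator algebra `V_{ℤα}` with `α(-1) ↦ e^α + e^{-α}`,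
`e^α + e^{-α} ↦ α(-1)` and `e^α - e^{-α} ↦ -(e^α - e^{-α})`. -/
structure IsSigma (σ : V1 ≃ₗ[ℂ] V1) : Prop where
  aut : IsVOAIso gramA1 gramA1 σ
  cartan : ∃ w : V1, (w : Fock (Fin 1)) = cartanVec 0 ∧
    (σ w : Fock (Fin 1)) = expA1 1 + expA1 (-1)
  add : ∃ w : V1, (w : Fock (Fin 1)) = expA1 1 + expA1 (-1) ∧
    (σ w : Fock (Fin 1)) = cartanVec 0
  sub : ∃ w : V1, (w : Fock (Fin 1)) = expA1 1 - expA1 (-1) ∧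
    (σ w : Fock (Fin 1)) = -(expA1 1 - expA1 (-1))

/-- The vector of `V_L` that is identified with
`u ⊗ v ⊗ w ∈ V_{ℤα₁} ⊗ V_{ℤα₂} ⊗ V_{ℤα₃}`. -/
def tensorCube (u v w : Fock (Fin 1)) : Fock (Fin 3) :=
  inducedMap (inclA1 0) u * inducedMap (inclA1 1) v * inducedMap (inclA1 2) w

/-- `τ = σ ⊗ σ ⊗ σ` on `V_L = V_{ℤα₁} ⊗ V_{ℤα₂} ⊗ V_{ℤα₃}`. -/
def IsCube (σ : V1 ≃ₗ[ℂ] V1) (τ : VL ≃ₗ[ℂ] VL) : Prop :=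
  ∀ u v w : V1, ∃ x : VL, (x : Fock (Fin 3)) = tensorCube u v w ∧
    (τ x : Fock (Fin 3)) = tensorCube (σ u) (σ v) (σ w)

end LatticeVOA

end

open LatticeVOA

open scoped TensorProduct

noncomputable section

namespace LatticeVOA

set_option linter.unusedSectionVars false

/-! ### Wick products -/

section Wick

variable {X S T : Type*} [CommRing S] [CommRing T]

/-! Everything rests on one description of vertex operators. On `p ⊗ e^β` and `q ⊗ e^γ` the series
is an exponential factor times `z^⟨β,γ⟩` times a bilinear form `wick` in `p` and `q`: each factor of
`p` is either contracted with a factor of `q` or replaced by its creation part plus zero mode, and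
what is left of `q` is evaluated by the annihilation part of `e^β(z)` (`vertexSeries_eq`). For an
orthogonal sum of lattices the mixed contractions vanish, so `wick` and with it the vertex operators
factor (`wick_split`, `vertexSeries_tensor`, `mode_tensor`). This yields the tensor product
statements and, with a zero summand, the homomorphisms induced by isometries (`mode_inducedMap`).

The substantial point is the existence of `σ`. The zero mode of `e^α` is a derivation of all
products. Indeed `e^α(w) Y(u,z) v`, `Y(u,z) e^α(w) v` and `Y(e^α(w-z) u, z) v` are the expansions,
in three regions, of the same finite sum of terms `w^(s-i) (w-z)^(r-j)` times the creation part of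
`e^α(w)` times a series in `z`. Comparing residues in `w` gives the commutator formula
(`choose_residue`, `map_expResidue_eq`, `expZero_coeff_vertexSeries`). On `V_{ℤα}` the zero modes of
`e^{±α}` are nilpotent on generators, hence locally nilpotent, so their exponentials preserve all
products. Then `σ` is the product of such an exponential, a torus element and the opposite
exponential, a Gauss decomposition in the group of the `sl₂` spanned by `e^{±α}` and `α(-1)`. It is
unique because the vacuum, `α(-1)` and `e^{±α}` generate (`eq_top_of_closed`).

For `τ(V_N) = V_L⁺`: `σ` conjugates the twist `e^{kα} ↦ (-1)^k e^{kα}` into the lift of `-1`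
(`negV1_sigma`), so `τ` does the same on `V_L`. As `N` consists of the vectors with even coordinate
sum, `V_N` is the fixed space of the twist and is carried onto the fixed space of the lift of `-1`.

Finally `D` has index 3 in `L`, with cosets `D`, `D + α₂` and `-(D + α₂)`. The lift `θ` of `-1`
preserves `V_D` and exchanges the other two summands, so a fixed vector amounts to a fixed vector of
`V_D` and an arbitrary vector of `V_{D+α₂}` (`exists_plus_equiv`). The two pieces split along `E ⊥
F`, using `α₂ = √2(β₁-β₂)/3 + γ/3` (`single_eq`) and the eigenspaces of `θ ⊗ θ`
(`plus_decomposition`). -/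

/-- The derivation of `S[X]` with `x_y ↦ m x y`. -/
def contract (m : X → X → S) (x : X) : Derivation S (MvPolynomial X S) (MvPolynomial X S) :=
  MvPolynomial.mkDerivation S fun y => MvPolynomial.C (m x y)

@[simp]
theorem contract_X (m : X → X → S) (x y : X) :
    contract m x (MvPolynomial.X y) = MvPolynomial.C (m x y) :=
  MvPolynomial.mkDerivation_X _ _ _

theorem contract_comm (m m' : X → X → S) (x y : X) (f : MvPolynomial X S) :
    contract m x (contract m' y f) = contract m' y (contract m x f) := by
  induction f using MvPolynomial.induction_on with
  | C a => simp
  | add p q hp hq => simp [hp, hq]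
  | mul_X p i hp =>
    simp only [Derivation.leibniz, map_add, contract_X, hp, smul_eq_mul, MvPolynomial.derivation_C]
    ring

/-- Multiplication by the value `c x`, plus contraction with `x`. -/
def wickStep (c : X → S) (m : X → X → S) (x : X) : Module.End S (MvPolynomial X S) :=
  c x • LinearMap.id + (contract m x).toLinearMap

theorem wickStep_apply (c : X → S) (m : X → X → S) (x : X) (f : MvPolynomial X S) :
    wickStep c m x f = c x • f + contract m x f := rfl

instance wickStep_leftComm (c : X → S) (m : X → X → S) :
    LeftCommutative fun x f => wickStep c m x f where
  left_comm x y f := by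
    simp only [wickStep_apply, map_add, Derivation.map_smul, contract_comm m m x y f,
      smul_comm (c x) (c y)]
    abel

/-- The map `q ↦ x_1 ⋯ x_k q` (with each `x_i` acting by `wickStep`). -/
def wickFold (c : X → S) (m : X → X → S) (s : Multiset X) : Module.End S (MvPolynomial X S) where
  toFun q := Multiset.foldr (fun x f => wickStep c m x f) q s
  map_add' p q := by
    induction s using Multiset.induction_on with
    | empty => rfl
    | cons x s ih => simp only [Multiset.foldr_cons, ih, map_add]
  map_smul' a q := by
    induction s using Multiset.induction_on with
    | empty => rfl
    | cons x s ih => simp only [Multiset.foldr_cons, ih, map_smul, RingHom.id_apply]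

theorem wickFold_apply (c : X → S) (m : X → X → S) (s : Multiset X) (q : MvPolynomial X S) :
    wickFold c m s q = Multiset.foldr (fun x f => wickStep c m x f) q s := rfl

theorem wickFold_cons (c : X → S) (m : X → X → S) (x : X) (s : Multiset X)
    (q : MvPolynomial X S) :
    wickFold c m (x ::ₘ s) q = wickStep c m x (wickFold c m s q) :=
  Multiset.foldr_cons _ _ _ _

/-- Since the steps commute, the step of `x` may also be performed first. This is what makes `wick`
computable by peeling variables off its first argument. -/
theorem wickFold_cons' (c : X → S) (m : X → X → S) (x : X) (s : Multiset X)
    (q : MvPolynomial X S) :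
    wickFold c m (x ::ₘ s) q = wickFold c m s (wickStep c m x q) := by
  induction s using Multiset.induction_on with
  | empty => rfl
  | cons y s ih =>
    rw [Multiset.cons_swap, wickFold_cons, ih, ← wickFold_cons]

/-- The bilinear form `(p, q) ↦ exp (∑ m x y ∂/∂x ⊗ ∂/∂y) (p ⊗ q)`, evaluated at `(c, d)`. -/
def wick (c d : X → S) (m : X → X → S) :
    MvPolynomial X S →ₗ[S] MvPolynomial X S →ₗ[S] S :=
  (MvPolynomial.basisMonomials X S).constr S fun s =>
    (MvPolynomial.aeval d).toLinearMap ∘ₗ wickFold c m (Finsupp.toMultiset s)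

theorem wick_monomial (c d : X → S) (m : X → X → S) (s : X →₀ ℕ) (a : S) (q : MvPolynomial X S) :
    wick c d m (MvPolynomial.monomial s a) q =
      a * MvPolynomial.aeval d (wickFold c m (Finsupp.toMultiset s) q) := by
  have : MvPolynomial.monomial s a = a • (MvPolynomial.basisMonomials X S) s := by
    simp [MvPolynomial.smul_monomial]
  rw [this, map_smul, wick, Module.Basis.constr_basis]
  simp

theorem wick_C (c d : X → S) (m : X → X → S) (a : S) (q : MvPolynomial X S) :
    wick c d m (MvPolynomial.C a) q = a * MvPolynomial.aeval d q := by
  rw [MvPolynomial.C_apply, wick_monomial]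
  simp [wickFold]

theorem wick_one (c d : X → S) (m : X → X → S) (q : MvPolynomial X S) :
    wick c d m 1 q = MvPolynomial.aeval d q := by
  simpa using wick_C c d m 1 q

theorem wick_X_mul (c d : X → S) (m : X → X → S) (x : X) (p q : MvPolynomial X S) :
    wick c d m (MvPolynomial.X x * p) q = wick c d m p (wickStep c m x q) := by
  induction p using MvPolynomial.induction_on' with
  | add p p' h h' => simp only [mul_add, map_add, LinearMap.add_apply, h, h']
  | monomial s a =>
    rw [MvPolynomial.X, MvPolynomial.monomial_mul, one_mul, wick_monomial, wick_monomial,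
      map_add, Finsupp.toMultiset_single, one_smul, Multiset.singleton_add, wickFold_cons']

theorem wick_mul_X (c d : X → S) (m : X → X → S) (x : X) (p q : MvPolynomial X S) :
    wick c d m (p * MvPolynomial.X x) q = wick c d m p (wickStep c m x q) := by
  rw [mul_comm, wick_X_mul]

/-- A variable of the second argument either survives, and is evaluated at `d y`, or is contracted
with one factor of `p`. It is the mirror image of `wick_X_mul`, and the two recursions together give
`wick_symm`. -/
theorem wick_X_right (c d : X → S) (m : X → X → S) (y : X) (p q : MvPolynomial X S) :
    wick c d m p (MvPolynomial.X y * q) =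
      d y * wick c d m p q + wick c d m (contract (fun a b => m b a) y p) q := by
  induction p using MvPolynomial.induction_on generalizing q with
  | C a => simp [wick_C]; ring
  | add p p' h h' => simp only [map_add, LinearMap.add_apply, h, h']; ring
  | mul_X p x h =>
    rw [wick_mul_X, wickStep_apply, Derivation.leibniz, contract_X]
    have e : c x • (MvPolynomial.X y * q) + ((MvPolynomial.X y : MvPolynomial X S) • contract m x q +
        q • MvPolynomial.C (m x y)) = MvPolynomial.X y * wickStep c m x q + m x y • q := by
      simp only [wickStep_apply, smul_eq_mul, MvPolynomial.smul_eq_C_mul]; ring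
    rw [e, map_add, h, map_smul, Derivation.leibniz, contract_X, wick_mul_X]
    simp only [smul_eq_mul, map_add, LinearMap.add_apply]
    rw [mul_comm p (MvPolynomial.C _), ← MvPolynomial.smul_eq_C_mul, map_smul, wick_X_mul]
    simp only [LinearMap.smul_apply, smul_eq_mul]
    ring

/-- The form sums over partial matchings between factors of `p` and factors of `q`, and a matching
has no preferred side. The symmetry lets `wick_mul_exp`, which inserts an exponential on the right,
serve on the left as well. -/
theorem wick_symm (c d : X → S) (m : X → X → S) (p q : MvPolynomial X S) :
    wick c d m p q = wick d c (fun a b => m b a) q p := by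
  induction q using MvPolynomial.induction_on generalizing p with
  | C a =>
    rw [wick_C, ← mul_one (MvPolynomial.C a), ← MvPolynomial.smul_eq_C_mul, map_smul, smul_eq_mul]
    congr 1
    induction p using MvPolynomial.induction_on with
    | C a => simp [wick_C]
    | add p p' h h' => simp [h, h']
    | mul_X p x h => simp [wick_mul_X, wickStep_apply, h, mul_comm]
  | add p p' h h' => simp only [map_add, LinearMap.add_apply, h, h']
  | mul_X q y h =>
    rw [mul_comm, wick_X_right, wick_X_mul, h, h, wickStep_apply, map_add, map_smul, smul_eq_mul]

theorem map_contract (φ : S →+* T) (m : X → X → S) (x : X) (q : MvPolynomial X S) :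
    MvPolynomial.map φ (contract m x q) =
      contract (fun x y => φ (m x y)) x (MvPolynomial.map φ q) := by
  induction q using MvPolynomial.induction_on with
  | C a => simp
  | add p q hp hq => simp [hp, hq]
  | mul_X p i hp => simp [Derivation.leibniz, hp]

theorem map_wick (φ : S →+* T) (c d : X → S) (m : X → X → S) (p q : MvPolynomial X S) :
    φ (wick c d m p q) =
      wick (fun x => φ (c x)) (fun x => φ (d x)) (fun x y => φ (m x y))
        (MvPolynomial.map φ p) (MvPolynomial.map φ q) := by
  have hstep : ∀ x q, MvPolynomial.map φ (wickStep c m x q) =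
      wickStep (fun x => φ (c x)) (fun x y => φ (m x y)) x (MvPolynomial.map φ q) := by
    intro x q
    simp [wickStep_apply, map_contract, MvPolynomial.smul_eq_C_mul]
  induction p using MvPolynomial.induction_on generalizing q with
  | C a =>
    rw [wick_C, MvPolynomial.map_C, wick_C, map_mul]
    congr 1
    rw [MvPolynomial.aeval_def, MvPolynomial.aeval_def, MvPolynomial.eval₂_map,
      MvPolynomial.hom_eval₂]
    rfl
  | add p p' h h' => simp only [map_add, LinearMap.add_apply, h, h']
  | mul_X p x h =>
    rw [wick_mul_X, h, hstep, map_mul, MvPolynomial.map_X, wick_mul_X]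

/-- The substitution `x ↦ x + c x`. -/
def shift (c : X → S) : MvPolynomial X S →ₐ[S] MvPolynomial X S :=
  MvPolynomial.aeval fun x => MvPolynomial.X x + MvPolynomial.C (c x)

theorem wick_shift_left (c c' d : X → S) (m : X → X → S) (p q : MvPolynomial X S) :
    wick (fun x => c x + c' x) d m p q = wick c d m (shift c' p) q := by
  induction p using MvPolynomial.induction_on generalizing q with
  | C a => simp [wick_C, shift, MvPolynomial.algebraMap_eq]
  | add p p' h h' => simp only [map_add, LinearMap.add_apply, h, h']
  | mul_X p x h =>
    have e : wickStep (fun x => c x + c' x) m x q = wickStep c m x q + c' x • q := by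
      simp only [wickStep_apply, add_smul]; abel
    rw [wick_mul_X, e, map_add, h, h, map_smul, map_mul, shift, MvPolynomial.aeval_X, mul_add,
      map_add, LinearMap.add_apply, wick_mul_X, mul_comm _ (MvPolynomial.C _),
      ← MvPolynomial.smul_eq_C_mul, map_smul, LinearMap.smul_apply]

theorem wick_shift_right (c d d' : X → S) (m : X → X → S) (p q : MvPolynomial X S) :
    wick c (fun x => d x + d' x) m p q = wick c d m p (shift d' q) := by
  rw [wick_symm, wick_shift_left, ← wick_symm]

/-- Multiplication of the second argument by a family `h` that behaves like the coefficients of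
the exponential of a linear form. -/
theorem wick_mul_exp (c d : X → S) (m : X → X → S) (μ : X → PowerSeries S)
    (h : ℕ → MvPolynomial X S)
    (hh : ∀ x n, contract m x (h n) =
      ∑ ij ∈ Finset.HasAntidiagonal.antidiagonal n, PowerSeries.coeff ij.1 (μ x) • h ij.2)
    (p q : MvPolynomial X S) :
    PowerSeries.mk (fun n => wick c d m p (q * h n)) =
      PowerSeries.mk (fun n => MvPolynomial.aeval d (h n)) *
        wick (fun x => PowerSeries.C (c x) + μ x) (fun x => PowerSeries.C (d x))
          (fun x y => PowerSeries.C (m x y))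
          (MvPolynomial.map PowerSeries.C p) (MvPolynomial.map PowerSeries.C q) := by
  induction p using MvPolynomial.induction_on generalizing q with
  | C a =>
    have e : MvPolynomial.aeval (fun x => PowerSeries.C (d x)) (MvPolynomial.map PowerSeries.C q) =
        PowerSeries.C (MvPolynomial.aeval d q) := by
      rw [MvPolynomial.aeval_def, MvPolynomial.aeval_def, MvPolynomial.eval₂_map,
        MvPolynomial.hom_eval₂]
      rfl
    rw [MvPolynomial.map_C, wick_C, e]
    ext n
    rw [← map_mul, PowerSeries.coeff_mul_C, PowerSeries.coeff_mk, PowerSeries.coeff_mk, wick_C,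
      map_mul]
    ring
  | add p p' h h' =>
    simp only [map_add, LinearMap.add_apply, mul_add, ← h, ← h']
    rfl
  | mul_X p x ih =>
    -- Contracting `x` with the exponential returns the exponential times `μ x`; this is the shift
    -- of `c x` by `μ x`.
    have e : ∀ n, wick c d m (p * MvPolynomial.X x) (q * h n) =
        wick c d m p (wickStep c m x q * h n) +
          ∑ ij ∈ Finset.HasAntidiagonal.antidiagonal n, PowerSeries.coeff ij.1 (μ x) *
            wick c d m p (q * h ij.2) := by
      intro n
      rw [wick_mul_X, wickStep_apply, Derivation.leibniz, hh, smul_eq_mul, Finset.mul_sum,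
        wickStep_apply, add_mul, map_add, map_add, map_add, map_sum]
      simp only [mul_smul_comm, map_smul, smul_eq_mul, smul_mul_assoc]
      rw [mul_comm (h n)]
      abel
    have e' : PowerSeries.mk (fun n => wick c d m (p * MvPolynomial.X x) (q * h n)) =
        PowerSeries.mk (fun n => wick c d m p (wickStep c m x q * h n)) +
          μ x * PowerSeries.mk (fun n => wick c d m p (q * h n)) := by
      ext n
      rw [PowerSeries.coeff_mk, e, map_add, PowerSeries.coeff_mk, PowerSeries.coeff_mul]
      simp
    have hstep : wickStep (fun x => PowerSeries.C (c x) + μ x)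
          (fun x y => PowerSeries.C (m x y)) x (MvPolynomial.map PowerSeries.C q) =
        MvPolynomial.map PowerSeries.C (wickStep c m x q) +
          μ x • MvPolynomial.map PowerSeries.C q := by
      rw [wickStep_apply, wickStep_apply, map_add, map_contract, add_smul]
      simp only [MvPolynomial.smul_eq_C_mul, map_mul, MvPolynomial.map_C]
      abel
    rw [e', ih, ih, map_mul, MvPolynomial.map_X, wick_mul_X, hstep, map_add, map_smul, smul_eq_mul]
    ring

end Wick

/-! ### Formal series -/

section Series

open PowerSeries (derivative)

variable {A B : Type*} [CommRing A] [CommRing B]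

/-- The ring need not be a domain, but `n + 1` is a unit because of the rational scalars. -/
theorem natCast_succ_mul_cancel [Algebra ℚ A] {a b : A} {n : ℕ}
    (h : a * ((n : A) + 1) = b * ((n : A) + 1)) : a = b := by
  have hu : ((n : A) + 1) * algebraMap ℚ A (1 / ((n : ℚ) + 1)) = 1 := by
    have : ((n : A) + 1) = algebraMap ℚ A ((n : ℚ) + 1) := by simp
    rw [this, ← map_mul, mul_one_div_cancel (by positivity), map_one]
  have := congrArg (· * algebraMap ℚ A (1 / ((n : ℚ) + 1))) h
  simpa only [mul_assoc, hu, mul_one] using this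

/-- The equation expresses `n + 1` times the coefficient of index `n + 1` through the earlier ones.
All later identities between exponential series are proved by this, so that substitution into `exp`
is met only once, in `isExpInt_exp_subst`. -/
theorem powerSeries_ode_unique [Algebra ℚ A] {l F G : PowerSeries A}
    (hF : derivative A F = l * F) (hG : derivative A G = l * G)
    (h0 : PowerSeries.constantCoeff F = PowerSeries.constantCoeff G) : F = G := by
  ext n
  induction n using Nat.strong_induction_on with
  | _ n ih =>
    cases n with
    | zero => simpa using h0
    | succ n =>
      have e1 := congrArg (PowerSeries.coeff n) hF
      have e2 := congrArg (PowerSeries.coeff n) hG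
      rw [PowerSeries.coeff_derivative, PowerSeries.coeff_mul] at e1 e2
      have : PowerSeries.coeff (n + 1) F * ((n : A) + 1) =
          PowerSeries.coeff (n + 1) G * ((n : A) + 1) := by
        rw [e1, e2]
        refine Finset.sum_congr rfl fun ij hij => ?_
        rw [ih _ (Nat.lt_succ_of_le (Finset.HasAntidiagonal.mem_antidiagonal.1 hij ▸
          Nat.le_add_left _ _))]
      exact natCast_succ_mul_cancel this

/-- `F = exp (∫ l)`. -/
structure IsExpInt (l F : PowerSeries A) : Prop where
  deriv : derivative A F = l * F
  constantCoeff : PowerSeries.constantCoeff F = 1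

theorem IsExpInt.unique [Algebra ℚ A] {l F G : PowerSeries A} (hF : IsExpInt l F)
    (hG : IsExpInt l G) : F = G :=
  powerSeries_ode_unique hF.deriv hG.deriv (hF.constantCoeff.trans hG.constantCoeff.symm)

theorem IsExpInt.mul {l l' F F' : PowerSeries A} (hF : IsExpInt l F) (hF' : IsExpInt l' F') :
    IsExpInt (l + l') (F * F') where
  deriv := by
    rw [Derivation.leibniz, hF.deriv, hF'.deriv, smul_eq_mul, smul_eq_mul]; ring
  constantCoeff := by rw [map_mul, hF.constantCoeff, hF'.constantCoeff, one_mul]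

theorem derivative_powerSeries_map (φ : A →+* B) (F : PowerSeries A) :
    derivative B (PowerSeries.map φ F) = PowerSeries.map φ (derivative A F) := by
  ext n
  simp [PowerSeries.coeff_derivative]

theorem IsExpInt.map {l F : PowerSeries A} (hF : IsExpInt l F) (φ : A →+* B) :
    IsExpInt (PowerSeries.map φ l) (PowerSeries.map φ F) where
  deriv := by rw [derivative_powerSeries_map, hF.deriv, map_mul]
  constantCoeff := by
    rw [← PowerSeries.coeff_zero_eq_constantCoeff_apply, PowerSeries.coeff_map,
      PowerSeries.coeff_zero_eq_constantCoeff_apply, hF.constantCoeff, map_one]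

theorem isExpInt_exp_subst [Algebra ℚ A] {F : PowerSeries A}
    (hF : PowerSeries.constantCoeff F = 0) :
    IsExpInt (derivative A F) ((PowerSeries.exp A).subst F) where
  deriv := by
    rw [PowerSeries.derivative_subst (PowerSeries.HasSubst.of_constantCoeff_zero' hF),
      PowerSeries.derivative_exp, mul_comm]
  constantCoeff := by
    have h := PowerSeries.constantCoeff_subst
      (PowerSeries.HasSubst.of_constantCoeff_zero' hF) (PowerSeries.exp A)
    rw [finsum_eq_single _ 0 fun n hn => ?_] at h
    · refine Eq.trans h ?_
      simp
    · rw [map_pow]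
      change _ • PowerSeries.constantCoeff F ^ n = 0
      rw [hF, zero_pow hn, smul_zero]

/-- `(1 - c X) ^ a`. -/
def binom (c : A) (a : ℤ) : PowerSeries A :=
  PowerSeries.rescale (-c) (PowerSeries.binomialSeries A a)

theorem coeff_binom (c : A) (a : ℤ) (n : ℕ) :
    PowerSeries.coeff n (binom c a) = (-c) ^ n * (Ring.choose a n : ℤ) := by
  simp [binom, PowerSeries.coeff_rescale]

theorem binom_add (c : A) (a b : ℤ) : binom c (a + b) = binom c a * binom c b := by
  simp [binom, PowerSeries.binomialSeries_add]

theorem binom_zero (c : A) : binom c 0 = 1 := by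
  simp [binom]

theorem binom_pow (c : A) (a : ℤ) (n : ℕ) : binom c a ^ n = binom c (n * a) := by
  induction n with
  | zero => simp [binom_zero]
  | succ n ih => rw [pow_succ, ih, ← binom_add]; congr 1; push_cast; ring

/-- These are the binomial coefficients in the divided derivatives of `α_i(z)`; the formula turns
contractions and creation parts into powers of geometric series. -/
theorem coeff_binom_neg (c : A) (m n : ℕ) :
    PowerSeries.coeff n (binom c (-(m + 1))) = ((n + m).choose m : ℕ) * c ^ n := by
  rw [coeff_binom, Ring.choose_neg]
  have : (m : ℤ) + 1 + n - 1 = ((n + m : ℕ) : ℤ) := by push_cast; ring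
  rw [this, Ring.choose_natCast, Nat.choose_symm_add, neg_pow]
  rcases Nat.even_or_odd n with h | h <;> simp [h.neg_one_pow, Int.negOnePow_even, Int.negOnePow_odd, h, mul_comm]

/-- The logarithmic derivative of `(1 - cX)^a` is `-ac / (1 - cX)`, a geometric series. -/
theorem isExpInt_binom (c : A) (a : ℤ) :
    IsExpInt (PowerSeries.mk fun k => -(a : A) * c ^ (k + 1)) (binom c a) where
  deriv := by
    have h1 : (PowerSeries.mk fun k => -(a : A) * c ^ (k + 1)) =
        PowerSeries.C (-(a : A) * c) * binom c (-1) := by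
      ext n
      rw [PowerSeries.coeff_mk, PowerSeries.coeff_C_mul]
      have := coeff_binom_neg c 0 n
      simp only [Nat.cast_zero, zero_add, add_zero, Nat.choose_zero_right, Nat.cast_one,
        one_mul] at this
      rw [this]; ring
    rw [h1, mul_assoc, ← binom_add]
    ext n
    rw [PowerSeries.coeff_derivative, PowerSeries.coeff_C_mul, coeff_binom, coeff_binom]
    have h2 := Ring.choose_smul_choose a (n := n + 1) (k := 1) (by omega)
    simp only [Nat.choose_one_right, Ring.choose_one_right, Nat.cast_one, Nat.add_sub_cancel,
      nsmul_eq_mul] at h2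
    have h3 := congrArg (Int.cast (R := A)) h2
    push_cast at h3
    rw [show -1 + a = a - 1 by ring, mul_assoc, mul_comm _ ((n : A) + 1), h3]
    ring
  constantCoeff := by
    rw [← PowerSeries.coeff_zero_eq_constantCoeff_apply, coeff_binom]; simp

/-- Coefficientwise application of a ring homomorphism to Laurent series. -/
def laurentMap (φ : A →+* B) : LaurentSeries A →+* LaurentSeries B where
  toFun f := f.map φ
  map_zero' := by ext; simp
  map_one' := by
    ext n
    simp only [HahnSeries.map_coeff, HahnSeries.coeff_one]
    split_ifs <;> simp
  map_add' f g := by ext; simp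
  map_mul' f g := HahnSeries.map_mul φ.toNonUnitalRingHom

@[simp]
theorem coeff_laurentMap (φ : A →+* B) (f : LaurentSeries A) (n : ℤ) :
    (laurentMap φ f).coeff n = φ (f.coeff n) := rfl

theorem laurentMap_single (φ : A →+* B) (n : ℤ) (a : A) :
    laurentMap φ (HahnSeries.single n a) = HahnSeries.single n (φ a) := by
  ext m
  rw [coeff_laurentMap, HahnSeries.coeff_single, HahnSeries.coeff_single]
  split_ifs <;> simp

theorem coeff_ofPowerSeries (F : PowerSeries A) (n : ℤ) :
    (HahnSeries.ofPowerSeries ℤ A F).coeff n =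
      if n < 0 then 0 else PowerSeries.coeff n.natAbs F :=
  PowerSeries.coeff_coe F n

theorem coeff_ofPowerSeries_natCast (F : PowerSeries A) (n : ℕ) :
    (HahnSeries.ofPowerSeries ℤ A F).coeff n = PowerSeries.coeff n F := by
  simp [coeff_ofPowerSeries]

theorem laurentMap_ofPowerSeries (φ : A →+* B) (F : PowerSeries A) :
    laurentMap φ (HahnSeries.ofPowerSeries ℤ A F) =
      HahnSeries.ofPowerSeries ℤ B (PowerSeries.map φ F) := by
  ext n
  rw [coeff_laurentMap, coeff_ofPowerSeries, coeff_ofPowerSeries]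
  split_ifs <;> simp

/-! ### Taylor expansion of Laurent series -/

theorem coeff_hasseDeriv (k : ℕ) (f : LaurentSeries A) (n : ℤ) :
    (LaurentSeries.hasseDeriv A k f).coeff n = (Ring.choose (n + k) k : ℤ) * f.coeff (n + k) := by
  rw [LaurentSeries.hasseDeriv_coeff, zsmul_eq_mul]

/-- The Euler operator `z d/dz` multiplies the coefficient of index `n` by `n`, and `n = i + j` for
every pair contributing to the product. The factor `z` also keeps supports from growing, so all
three sums run over the same pairs; it is cancelled at the end. -/
theorem hasseDeriv_one_mul (f g : LaurentSeries A) :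
    LaurentSeries.hasseDeriv A 1 (f * g) =
      LaurentSeries.hasseDeriv A 1 f * g + f * LaurentSeries.hasseDeriv A 1 g := by
  have key : ∀ (h : LaurentSeries A) (n : ℤ),
      (HahnSeries.single (1 : ℤ) (1 : A) * LaurentSeries.hasseDeriv A 1 h).coeff n =
        n * h.coeff n := by
    intro h n
    have := HahnSeries.coeff_single_mul_add (r := (1 : A)) (x := LaurentSeries.hasseDeriv A 1 h)
      (a := n - 1) (b := 1)
    rw [sub_add_cancel, one_mul] at this
    rw [this, coeff_hasseDeriv]
    simp
  have hs : ∀ h : LaurentSeries A,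
      (HahnSeries.single (1 : ℤ) (1 : A) * LaurentSeries.hasseDeriv A 1 h).support ⊆
        h.support := by
    intro h n hn h0
    exact hn (by rw [key, h0, mul_zero])
  have h1 : HahnSeries.single (1 : ℤ) (1 : A) * LaurentSeries.hasseDeriv A 1 (f * g) =
      HahnSeries.single (1 : ℤ) (1 : A) * (LaurentSeries.hasseDeriv A 1 f * g +
        f * LaurentSeries.hasseDeriv A 1 g) := by
    rw [mul_add, ← mul_assoc, mul_left_comm]
    ext n
    rw [key, HahnSeries.coeff_add, HahnSeries.coeff_mul_left' f.isPWO_support (hs f),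
      HahnSeries.coeff_mul_right' g.isPWO_support (hs g), HahnSeries.coeff_mul, Finset.mul_sum,
      ← Finset.sum_add_distrib]
    refine Finset.sum_congr rfl fun ij hij => ?_
    have : ij.1 + ij.2 = n := (Finset.mem_antidiagonal.1 hij).2.2
    rw [key, key, ← this]
    push_cast
    ring
  have h2 := congrArg (HahnSeries.single (-1 : ℤ) (1 : A) * ·) h1
  simpa [← mul_assoc, HahnSeries.single_mul_single] using h2

/-- The `w`-derivative of `f(z + w)` is `f'(z + w)`. -/
theorem derivative_mk_hasseDeriv (f : LaurentSeries A) :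
    derivative _ (PowerSeries.mk fun n => LaurentSeries.hasseDeriv A n f) =
      PowerSeries.mk fun n => LaurentSeries.hasseDeriv A n (LaurentSeries.hasseDeriv A 1 f) := by
  ext n : 1
  rw [PowerSeries.coeff_derivative, PowerSeries.coeff_mk, PowerSeries.coeff_mk,
    LaurentSeries.hasseDeriv_comp]
  simp [mul_comm]

variable [Algebra ℚ A]

/-- `f(z) ↦ f(z + w)`, as a power series in `w`. -/
def taylor : LaurentSeries A →+* PowerSeries (LaurentSeries A) where
  toFun f := PowerSeries.mk fun n => LaurentSeries.hasseDeriv A n f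
  map_zero' := by ext; simp
  map_one' := by
    ext n : 1
    rw [PowerSeries.coeff_mk, ← HahnSeries.single_zero_one, LaurentSeries.hasseDeriv_single,
      PowerSeries.coeff_one, Ring.choose_zero_ite]
    split_ifs with h <;> simp [h]
  map_add' f g := by ext; simp
  map_mul' f g := by
    ext n : 1
    induction n generalizing f g with
    | zero => simp [PowerSeries.coeff_mul]
    | succ n ih =>
      -- Multiplied by `n + 1`, the coefficient of index `n + 1` becomes that of index `n` of the
      -- `w`-derivative. The Leibniz rules in `w` and in `z` then reduce the claim to the induction
      -- hypothesis for the pairs `(f', g)` and `(f, g')`.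
      apply natCast_succ_mul_cancel (n := n)
      rw [← PowerSeries.coeff_derivative, ← PowerSeries.coeff_derivative,
        derivative_mk_hasseDeriv, Derivation.leibniz, derivative_mk_hasseDeriv,
        derivative_mk_hasseDeriv, hasseDeriv_one_mul, smul_eq_mul, smul_eq_mul, map_add,
        mul_comm (PowerSeries.mk fun n => LaurentSeries.hasseDeriv A n g), ← ih, ← ih, ← map_add]
      congr 1
      ext m : 1
      simp [add_comm]

theorem coeff_taylor (f : LaurentSeries A) (n : ℕ) :
    PowerSeries.coeff n (taylor f) = LaurentSeries.hasseDeriv A n f := by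
  simp [taylor]

theorem derivative_taylor (f : LaurentSeries A) :
    derivative _ (taylor f) = taylor (LaurentSeries.hasseDeriv A 1 f) :=
  derivative_mk_hasseDeriv f

end Series

/-! ### Factorization of the Wick form on an orthogonal sum -/

section WickSplit

variable {S X Y Y' κ : Type*} [CommRing S] [Fintype κ]

/-- The substitution `y ↦ ∑ k, a y k • x_(e y k)`. -/
def linSubst (a : Y → κ → S) (e : Y → κ → X) : MvPolynomial Y S →ₐ[S] MvPolynomial X S :=
  MvPolynomial.aeval fun y => ∑ k, MvPolynomial.C (a y k) * MvPolynomial.X (e y k)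

theorem linSubst_X (a : Y → κ → S) (e : Y → κ → X) (y : Y) :
    linSubst a e (MvPolynomial.X y) =
      ∑ k, MvPolynomial.C (a y k) * MvPolynomial.X (e y k) :=
  MvPolynomial.aeval_X _ _

/-- A chain rule: contracting with the image of `y` after the substitution is the substitution after
contracting with `y`. Both sides are derivations along the substitution, so the variables decide. -/
theorem sum_contract_linSubst {a : Y → κ → S} {e : Y → κ → X} {b : Y' → κ → S} {f : Y' → κ → X}
    {m : X → X → S} {mY : Y' → S} {y : Y}
    (hm : ∀ y', ∑ k, ∑ k', a y k * (b y' k' * m (e y k) (f y' k')) = mY y')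
    (q : MvPolynomial Y' S) :
    ∑ k, a y k • contract m (e y k) (linSubst b f q) =
      linSubst b f (MvPolynomial.mkDerivation S (fun y' => MvPolynomial.C (mY y')) q) := by
  induction q using MvPolynomial.induction_on with
  | C a => simp [linSubst, MvPolynomial.algebraMap_eq]
  | add p q hp hq => simp only [map_add, smul_add, Finset.sum_add_distrib, hp, hq]
  | mul_X p y' hp =>
    have : ∀ k, contract m (e y k) (linSubst b f (MvPolynomial.X y')) =
        MvPolynomial.C (∑ k', b y' k' * m (e y k) (f y' k')) := by
      intro k
      simp [linSubst_X, Derivation.leibniz, mul_comm]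
    have e1 : ∀ k, a y k • contract m (e y k) (linSubst b f (p * MvPolynomial.X y')) =
        linSubst b f p * MvPolynomial.C (∑ k', a y k * (b y' k' * m (e y k) (f y' k'))) +
          linSubst b f (MvPolynomial.X y') * a y k • contract m (e y k) (linSubst b f p) := by
      intro k
      rw [map_mul, Derivation.leibniz, this, smul_add, ← Finset.mul_sum, map_mul,
        smul_eq_mul, smul_eq_mul, MvPolynomial.smul_eq_C_mul, MvPolynomial.smul_eq_C_mul,
        MvPolynomial.smul_eq_C_mul]
      ring
    rw [Finset.sum_congr rfl fun k _ => e1 k, Finset.sum_add_distrib, ← Finset.mul_sum,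
      ← Finset.mul_sum, hp, ← map_sum, hm, Derivation.leibniz, MvPolynomial.mkDerivation_X,
      map_add, smul_eq_mul, smul_eq_mul, map_mul, map_mul]
    congr 2
    rw [linSubst, MvPolynomial.aeval_C, MvPolynomial.algebraMap_eq]

/-- One summand is peeled off, with an inert factor `P` carried along. The statement is arranged to
be applied twice: first with `P` coming from the second summand, then with the roles exchanged and
`P = 1`. -/
theorem wick_split_left {a : Y → κ → S} {e : Y → κ → X} {b : Y' → κ → S} {f : Y' → κ → X}
    {c d : X → S} {m : X → X → S} {cA dA : Y → S} {mA : Y → Y → S}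
    (hc : ∀ y, ∑ k, a y k * c (e y k) = cA y)
    (hm : ∀ y y', ∑ k, ∑ k', a y k * (a y' k' * m (e y k) (e y' k')) = mA y y')
    (hab : ∀ y y', ∑ k, ∑ k', a y k * (b y' k' * m (e y k) (f y' k')) = 0)
    (P : MvPolynomial X S) (q' : MvPolynomial Y' S) (t : S)
    (hP : ∀ q, wick c d m P (linSubst a e q * linSubst b f q') = MvPolynomial.aeval dA q * t)
    (p q : MvPolynomial Y S) :
    wick c d m (linSubst a e p * P) (linSubst a e q * linSubst b f q') =
      wick cA dA mA p q * t := by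
  induction p using MvPolynomial.induction_on generalizing q with
  | C s =>
    rw [wick_C, linSubst, MvPolynomial.aeval_C, MvPolynomial.algebraMap_eq,
      ← MvPolynomial.smul_eq_C_mul, map_smul, LinearMap.smul_apply, ← linSubst, hP, smul_eq_mul,
      mul_assoc]
  | add p p' h h' => simp only [map_add, LinearMap.add_apply, add_mul, h, h']
  | mul_X p y ih =>
    have h0 : linSubst a e (p * MvPolynomial.X y) * P =
        ∑ k, MvPolynomial.C (a y k) * MvPolynomial.X (e y k) * (linSubst a e p * P) := by
      rw [map_mul, linSubst_X, ← Finset.sum_mul]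
      ring
    rw [wick_mul_X, ← ih, h0, map_sum, LinearMap.sum_apply]
    have h1 : ∀ k, wick c d m (MvPolynomial.C (a y k) * MvPolynomial.X (e y k) *
        (linSubst a e p * P)) (linSubst a e q * linSubst b f q') =
        wick c d m (linSubst a e p * P) (a y k • wickStep c m (e y k)
          (linSubst a e q * linSubst b f q')) := by
      intro k
      rw [mul_assoc, ← MvPolynomial.smul_eq_C_mul, map_smul, LinearMap.smul_apply, wick_X_mul,
        map_smul]
    rw [Finset.sum_congr rfl fun k _ => h1 k, ← map_sum]
    congr 1
    have h2 := sum_contract_linSubst (hm y) q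
    have h3 := sum_contract_linSubst (mY := fun _ => 0) (hab y) q'
    -- Orthogonality: a variable of the first summand has no contraction with `q'`.
    have h4 : MvPolynomial.mkDerivation S 
        (fun _ : Y' => (MvPolynomial.C (0 : S) : MvPolynomial Y' S)) q' = 0 := by
      have : (fun _ : Y' => (MvPolynomial.C (0 : S) : MvPolynomial Y' S)) = 0 := by
        ext1; simp
      rw [this]
      have : MvPolynomial.mkDerivation S (0 : Y' → MvPolynomial Y' S) = 0 :=
        MvPolynomial.derivation_ext fun i => by simp
      rw [this]; rfl
    rw [h4, map_zero] at h3
    simp only [wickStep_apply, smul_add, Finset.sum_add_distrib, Derivation.leibniz, map_add,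
      map_smul, add_mul, smul_mul_assoc]
    rw [← hc y, Finset.sum_smul]
    congr 1
    · simp only [smul_smul]
    · change _ = linSubst a e (MvPolynomial.mkDerivation S (fun y' => MvPolynomial.C (mA y y')) q) * _
      rw [← h2, Finset.sum_mul]
      simp only [smul_eq_mul]
      have : ∑ k, a y k • (linSubst a e q * contract m (e y k) (linSubst b f q')) = 0 := by
        simp only [← mul_smul_comm, ← Finset.mul_sum, h3, mul_zero]
      rw [this, zero_add]
      refine Finset.sum_congr rfl fun k _ => ?_
      rw [mul_comm, smul_mul_assoc]

theorem aeval_linSubst {a : Y → κ → S} {e : Y → κ → X} {d : X → S} {dA : Y → S}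
    (hd : ∀ y, ∑ k, a y k * d (e y k) = dA y) (r : MvPolynomial Y S) :
    MvPolynomial.aeval d (linSubst a e r) = MvPolynomial.aeval dA r := by
  rw [linSubst, ← AlgHom.comp_apply, MvPolynomial.comp_aeval]
  congr 2
  ext y
  simp [← hd]

/-- The Wick form on an orthogonal sum. -/
theorem wick_split {a : Y → κ → S} {e : Y → κ → X} {b : Y' → κ → S} {f : Y' → κ → X}
    {c d : X → S} {m : X → X → S} {cA dA : Y → S} {mA : Y → Y → S}
    {cB dB : Y' → S} {mB : Y' → Y' → S}
    (hcA : ∀ y, ∑ k, a y k * c (e y k) = cA y) (hdA : ∀ y, ∑ k, a y k * d (e y k) = dA y)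
    (hmA : ∀ y y', ∑ k, ∑ k', a y k * (a y' k' * m (e y k) (e y' k')) = mA y y')
    (hcB : ∀ y, ∑ k, b y k * c (f y k) = cB y) (hdB : ∀ y, ∑ k, b y k * d (f y k) = dB y)
    (hmB : ∀ y y', ∑ k, ∑ k', b y k * (b y' k' * m (f y k) (f y' k')) = mB y y')
    (hab : ∀ y y', ∑ k, ∑ k', a y k * (b y' k' * m (e y k) (f y' k')) = 0)
    (hba : ∀ y y', ∑ k, ∑ k', b y k * (a y' k' * m (f y k) (e y' k')) = 0)
    (p q : MvPolynomial Y S) (p' q' : MvPolynomial Y' S) :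
    wick c d m (linSubst a e p * linSubst b f p') (linSubst a e q * linSubst b f q') =
      wick cA dA mA p q * wick cB dB mB p' q' := by
  refine wick_split_left hcA hmA hab _ q' _ (fun q => ?_) p q
  rw [mul_comm (linSubst a e q), mul_comm (MvPolynomial.aeval dA q),
    ← mul_one (linSubst b f p')]
  refine wick_split_left hcB hmB hba 1 q _ (fun q' => ?_) p' q'
  rw [wick_one, map_mul, aeval_linSubst hdA, aeval_linSubst hdB]

end WickSplit

/-! ### Vertex operators in terms of the Wick form -/

section VertexSeries

open PowerSeries (derivative)

variable {ι : Type} [Fintype ι] [DecidableEq ι]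

/-- The constants in `M(1)((z))`. -/
def constHom (ι : Type) : ℂ →+* Ser ι := HahnSeries.C.comp MvPolynomial.C

theorem constHom_apply (c : ℂ) : constHom ι c = zmon 0 c := rfl

theorem algebraMap_ser : algebraMap ℂ (Ser ι) = constHom ι := by
  ext1 c
  rw [HahnSeries.algebraMap_apply', PowerSeries.algebraMap_apply, HahnSeries.ofPowerSeries_C]
  rfl

theorem constHom_mul (c : ℂ) (f : Ser ι) : constHom ι c * f = c • f := by
  refine HahnSeries.ext (funext fun n => ?_)
  rw [constHom_apply, HahnSeries.coeff_single_zero_mul, HahnSeries.coeff_smul,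
    MvPolynomial.smul_eq_C_mul]

/-- Polynomials over `ℂ` as polynomials over `M(1)((z))`. -/
def toSer : Heis ι →+* MvPolynomial (ι × ℕ) (Ser ι) := MvPolynomial.map (constHom ι)

/-- The multiplication part of `normalStep`. -/
def createAt (G : Matrix ι ι ℚ) (γ : ι → ℚ) (x : ι × ℕ) : Ser ι := creation x + zeroMode G γ x

/-- The value of `expAnnihilation` on a variable. -/
def annihAt (G : Matrix ι ι ℚ) (β : ι → ℚ) (y : ι × ℕ) : Ser ι :=
  HahnSeries.single (0 : ℤ) (MvPolynomial.X y) -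
    zmon (-((y.2 : ℤ) + 1)) ((G.mulVec β y.1 : ℚ) : ℂ)

/-- The contraction of two variables. -/
def contractAt (G : Matrix ι ι ℚ) (x y : ι × ℕ) : Ser ι :=
  zmon (-((y.2 : ℤ) + 1) - 1 - x.2)
      ((-1) ^ x.2 * (((y.2 + 1 + x.2).choose x.2 : ℕ) : ℂ) * (((y.2 + 1 : ℕ) : ℂ) *
        ((G x.1 y.1 : ℚ) : ℂ)))

theorem normalStep_eq (G : Matrix ι ι ℚ) (γ : ι → ℚ) (x : ι × ℕ)
    (f : MvPolynomial (ι × ℕ) (Ser ι)) :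
    normalStep G γ x f = wickStep (createAt G γ) (contractAt G) x f := by
  rw [normalStep, wickStep_apply, createAt, add_smul, add_assoc, add_comm (zeroMode G γ x • f)]
  rfl

theorem expAnnihilation_eq (G : Matrix ι ι ℚ) (β : ι → ℚ) :
    expAnnihilation G β = MvPolynomial.aeval (annihAt G β) := rfl

theorem foldr_normalStep (G : Matrix ι ι ℚ) (γ : ι → ℚ) (f : MvPolynomial (ι × ℕ) (Ser ι))
    (s : Multiset (ι × ℕ)) :
    Multiset.foldr (normalStep G γ) f s = wickFold (createAt G γ) (contractAt G) s f := by
  induction s using Multiset.induction_on with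
  | empty => rw [Multiset.foldr_zero, wickFold_apply, Multiset.foldr_zero]
  | cons x s ih => rw [Multiset.foldr_cons, ih, wickFold_cons, normalStep_eq]

/-- The normally ordered product of a monomial is a fold of Wick steps, followed by evaluation
through the annihilation exponential. From here on vertex operators are handled through a bilinear
form instead of a sum over monomials. -/
theorem vertexSeries_eq (G : Matrix ι ι ℚ) (β γ : ι → ℚ) (p q : Heis ι) :
    vertexSeries G β γ p q = expCreation β * zpowRat (pairing G β γ) *
      wick (createAt G γ) (annihAt G β) (contractAt G) (toSer p) (toSer q) := by
  have h : toSer p = ∑ s ∈ p.support, MvPolynomial.monomial s (zmon 0 (p.coeff s)) := by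
    conv_lhs => rw [p.as_sum]
    rw [map_sum]
    refine Finset.sum_congr rfl fun s _ => ?_
    rw [toSer, MvPolynomial.map_monomial, constHom_apply]
  rw [h, map_sum, LinearMap.sum_apply, Finset.mul_sum, vertexSeries]
  refine Finset.sum_congr rfl fun s _ => ?_
  rw [wick_monomial, mul_left_comm]
  rw [expAnnihilation_eq, foldr_normalStep, toSer, algebraMap_ser]

theorem vertexSeries_add_left (G : Matrix ι ι ℚ) (β γ : ι → ℚ) (p p' q : Heis ι) :
    vertexSeries G β γ (p + p') q = vertexSeries G β γ p q + vertexSeries G β γ p' q := by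
  simp only [vertexSeries_eq, map_add, LinearMap.add_apply, mul_add]

theorem vertexSeries_add_right (G : Matrix ι ι ℚ) (β γ : ι → ℚ) (p q q' : Heis ι) :
    vertexSeries G β γ p (q + q') = vertexSeries G β γ p q + vertexSeries G β γ p q' := by
  simp only [vertexSeries_eq, map_add, mul_add]

theorem toSer_smul (c : ℂ) (p : Heis ι) : toSer (c • p) = constHom ι c • toSer p := by
  rw [MvPolynomial.smul_eq_C_mul, map_mul, toSer, MvPolynomial.map_C, MvPolynomial.smul_eq_C_mul]

theorem vertexSeries_smul_left (G : Matrix ι ι ℚ) (β γ : ι → ℚ) (c : ℂ) (p q : Heis ι) :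
    vertexSeries G β γ (c • p) q = c • vertexSeries G β γ p q := by
  simp only [vertexSeries_eq, toSer_smul, map_smul, LinearMap.smul_apply, smul_eq_mul,
    ← constHom_mul]
  ring

theorem vertexSeries_smul_right (G : Matrix ι ι ℚ) (β γ : ι → ℚ) (c : ℂ) (p q : Heis ι) :
    vertexSeries G β γ p (c • q) = c • vertexSeries G β γ p q := by
  simp only [vertexSeries_eq, toSer_smul, map_smul, smul_eq_mul, ← constHom_mul]
  ring

/-- The linear form `∑ β i • α i (-k-1)`. -/
def linForm (β : ι → ℚ) (k : ℕ) : Heis ι :=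
  ∑ i, MvPolynomial.C ((β i : ℚ) : ℂ) * MvPolynomial.X (i, k)

/-- `expCreation` as a power series. -/
def expSeries (β : ι → ℚ) : PowerSeries (Heis ι) :=
  (PowerSeries.exp (Heis ι)).subst
      (PowerSeries.mk fun n : ℕ =>
        if n = 0 then (0 : Heis ι)
        else MvPolynomial.C ((n : ℂ)⁻¹) * ∑ i, MvPolynomial.C ((β i : ℚ) : ℂ) *
          MvPolynomial.X (i, n - 1))

theorem expCreation_eq (β : ι → ℚ) :
    expCreation β = HahnSeries.ofPowerSeries ℤ (Heis ι) (expSeries β) := rfl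

/-- The exponent `∑ β(-n) z^n / n` has derivative `∑ β(-k-1) z^k`, with no denominators left. -/
theorem isExpInt_expSeries (β : ι → ℚ) :
    IsExpInt (PowerSeries.mk (linForm β)) (expSeries β) := by
  have h := isExpInt_exp_subst (A := Heis ι) (F := PowerSeries.mk fun n : ℕ =>
        if n = 0 then (0 : Heis ι)
        else MvPolynomial.C ((n : ℂ)⁻¹) * ∑ i, MvPolynomial.C ((β i : ℚ) : ℂ) *
          MvPolynomial.X (i, n - 1)) (by
            rw [← PowerSeries.coeff_zero_eq_constantCoeff_apply, PowerSeries.coeff_mk]; simp)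
  convert h using 1
  swap
  · rfl
  ext1 n
  rw [PowerSeries.coeff_mk, PowerSeries.coeff_derivative, PowerSeries.coeff_mk, if_neg (by omega),
    Nat.add_sub_cancel, mul_right_comm]
  have : (MvPolynomial.C (((n + 1 : ℕ) : ℂ)⁻¹) : Heis ι) * ((n : Heis ι) + 1) = 1 := by
    have : ((n : Heis ι) + 1) = MvPolynomial.C ((n + 1 : ℕ) : ℂ) := by simp
    rw [this, ← map_mul, inv_mul_cancel₀ (Nat.cast_ne_zero.2 (Nat.succ_ne_zero n)), map_one]
  rw [this, one_mul, linForm]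

/-- `h(-n) ↦ (A h)(-n)`. -/
def polyMap {κ : Type} (A : Matrix κ ι ℚ) [Fintype κ] : Heis ι →ₐ[ℂ] Heis κ :=
  MvPolynomial.aeval fun x : ι × ℕ =>
        ∑ k, MvPolynomial.C ((A k x.1 : ℚ) : ℂ) * (MvPolynomial.X (k, x.2) : Heis κ)

theorem polyMap_X {κ : Type} (A : Matrix κ ι ℚ) [Fintype κ] (x : ι × ℕ) :
    polyMap A (MvPolynomial.X x) =
      ∑ k, MvPolynomial.C ((A k x.1 : ℚ) : ℂ) * (MvPolynomial.X (k, x.2) : Heis κ) :=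
  MvPolynomial.aeval_X _ _

theorem inducedMap_vec {κ : Type} (A : Matrix κ ι ℚ) [Fintype κ] (β : ι → ℚ) (p : Heis ι) :
    inducedMap A (vec β p) = vec (A.mulVec β) (polyMap A p) := by
  simp [inducedMap, polyMap, AddMonoidAlgebra.mapAlgHom]

theorem polyMap_linForm {κ : Type} (A : Matrix κ ι ℚ) [Fintype κ] (β : ι → ℚ) (k : ℕ) :
    polyMap A (linForm β k) = linForm (A.mulVec β) k := by
  simp only [linForm, map_sum, map_mul, polyMap_X, Matrix.mulVec, dotProduct]
  simp only [Finset.mul_sum, Rat.cast_sum, Rat.cast_mul, map_sum, map_mul, Finset.sum_mul]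
  rw [Finset.sum_comm]
  refine Finset.sum_congr rfl fun k _ => Finset.sum_congr rfl fun i _ => ?_
  rw [MvPolynomial.algHom_C, MvPolynomial.algebraMap_eq]
  ring

theorem linForm_add (β γ : ι → ℚ) (k : ℕ) : linForm (β + γ) k = linForm β k + linForm γ k := by
  simp [linForm, add_mul, Finset.sum_add_distrib]

theorem expSeries_add (β γ : ι → ℚ) : expSeries (β + γ) = expSeries β * expSeries γ := by
  refine IsExpInt.unique (isExpInt_expSeries _) ?_
  convert (isExpInt_expSeries β).mul (isExpInt_expSeries γ) using 1
  ext1 n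
  simp [linForm_add]

theorem expCreation_add (β γ : ι → ℚ) :
    expCreation (β + γ) = expCreation β * expCreation γ := by
  rw [expCreation_eq, expCreation_eq, expCreation_eq, expSeries_add, map_mul]

theorem map_expCreation {κ : Type} [Fintype κ] [DecidableEq κ] (A : Matrix κ ι ℚ) (β : ι → ℚ) :
    laurentMap (polyMap A).toRingHom (expCreation β) = expCreation (A.mulVec β) := by
  rw [expCreation_eq, expCreation_eq, laurentMap_ofPowerSeries]
  congr 1
  refine IsExpInt.unique ((isExpInt_expSeries β).map _) ?_
  convert isExpInt_expSeries (A.mulVec β) using 1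
  ext1 n
  simp [polyMap_linForm]

theorem zpowRat_intCast (n : ℤ) : zpowRat (ι := ι) n = zmon n 1 := by
  simp [zpowRat]

theorem zmon_mul (k l : ℤ) (a b : ℂ) : (zmon k a * zmon l b : Ser ι) = zmon (k + l) (a * b) := by
  rw [zmon, zmon, HahnSeries.single_mul_single, ← map_mul]

theorem laurentMap_zmon {κ : Type} [Fintype κ] (A : Matrix κ ι ℚ) (k : ℤ) (a : ℂ) :
    laurentMap (polyMap A).toRingHom (zmon k a) = zmon k a := by
  rw [laurentMap_single]
  congr 1
  exact MvPolynomial.algHom_C _ _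

end VertexSeries

/-! ### Vertex operators for orthogonal sums of lattices -/

section TensorFormula

variable {ι κ υ : Type} [Fintype ι] [DecidableEq ι] [Fintype κ] [DecidableEq κ] [Fintype υ]
  [DecidableEq υ]

theorem constHom_mul_zmon (c : ℂ) (k : ℤ) (a : ℂ) :
    constHom ι c * zmon k a = zmon k (c * a) := by
  rw [constHom_apply, zmon_mul, zero_add]

theorem sum_single {α R : Type*} [CommRing R] (s : Finset α) (k : ℤ) (f : α → R) :
    ∑ i ∈ s, HahnSeries.single k (f i) = HahnSeries.single k (∑ i ∈ s, f i) :=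
  (map_sum (HahnSeries.single.addMonoidHom k) f s).symm

theorem sum_zmon {α : Type*} (s : Finset α) (k : ℤ) (f : α → ℂ) :
    ∑ i ∈ s, (zmon k (f i) : Ser ι) = zmon k (∑ i ∈ s, f i) := by
  rw [sum_single, ← map_sum]

/-- The series version of `polyMap`. -/
def serMap (A : Matrix υ ι ℚ) : Ser ι →+* Ser υ := laurentMap (polyMap A).toRingHom

theorem coeff_serMap (A : Matrix υ ι ℚ) (f : Ser ι) (n : ℤ) :
    (serMap A f).coeff n = polyMap A (f.coeff n) := rfl

theorem serMap_comp_constHom (A : Matrix υ ι ℚ) :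
    (serMap A).comp (constHom ι) = constHom υ := by
  ext1 c
  exact laurentMap_zmon A 0 c

/-- The coefficients of `polyMap`. -/
def substCoeff (A : Matrix υ ι ℚ) (x : ι × ℕ) (k : υ) : Ser υ := constHom υ (A k x.1 : ℚ)

theorem toSer_polyMap (A : Matrix υ ι ℚ) (p : Heis ι) :
    toSer (polyMap A p) =
      linSubst (substCoeff A) (fun x k => (k, x.2)) (MvPolynomial.map (constHom υ) p) := by
  have : (toSer (ι := υ)).comp (polyMap A).toRingHom =
      (linSubst (substCoeff A) (fun (x : ι × ℕ) k => (k, x.2))).toRingHom.comp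
        (MvPolynomial.map (constHom υ)) := by
    refine MvPolynomial.ringHom_ext (fun c => ?_) fun x => ?_
    · simp [toSer, linSubst, MvPolynomial.algebraMap_eq, MvPolynomial.algHom_C]
    · simp only [RingHom.comp_apply, AlgHom.toRingHom_eq_coe, RingHom.coe_coe, polyMap_X,
        MvPolynomial.map_X, linSubst_X, map_sum, map_mul, toSer, MvPolynomial.map_C]
      rfl
  exact congrArg (fun f => f p) this

theorem map_serMap_toSer (A : Matrix υ ι ℚ) (p : Heis ι) :
    MvPolynomial.map (serMap A) (toSer p) = MvPolynomial.map (constHom υ) p := by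
  rw [toSer, MvPolynomial.map_map, serMap_comp_constHom]

/-- The hypothesis says `⟨A α_i, δ⟩ = ⟨α_i, γ⟩`. It is needed only for the zero mode; the creation
parts match by linearity. -/
theorem sum_substCoeff_createAt (A : Matrix υ ι ℚ) (G : Matrix ι ι ℚ) (K : Matrix υ υ ℚ)
    (γ : ι → ℚ) (δ : υ → ℚ) (h : A.transpose.mulVec (K.mulVec δ) = G.mulVec γ) (x : ι × ℕ) :
    ∑ k, substCoeff A x k * createAt K δ (k, x.2) = serMap A (createAt G γ x) := by
  simp only [createAt, mul_add, Finset.sum_add_distrib, map_add, zeroMode, substCoeff,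
    constHom_mul_zmon, sum_zmon]
  congr 1
  · simp only [creation, serMap, laurentMap_ofPowerSeries, constHom_apply]
    have : ∀ k : υ, (zmon 0 ((A k x.1 : ℚ) : ℂ) : Ser υ) =
        HahnSeries.ofPowerSeries ℤ _ (PowerSeries.C (MvPolynomial.C ((A k x.1 : ℚ) : ℂ))) :=
      fun k => (HahnSeries.ofPowerSeries_C _).symm
    simp only [this, ← map_mul, ← map_sum]
    congr 1
    ext1 n
    simp only [map_sum, PowerSeries.coeff_C_mul, PowerSeries.coeff_mk, PowerSeries.coeff_map,
      map_mul, AlgHom.toRingHom_eq_coe, RingHom.coe_coe, polyMap_X, MvPolynomial.algHom_C,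
      MvPolynomial.algebraMap_eq, Finset.mul_sum]
    refine Finset.sum_congr rfl fun k _ => ?_
    ring
  · rw [serMap, laurentMap_zmon, ← h]
    congr 2
    simp only [Matrix.mulVec_transpose, Matrix.vecMul, dotProduct, Rat.cast_sum, Rat.cast_mul,
      Finset.mul_sum]
    refine Finset.sum_congr rfl fun k _ => ?_
    ring

theorem sum_substCoeff_annihAt (A : Matrix υ ι ℚ) (G : Matrix ι ι ℚ) (K : Matrix υ υ ℚ)
    (γ : ι → ℚ) (δ : υ → ℚ) (h : A.transpose.mulVec (K.mulVec δ) = G.mulVec γ) (x : ι × ℕ) :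
    ∑ k, substCoeff A x k * annihAt K δ (k, x.2) = serMap A (annihAt G γ x) := by
  simp only [annihAt, mul_sub, Finset.sum_sub_distrib, map_sub, substCoeff,
    constHom_mul_zmon, sum_zmon]
  congr 1
  · rw [serMap, laurentMap_single]
    simp only [AlgHom.toRingHom_eq_coe, RingHom.coe_coe, polyMap_X, constHom_apply,
      HahnSeries.single_mul_single, zero_add, sum_single]
  · rw [serMap, laurentMap_zmon, ← h]
    congr 2
    simp only [Matrix.mulVec_transpose, Matrix.vecMul, dotProduct, Rat.cast_sum, Rat.cast_mul]
    refine Finset.sum_congr rfl fun k _ => ?_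
    ring

theorem sum_substCoeff_contractAt (A : Matrix υ ι ℚ) (B : Matrix υ κ ℚ) (K : Matrix υ υ ℚ)
    (x : ι × ℕ) (y : κ × ℕ) :
    ∑ k, ∑ k', substCoeff A x k * (substCoeff B y k' * contractAt K (k, x.2) (k', y.2)) =
      zmon (-((y.2 : ℤ) + 1) - 1 - x.2)
      ((-1) ^ x.2 * (((y.2 + 1 + x.2).choose x.2 : ℕ) : ℂ) * (((y.2 + 1 : ℕ) : ℂ) *
        (((A.transpose * K * B) x.1 y.1 : ℚ) : ℂ))) := by
  simp only [contractAt, substCoeff, constHom_mul_zmon, sum_zmon]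
  congr 2
  simp only [Matrix.mul_apply, Matrix.transpose_apply, Rat.cast_sum, Rat.cast_mul, Finset.mul_sum,
    Finset.sum_mul]
  rw [Finset.sum_comm]
  refine Finset.sum_congr rfl fun k _ => Finset.sum_congr rfl fun k' _ => ?_
  ring

theorem serMap_contractAt (A : Matrix υ ι ℚ) (G : Matrix ι ι ℚ) (x y : ι × ℕ) :
    serMap A (contractAt G x y) = zmon (-((y.2 : ℤ) + 1) - 1 - x.2)
      ((-1) ^ x.2 * (((y.2 + 1 + x.2).choose x.2 : ℕ) : ℂ) * (((y.2 + 1 : ℕ) : ℂ) *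
        ((G x.1 y.1 : ℚ) : ℂ))) :=
  laurentMap_zmon _ _ _

theorem pairing_add_add (A : Matrix υ ι ℚ) (B : Matrix υ κ ℚ) (G : Matrix ι ι ℚ)
    (H : Matrix κ κ ℚ) (K : Matrix υ υ ℚ) (hA : A.transpose * K * A = G)
    (hB : B.transpose * K * B = H) (hAB : A.transpose * K * B = 0)
    (hBA : B.transpose * K * A = 0) (β γ : ι → ℚ) (β' γ' : κ → ℚ) :
    pairing K (A.mulVec β + B.mulVec β') (A.mulVec γ + B.mulVec γ') =
      pairing G β γ + pairing H β' γ' := by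
  have key : ∀ {ι κ : Type} [Fintype ι] [Fintype κ] (A : Matrix υ ι ℚ) (B : Matrix υ κ ℚ)
      (β : ι → ℚ) (γ : κ → ℚ), A.mulVec β ⬝ᵥ K.mulVec (B.mulVec γ) =
        β ⬝ᵥ (A.transpose * K * B).mulVec γ := by
    intro ι κ _ _ A B β γ
    rw [Matrix.mul_assoc, ← Matrix.mulVec_mulVec γ, Matrix.dotProduct_mulVec β,
      Matrix.vecMul_transpose, Matrix.mulVec_mulVec]
  simp only [pairing, Matrix.mulVec_add, add_dotProduct, dotProduct_add, key, hA, hB, hAB, hBA,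
    Matrix.zero_mulVec, dotProduct_zero]
  ring

theorem transpose_mulVec_add (A : Matrix υ ι ℚ) (B : Matrix υ κ ℚ) (G : Matrix ι ι ℚ)
    (K : Matrix υ υ ℚ) (hA : A.transpose * K * A = G) (hAB : A.transpose * K * B = 0)
    (γ : ι → ℚ) (γ' : κ → ℚ) :
    A.transpose.mulVec (K.mulVec (A.mulVec γ + B.mulVec γ')) = G.mulVec γ := by
  simp only [Matrix.mulVec_add, Matrix.mulVec_mulVec, ← Matrix.mul_assoc, hA, hAB,
    Matrix.zero_mulVec, add_zero]

/-- The vertex operators of an orthogonal sum of lattices are products. -/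
theorem vertexSeries_tensor (A : Matrix υ ι ℚ) (B : Matrix υ κ ℚ) (G : Matrix ι ι ℚ)
    (H : Matrix κ κ ℚ) (K : Matrix υ υ ℚ) (hA : A.transpose * K * A = G)
    (hB : B.transpose * K * B = H) (hAB : A.transpose * K * B = 0)
    (hBA : B.transpose * K * A = 0) (β γ : ι → ℚ) (β' γ' : κ → ℚ) {r r' : ℤ}
    (hr : pairing G β γ = r) (hr' : pairing H β' γ' = r') (p q : Heis ι) (p' q' : Heis κ) :
    vertexSeries K (A.mulVec β + B.mulVec β') (A.mulVec γ + B.mulVec γ')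
        (polyMap A p * polyMap B p') (polyMap A q * polyMap B q') =
      serMap A (vertexSeries G β γ p q) * serMap B (vertexSeries H β' γ' p' q') := by
  have hAγ := transpose_mulVec_add A B G K hA hAB γ γ'
  have hAβ := transpose_mulVec_add A B G K hA hAB β β'
  have hBγ := transpose_mulVec_add B A H K hB hBA γ' γ
  have hBβ := transpose_mulVec_add B A H K hB hBA β' β
  rw [add_comm] at hBγ hBβ
  -- Integrality of both exponents is essential: for non-integral exponents with integral sum the
  -- left side is a power of `z`, while both factors on the right would be zero.
  have hz : (zpowRat (pairing G β γ + pairing H β' γ') : Ser υ) =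
      zmon r 1 * zmon r' 1 := by
    rw [hr, hr', ← Int.cast_add, zpowRat_intCast, zmon_mul, one_mul]
  have hw : ∀ {ι : Type} [Fintype ι] [DecidableEq ι] (A : Matrix υ ι ℚ) (G : Matrix ι ι ℚ)
      (β γ : ι → ℚ) (r : ℤ) (p q : Heis ι), pairing G β γ = r →
      serMap A (vertexSeries G β γ p q) = expCreation (A.mulVec β) * zmon r 1 *
        wick (fun x => serMap A (createAt G γ x)) (fun x => serMap A (annihAt G β x))
          (fun x y => serMap A (contractAt G x y))
          (MvPolynomial.map (constHom υ) p) (MvPolynomial.map (constHom υ) q) := by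
    intro ι _ _ A G β γ r p q hr
    rw [vertexSeries_eq, hr, zpowRat_intCast, map_mul, map_mul, map_wick, map_serMap_toSer,
      map_serMap_toSer, serMap, laurentMap_zmon, map_expCreation]
  rw [hw A G β γ r p q hr, hw B H β' γ' r' p' q' hr', vertexSeries_eq, expCreation_add,
    pairing_add_add A B G H K hA hB hAB hBA, hz, map_mul toSer, map_mul toSer, toSer_polyMap,
    toSer_polyMap, toSer_polyMap, toSer_polyMap]
  rw [wick_split (sum_substCoeff_createAt A G K γ _ hAγ) (sum_substCoeff_annihAt A G K β _ hAβ)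
    (fun x y => ?_) (sum_substCoeff_createAt B H K γ' _ hBγ)
    (sum_substCoeff_annihAt B H K β' _ hBβ) (fun x y => ?_) (fun x y => ?_) (fun x y => ?_)]
  · ring
  · rw [sum_substCoeff_contractAt, hA, serMap_contractAt]
  · rw [sum_substCoeff_contractAt, hB, serMap_contractAt]
  · rw [sum_substCoeff_contractAt, hAB]; simp
  · rw [sum_substCoeff_contractAt, hBA]; simp

end TensorFormula

/-! ### Modes: bilinearity, truncation, tensor products and isometries -/

section Modes

variable {ι κ υ : Type} [Fintype ι] [DecidableEq ι] [Fintype κ] [DecidableEq κ] [Fintype υ]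
  [DecidableEq υ]

theorem vec_add (β : ι → ℚ) (p q : Heis ι) : vec β (p + q) = vec β p + vec β q :=
  AddMonoidAlgebra.single_add _ _ _

theorem vec_zero (β : ι → ℚ) : vec β (0 : Heis ι) = 0 := AddMonoidAlgebra.single_zero _

theorem smul_vec (β : ι → ℚ) (c : ℂ) (p : Heis ι) : c • vec β p = vec β (c • p) :=
  AddMonoidAlgebra.smul_single _ _ _

theorem vec_mul_vec (β γ : ι → ℚ) (p q : Heis ι) : vec β p * vec γ q = vec (β + γ) (p * q) :=
  AddMonoidAlgebra.single_mul_single _ _ _ _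

theorem vertexSeries_zero_left (G : Matrix ι ι ℚ) (β γ : ι → ℚ) (q : Heis ι) :
    vertexSeries G β γ 0 q = 0 := by
  have := vertexSeries_smul_left G β γ 0 0 q
  simpa using this

theorem vertexSeries_zero_right (G : Matrix ι ι ℚ) (β γ : ι → ℚ) (p : Heis ι) :
    vertexSeries G β γ p 0 = 0 := by
  have := vertexSeries_smul_right G β γ 0 p 0
  simpa using this

theorem mode_vec (G : Matrix ι ι ℚ) (n : ℤ) (β γ : ι → ℚ) (p q : Heis ι) :
    mode G n (vec β p) (vec γ q) =
      vec (β + γ) ((vertexSeries G β γ p q).coeff (-n - 1)) := by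
  rw [mode, AddMonoidAlgebra.coeff_single, Finsupp.sum_single_index,
    AddMonoidAlgebra.coeff_single, Finsupp.sum_single_index]
  · rw [vertexSeries_zero_right, HahnSeries.coeff_zero, vec_zero]
  · simp only [vertexSeries_zero_left, HahnSeries.coeff_zero, vec_zero, Finsupp.sum,
      Finset.sum_const_zero]

theorem mode_add_left (G : Matrix ι ι ℚ) (n : ℤ) (u u' v : Fock ι) :
    mode G n (u + u') v = mode G n u v + mode G n u' v := by
  rw [mode, AddMonoidAlgebra.coeff_add, Finsupp.sum_add_index']
  · rfl
  · simp only [vertexSeries_zero_left, HahnSeries.coeff_zero, vec_zero, Finsupp.sum, Finset.sum_const_zero, implies_true]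
  · intro β p p'
    simp only [vertexSeries_add_left, HahnSeries.coeff_add, vec_add, Finsupp.sum_add]

theorem mode_add_right (G : Matrix ι ι ℚ) (n : ℤ) (u v v' : Fock ι) :
    mode G n u (v + v') = mode G n u v + mode G n u v' := by
  simp only [mode]
  rw [← Finsupp.sum_add]
  refine Finsupp.sum_congr fun β _ => ?_
  rw [AddMonoidAlgebra.coeff_add, Finsupp.sum_add_index']
  · intro γ
    rw [vertexSeries_zero_right, HahnSeries.coeff_zero, vec_zero]
  · intro γ q q'
    simp only [vertexSeries_add_right, HahnSeries.coeff_add, vec_add]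

theorem mode_zero_left (G : Matrix ι ι ℚ) (n : ℤ) (v : Fock ι) : mode G n 0 v = 0 := by
  simp [mode]

theorem mode_zero_right (G : Matrix ι ι ℚ) (n : ℤ) (u : Fock ι) : mode G n u 0 = 0 := by
  simp [mode]

theorem fock_induction {P : Fock ι → Prop} (h0 : P 0) (hadd : ∀ u v, P u → P v → P (u + v))
    (hvec : ∀ β p, P (vec β p)) (u : Fock ι) : P u :=
  AddMonoidAlgebra.induction_linear u h0 (fun u v => hadd u v) hvec

theorem mode_smul_left (G : Matrix ι ι ℚ) (n : ℤ) (c : ℂ) (u v : Fock ι) :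
    mode G n (c • u) v = c • mode G n u v := by
  induction u using fock_induction with
  | h0 => simp [mode_zero_left]
  | hadd u u' h h' => rw [smul_add, mode_add_left, mode_add_left, smul_add, h, h']
  | hvec β p =>
    induction v using fock_induction with
    | h0 => simp [mode_zero_right]
    | hadd v v' h h' => rw [mode_add_right, mode_add_right, smul_add, h, h']
    | hvec γ q =>
      rw [smul_vec, mode_vec, mode_vec, vertexSeries_smul_left, HahnSeries.coeff_smul, smul_vec]

theorem mode_smul_right (G : Matrix ι ι ℚ) (n : ℤ) (c : ℂ) (u v : Fock ι) :
    mode G n u (c • v) = c • mode G n u v := by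
  induction u using fock_induction with
  | h0 => simp [mode_zero_left]
  | hadd u u' h h' => rw [mode_add_left, mode_add_left, smul_add, h, h']
  | hvec β p =>
    induction v using fock_induction with
    | h0 => simp [mode_zero_right]
    | hadd v v' h h' => rw [smul_add, mode_add_right, mode_add_right, smul_add, h, h']
    | hvec γ q =>
      rw [smul_vec, mode_vec, mode_vec, vertexSeries_smul_right, HahnSeries.coeff_smul, smul_vec]

/-- A Laurent series has finitely many negative powers. This truncation makes the convolution sums
in `mode_tensor` finite. -/
theorem exists_mode_eq_zero (G : Matrix ι ι ℚ) (u v : Fock ι) :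
    ∃ N : ℤ, ∀ n ≥ N, mode G n u v = 0 := by
  induction u using fock_induction with
  | h0 => exact ⟨0, fun n _ => mode_zero_left G n v⟩
  | hadd u u' h h' =>
    obtain ⟨N, hN⟩ := h
    obtain ⟨N', hN'⟩ := h'
    refine ⟨max N N', fun n hn => ?_⟩
    rw [mode_add_left, hN n (le_trans (le_max_left _ _) hn),
      hN' n (le_trans (le_max_right _ _) hn), add_zero]
  | hvec β p =>
    induction v using fock_induction with
    | h0 => exact ⟨0, fun n _ => mode_zero_right G n _⟩
    | hadd v v' h h' =>
      obtain ⟨N, hN⟩ := h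
      obtain ⟨N', hN'⟩ := h'
      refine ⟨max N N', fun n hn => ?_⟩
      rw [mode_add_right, hN n (le_trans (le_max_left _ _) hn),
        hN' n (le_trans (le_max_right _ _) hn), add_zero]
    | hvec γ q =>
      refine ⟨-(vertexSeries G β γ p q).order, fun n hn => ?_⟩
      rw [mode_vec, HahnSeries.coeff_eq_zero_of_lt_order (by omega), vec_zero]

theorem vec_mem_V {X : Set (ι → ℚ)} {β : ι → ℚ} (h : β ∈ X) (p : Heis ι) : vec β p ∈ V X := by
  intro γ hγ
  rw [AddMonoidAlgebra.coeff_single, Finsupp.single_apply] at hγ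
  split_ifs at hγ with he
  · exact he ▸ h
  · exact absurd rfl hγ

theorem V_induction {X : Set (ι → ℚ)} {P : (u : Fock ι) → u ∈ V X → Prop}
    (h0 : P 0 (zero_mem _))
    (hadd : ∀ u v hu hv, P u hu → P v hv → P (u + v) (add_mem hu hv))
    (hvec : ∀ β (hβ : β ∈ X) p, P (vec β p) (vec_mem_V hβ p)) {u : Fock ι}
    (hu : u ∈ V X) : P u hu := by
  suffices h : ∃ h : u ∈ V X, P u h from h.2
  have key := Finset.sum_induction (s := u.coeff.support) (fun β => vec β (u.coeff β))
    (fun u => ∃ h : u ∈ V X, P u h)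
    (fun u v ⟨hu, hPu⟩ ⟨hv, hPv⟩ => ⟨add_mem hu hv, hadd u v hu hv hPu hPv⟩) ⟨zero_mem _, h0⟩
    fun β hβ => ⟨vec_mem_V (hu β (Finsupp.mem_support_iff.1 hβ)) _, hvec β (hu β (Finsupp.mem_support_iff.1 hβ)) _⟩
  rwa [show ∑ β ∈ u.coeff.support, vec β (u.coeff β) = u from
    AddMonoidAlgebra.sum_coeff_single u] at key

theorem mode_mem_V {X Y Z : Set (ι → ℚ)} (h : ∀ β ∈ X, ∀ γ ∈ Y, β + γ ∈ Z) (G : Matrix ι ι ℚ)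
    (n : ℤ) {u v : Fock ι} (hu : u ∈ V X) (hv : v ∈ V Y) : mode G n u v ∈ V Z := by
  induction hu using V_induction with
  | h0 => rw [mode_zero_left]; exact zero_mem _
  | hadd u u' _ _ h h' => rw [mode_add_left]; exact add_mem h h'
  | hvec β hβ p =>
    induction hv using V_induction with
    | h0 => rw [mode_zero_right]; exact zero_mem _
    | hadd u u' _ _ h h' => rw [mode_add_right]; exact add_mem h h'
    | hvec γ hγ q => rw [mode_vec]; exact vec_mem_V (h β hβ γ hγ) _

theorem finite_support_tensor (A : Matrix υ ι ℚ) (B : Matrix υ κ ℚ) (G : Matrix ι ι ℚ)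
    (H : Matrix κ κ ℚ) (n : ℤ) (u w : Fock ι) (u' w' : Fock κ) :
    {i : ℤ | inducedMap A (mode G i u w) *
      inducedMap B (mode H (n - 1 - i) u' w') ≠ 0}.Finite := by
  obtain ⟨N, hN⟩ := exists_mode_eq_zero G u w
  obtain ⟨N', hN'⟩ := exists_mode_eq_zero H u' w'
  refine (Set.finite_Icc (n - 1 - N') N).subset fun i hi => ?_
  by_contra hc
  rw [Set.mem_Icc, not_and_or, not_le, not_le] at hc
  apply hi
  rcases hc with hc | hc
  · rw [hN' _ (by omega), map_zero, mul_zero]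
  · rw [hN _ (by omega), map_zero, zero_mul]

/-- Vertex operators on a tensor product, for an orthogonal sum of lattices. -/
theorem mode_tensor {A : Matrix υ ι ℚ} {B : Matrix υ κ ℚ} {G : Matrix ι ι ℚ}
    {H : Matrix κ κ ℚ} {K : Matrix υ υ ℚ} (hA : A.transpose * K * A = G)
    (hB : B.transpose * K * B = H) (hAB : A.transpose * K * B = 0)
    (hBA : B.transpose * K * A = 0) {X Y : Set (ι → ℚ)} {X' Y' : Set (κ → ℚ)}
    (hXY : ∀ β ∈ X, ∀ γ ∈ Y, ∃ r : ℤ, pairing G β γ = r)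
    (hXY' : ∀ β ∈ X', ∀ γ ∈ Y', ∃ r : ℤ, pairing H β γ = r) (n : ℤ) {u w : Fock ι}
    {u' w' : Fock κ} (hu : u ∈ V X) (hw : w ∈ V Y) (hu' : u' ∈ V X') (hw' : w' ∈ V Y') :
    mode K n (inducedMap A u * inducedMap B u') (inducedMap A w * inducedMap B w') =
      ∑ᶠ i : ℤ, inducedMap A (mode G i u w) * inducedMap B (mode H (n - 1 - i) u' w') := by
  induction hu using V_induction with
  | h0 => simp [mode_zero_left]
  | hadd u₁ u₂ _ _ h₁ h₂ =>
    simp only [map_add, add_mul, mode_add_left, h₁, h₂]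
    exact (finsum_add_distrib (finite_support_tensor A B G H n _ _ _ _)
      (finite_support_tensor A B G H n _ _ _ _)).symm
  | hvec β hβ p =>
  induction hw using V_induction with
  | h0 => simp [mode_zero_right]
  | hadd u₁ u₂ _ _ h₁ h₂ =>
    simp only [map_add, add_mul, mode_add_right, h₁, h₂]
    exact (finsum_add_distrib (finite_support_tensor A B G H n _ _ _ _)
      (finite_support_tensor A B G H n _ _ _ _)).symm
  | hvec γ hγ q =>
  induction hu' using V_induction with
  | h0 => simp [mode_zero_left]
  | hadd u₁ u₂ _ _ h₁ h₂ =>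
    simp only [map_add, mul_add, mode_add_left, h₁, h₂]
    exact (finsum_add_distrib (finite_support_tensor A B G H n _ _ _ _)
      (finite_support_tensor A B G H n _ _ _ _)).symm
  | hvec β' hβ' p' =>
  induction hw' using V_induction with
  | h0 => simp [mode_zero_right]
  | hadd u₁ u₂ _ _ h₁ h₂ =>
    simp only [map_add, mul_add, mode_add_right, h₁, h₂]
    exact (finsum_add_distrib (finite_support_tensor A B G H n _ _ _ _)
      (finite_support_tensor A B G H n _ _ _ _)).symm
  | hvec γ' hγ' q' =>
    obtain ⟨r, hr⟩ := hXY β hβ γ hγ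
    obtain ⟨r', hr'⟩ := hXY' β' hβ' γ' hγ'
    simp only [mode_vec, inducedMap_vec, vec_mul_vec,
      vertexSeries_tensor A B G H K hA hB hAB hBA β γ β' γ' hr hr']
    set f := vertexSeries G β γ p q
    set g := vertexSeries H β' γ' p' q'
    have e : A.mulVec β + B.mulVec β' + (A.mulVec γ + B.mulVec γ') =
        A.mulVec (β + γ) + B.mulVec (β' + γ') := by
      rw [Matrix.mulVec_add, Matrix.mulVec_add]; abel
    rw [e]
    set δ := A.mulVec (β + γ) + B.mulVec (β' + γ')
    -- The exponents of the two factors are `-i-1` and `-(n-1-i)-1`; they add up to `-n-1`, whence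
    -- the index `n-1-i` of the second mode.
    have hsum : (serMap A f * serMap B g).coeff (-n - 1) =
        ∑ᶠ i : ℤ, polyMap A (f.coeff (-i - 1)) * polyMap B (g.coeff (-(n - 1 - i) - 1)) := by
      rw [HahnSeries.coeff_mul]
      have hinj : Set.InjOn (fun ij : ℤ × ℤ => -ij.1 - 1)
          (Finset.antidiagonal (serMap A f).isPWO_support (serMap B g).isPWO_support (-n - 1) :
            Set (ℤ × ℤ)) := by
        intro x hx y hy hxy
        have hx' := (Finset.mem_antidiagonal.1 hx).2.2
        have hy' := (Finset.mem_antidiagonal.1 hy).2.2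
        have : x.1 = y.1 := by simpa using hxy
        exact Prod.ext this (by omega)
      rw [finsum_eq_sum_of_support_subset (s := (Finset.antidiagonal (serMap A f).isPWO_support
        (serMap B g).isPWO_support (-n - 1)).image fun ij => -ij.1 - 1), Finset.sum_image hinj]
      · refine Finset.sum_congr rfl fun ij hij => ?_
        have := (Finset.mem_antidiagonal.1 hij).2.2
        rw [coeff_serMap, coeff_serMap]
        congr 3
        · ring
        · omega
      · intro i hi
        simp only [Finset.coe_image, Set.mem_image, Finset.mem_coe, Finset.mem_antidiagonal]
        refine ⟨(-i - 1, -(n - 1 - i) - 1), ⟨?_, ?_, by ring⟩, by ring⟩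
        · intro h0
          exact hi (by dsimp only; rw [← coeff_serMap, h0, zero_mul])
        · intro h0
          exact hi (by dsimp only; rw [← coeff_serMap B, h0, mul_zero])
    rw [hsum]
    have := (AddMonoidAlgebra.singleAddHom (R := Heis υ) δ).map_finsum
      (f := fun i : ℤ => polyMap A (f.coeff (-i - 1)) * polyMap B (g.coeff (-(n - 1 - i) - 1))) ?_
    · exact this
    · refine (finite_support_tensor A B G H n (vec β p) (vec γ q) (vec β' p')
        (vec γ' q')).subset fun i hi => ?_
      simp only [mode_vec, inducedMap_vec, vec_mul_vec, Set.mem_ofPred_eq]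
      exact fun h => hi (AddMonoidAlgebra.single_eq_zero.1 h)

theorem expSeries_zero : expSeries (0 : ι → ℚ) = 1 :=
  (isExpInt_expSeries 0).unique ⟨by ext n; simp [linForm], by simp⟩

theorem vertexSeries_one_left (G : Matrix ι ι ℚ) (γ : ι → ℚ) (q : Heis ι) :
    vertexSeries G 0 γ 1 q = HahnSeries.C q := by
  have h0 : pairing G 0 γ = ((0 : ℤ) : ℚ) := by simp [pairing]
  have h1 : (MvPolynomial.aeval (annihAt G 0)) (toSer q) = HahnSeries.C q := by
    have : ((MvPolynomial.aeval (annihAt G 0)).toRingHom).comp toSer =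
        (HahnSeries.C : Heis ι →+* Ser ι) := by
      refine MvPolynomial.ringHom_ext (fun c => ?_) fun x => ?_
      · simp [toSer, constHom_apply]
      · simp [toSer, annihAt, HahnSeries.C_apply]
    exact congrArg (fun f => f q) this
  rw [vertexSeries_eq, expCreation_eq, expSeries_zero, map_one, h0, zpowRat_intCast, map_one,
    wick_one, h1, one_mul]
  simp

/-- Maps of lattices that preserve the bilinear form induce homomorphisms. -/
theorem mode_inducedMap {A : Matrix υ ι ℚ} {G : Matrix ι ι ℚ} {K : Matrix υ υ ℚ}
    (hA : A.transpose * K * A = G) (n : ℤ) (u w : Fock ι) :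
    mode K n (inducedMap A u) (inducedMap A w) = inducedMap A (mode G n u w) := by
  induction u using fock_induction with
  | h0 => simp [mode_zero_left]
  | hadd u u' h h' => simp only [map_add, mode_add_left, h, h']
  | hvec β p =>
  induction w using fock_induction with
  | h0 => simp [mode_zero_right]
  | hadd u u' h h' => simp only [map_add, mode_add_right, h, h']
  | hvec γ q =>
    simp only [inducedMap_vec, mode_vec, Matrix.mulVec_add, ← coeff_serMap]
    congr 2
    -- For an integral pairing the tensor formula is applied with a second summand of rank zero.
    -- Otherwise the power of `z` is replaced by zero on both sides.
    by_cases h : (pairing G β γ).den = 1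
    · have := vertexSeries_tensor A (0 : Matrix υ (Fin 0) ℚ) G 0 K hA (by simp) (by simp) (by simp)
        β γ 0 0 (r := (pairing G β γ).num) (r' := 0) (Rat.den_eq_one_iff _ |>.1 h).symm
        (by simp [pairing]) p q 1 1
      rw [vertexSeries_one_left, map_one, map_one] at this
      simpa using this
    · have h2 := pairing_add_add A (0 : Matrix υ (Fin 0) ℚ) G 0 K hA (by simp) (by simp) (by simp)
        β γ 0 0
      have h3 : pairing K (A.mulVec β) (A.mulVec γ) = pairing G β γ := by
        simpa [pairing] using h2
      rw [vertexSeries_eq, vertexSeries_eq, h3, zpowRat, zpowRat, if_neg h, if_neg h]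
      simp

end Modes

/-! ### Binomial identity behind the residue theorem -/

theorem ringChoose_eq_zero {a : ℤ} {n : ℕ} (h0 : 0 ≤ a) (h : a < n) : Ring.choose a n = 0 := by
  lift a to ℕ using h0
  rw [Ring.choose_natCast, Nat.choose_eq_zero_of_lt (by exact_mod_cast h), Nat.cast_zero]

theorem ringChoose_neg_succ (b n : ℕ) :
    Ring.choose (-(b : ℤ) - 1) n = (-1) ^ n * ((n + b).choose n : ℕ) := by
  rw [show -(b : ℤ) - 1 = -((b : ℤ) + 1) by ring, Ring.choose_neg,
    show (b : ℤ) + 1 + n - 1 = ((n + b : ℕ) : ℤ) by push_cast; ring, Ring.choose_natCast,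
    Units.smul_def, smul_eq_mul, Int.negOnePow_def]
  simp

/-- The residue of `w ^ i (w - z) ^ a` at infinity is the sum of the residues at `0` and `z`. -/
theorem choose_residue (a N : ℤ) :
    (if 0 ≤ N then (-1) ^ N.natAbs * Ring.choose a N.toNat else 0) =
      (if 0 ≤ a - N then (-1) ^ N.natAbs * Ring.choose a (a - N).toNat else 0) +
        (if 0 ≤ -a - 1 then Ring.choose (N - a - 1) (-a - 1).toNat else 0) := by
  rcases le_or_gt 0 a with ha | ha
  -- For `0 ≤ a` there is no pole at `z`, and the identity is the symmetry of binomial coefficients.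
  · rw [if_neg (show ¬ 0 ≤ -a - 1 by omega), add_zero]
    rcases lt_or_ge N 0 with hN | hN
    · rw [if_neg (not_le.2 hN), if_pos (by omega), ringChoose_eq_zero ha (by omega), mul_zero]
    · rw [if_pos hN]
      split_ifs with h
      · lift a to ℕ using ha
        lift N to ℕ using hN
        have hle : N ≤ a := by omega
        rw [show ((a : ℤ) - N) = ((a - N : ℕ) : ℤ) by omega, Int.toNat_natCast, Int.toNat_natCast,
          Ring.choose_natCast, Ring.choose_natCast, Nat.choose_symm hle]
      · rw [ringChoose_eq_zero ha (by omega), mul_zero]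
  -- For `a < 0`: when `N < 0` the left side is zero and the residues at `0` and `z` cancel or both
  -- vanish; when `0 ≤ N` only the pole at `z` contributes.
  · obtain ⟨b, rfl⟩ : ∃ b : ℕ, a = -(b : ℤ) - 1 := ⟨(-a - 1).toNat, by omega⟩
    rw [if_pos (show 0 ≤ -(-(b : ℤ) - 1) - 1 by omega),
      show (-(-(b : ℤ) - 1) - 1).toNat = b by omega]
    rcases lt_or_ge N 0 with hN | hN
    · obtain ⟨M, rfl⟩ : ∃ M : ℕ, N = -(M : ℤ) - 1 := ⟨(-N - 1).toNat, by omega⟩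
      rw [if_neg (not_le.2 hN)]
      split_ifs with h
      · obtain ⟨k, rfl⟩ : ∃ k : ℕ, M = b + k := ⟨M - b, by omega⟩
        rw [show (-(b : ℤ) - 1 - (-((b + k : ℕ) : ℤ) - 1)).toNat = k by omega,
          show -((b + k : ℕ) : ℤ) - 1 - (-(b : ℤ) - 1) - 1 = -(k : ℤ) - 1 by push_cast; ring,
          ringChoose_neg_succ, ringChoose_neg_succ,
          show (-((b + k : ℕ) : ℤ) - 1).natAbs = b + k + 1 by omega,
          show (k + b).choose k = (b + k).choose b by rw [Nat.add_comm k b, Nat.choose_symm_add]]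
        have : ((-1 : ℤ) ^ k) * (-1) ^ k = 1 := by rw [← mul_pow]; simp
        rw [pow_succ, pow_add, ← mul_assoc]
        linear_combination ((-1) ^ b * ((b + k).choose b : ℤ)) * this
      · rw [ringChoose_eq_zero (by omega) (by omega), add_zero]
    · rw [if_pos hN, if_neg (by omega), zero_add]
      lift N to ℕ using hN
      rw [show (N : ℤ) - (-(b : ℤ) - 1) - 1 = ((N + b : ℕ) : ℤ) by push_cast; ring,
        Ring.choose_natCast, Int.toNat_natCast, ringChoose_neg_succ, Int.natAbs_natCast,
        ← mul_assoc, ← mul_pow, Nat.choose_symm_add]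
      simp

/-! ### The zero mode of `e^α` as a residue -/

section Exponential

open PowerSeries (derivative)

variable {ι : Type} [Fintype ι] [DecidableEq ι]

/-- `⟨α, α_i⟩` as a complex number. -/
def gramCoeff (G : Matrix ι ι ℚ) (α : ι → ℚ) (x : ι × ℕ) : ℂ := ((G.mulVec α x.1 : ℚ) : ℂ)

/-- The annihilation part of `e^α(w)`, as a polynomial in `w⁻¹`. -/
def annihPoly (G : Matrix ι ι ℚ) (α : ι → ℚ) : Heis ι →+* Polynomial (Heis ι) :=
  MvPolynomial.eval₂Hom (Polynomial.C.comp MvPolynomial.C) fun x =>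
    Polynomial.C (MvPolynomial.X x) -
      Polynomial.C (MvPolynomial.C (gramCoeff G α x)) * Polynomial.X ^ (x.2 + 1)

theorem annihPoly_C (G : Matrix ι ι ℚ) (α : ι → ℚ) (c : ℂ) :
    annihPoly G α (MvPolynomial.C c) = Polynomial.C (MvPolynomial.C c) := by
  simp [annihPoly]

theorem annihPoly_X (G : Matrix ι ι ℚ) (α : ι → ℚ) (x : ι × ℕ) :
    annihPoly G α (MvPolynomial.X x) = Polynomial.C (MvPolynomial.X x) -
      Polynomial.C (MvPolynomial.C (gramCoeff G α x)) * Polynomial.X ^ (x.2 + 1) := by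
  simp [annihPoly]

/-- Substituting `ζ` for the variable of `annihPoly` gives the shift by `-⟨α, α_i⟩ ζ^(m+1)`. All
expansions below produce a shift of this shape, with `ζ` an expansion of `1/(w-z)` or of `1/w`, so
the same polynomials, and the same indices `i` and `j`, occur in each of them. -/
theorem shift_map (G : Matrix ι ι ℚ) (α : ι → ℚ) {T : Type*} [CommRing T] (φ : ℂ →+* T) (ζ : T)
    (p : Heis ι) :
    shift (fun x : ι × ℕ => -(φ (gramCoeff G α x) * ζ ^ (x.2 + 1))) (MvPolynomial.map φ p) =
      (annihPoly G α p).sum fun j pj => ζ ^ j • MvPolynomial.map φ pj := by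
  have : ((shift (fun x : ι × ℕ => -(φ (gramCoeff G α x) * ζ ^ (x.2 + 1)))).toRingHom).comp
      (MvPolynomial.map φ) =
      (Polynomial.eval₂RingHom (MvPolynomial.map φ) (MvPolynomial.C ζ)).comp (annihPoly G α) := by
    refine MvPolynomial.ringHom_ext (fun c => ?_) fun x => ?_
    · simp [annihPoly_C, shift, MvPolynomial.algebraMap_eq]
    · simp [annihPoly_X, shift, sub_eq_add_neg]
  have h := congrArg (fun f => f p) this
  refine h.trans ?_
  change Polynomial.eval₂ _ _ _ = _
  rw [Polynomial.eval₂_eq_sum]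
  refine Finset.sum_congr rfl fun j _ => ?_
  dsimp only
  rw [MvPolynomial.smul_eq_C_mul, map_pow, mul_comm]

theorem wick_shift_map (G : Matrix ι ι ℚ) (α : ι → ℚ) {T : Type*} [CommRing T] (φ : ℂ →+* T)
    (ζ : T) (c d : ι × ℕ → T) (m : ι × ℕ → ι × ℕ → T) (p : Heis ι)
    (Q : MvPolynomial (ι × ℕ) T) :
    wick (fun x => c x + -(φ (gramCoeff G α x) * ζ ^ (x.2 + 1))) d m (MvPolynomial.map φ p) Q =
      (annihPoly G α p).sum fun j pj => ζ ^ j * wick c d m (MvPolynomial.map φ pj) Q := by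
  rw [wick_shift_left, shift_map, Polynomial.sum, map_sum, LinearMap.sum_apply]
  simp only [map_smul, LinearMap.smul_apply, smul_eq_mul]
  rfl

theorem wick_shift_map_right (G : Matrix ι ι ℚ) (α : ι → ℚ) {T : Type*} [CommRing T]
    (φ : ℂ →+* T) (ζ : T) (c d : ι × ℕ → T) (m : ι × ℕ → ι × ℕ → T)
    (P : MvPolynomial (ι × ℕ) T) (q : Heis ι) :
    wick c (fun x => d x + -(φ (gramCoeff G α x) * ζ ^ (x.2 + 1))) m P (MvPolynomial.map φ q) =
      (annihPoly G α q).sum fun i qi => ζ ^ i * wick c d m P (MvPolynomial.map φ qi) := by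
  rw [wick_shift_right, shift_map, Polynomial.sum, map_sum]
  simp only [map_smul, smul_eq_mul]
  rfl

theorem sum_mul_linForm {T : Type*} [CommRing T] (α : ι → ℚ) (f : Heis ι →+* T) (k : ℕ) :
    f (linForm α k) = ∑ i, f (MvPolynomial.C ((α i : ℚ) : ℂ)) * f (MvPolynomial.X (i, k)) := by
  simp [linForm]

theorem sum_mul_gramCoeff (G : Matrix ι ι ℚ) (α β : ι → ℚ) (k : ℕ) :
    ∑ i, ((α i : ℚ) : ℂ) * gramCoeff G β (i, k) = ((pairing G α β : ℚ) : ℂ) := by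
  simp [gramCoeff, pairing, dotProduct]

/-- Modes of the creation part of `e^α(w)`. -/
def expMode (α : ι → ℚ) (k : ℤ) : Heis ι := (expCreation α).coeff k

theorem expMode_natCast (α : ι → ℚ) (k : ℕ) :
    expMode α k = PowerSeries.coeff k (expSeries α) :=
  coeff_ofPowerSeries_natCast _ _

theorem expMode_of_neg (α : ι → ℚ) {k : ℤ} (h : k < 0) : expMode α k = 0 := by
  rw [expMode, expCreation_eq, coeff_ofPowerSeries, if_pos h]

/-- The residue of `w ^ s` times a polynomial in `w⁻¹` times the creation part of `e^α(w)`. -/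
def expResidue (α : ι → ℚ) (s : ℤ) : Polynomial (Heis ι) →ₗ[Heis ι] Heis ι :=
  -- The residue of `w^(s-i)` times the creation series is its coefficient of index `i - s - 1`.
  Polynomial.lsum fun i => LinearMap.toSpanSingleton (Heis ι) (Heis ι) (expMode α (i - s - 1))

theorem expResidue_apply (α : ι → ℚ) (s : ℤ) (f : Polynomial (Heis ι)) :
    expResidue α s f = f.sum fun i a => a * expMode α (i - s - 1) := rfl

theorem expResidue_C_mul_X_pow (α : ι → ℚ) (s : ℤ) (a : Heis ι) (i : ℕ) :
    expResidue α s (Polynomial.C a * Polynomial.X ^ i) = a * expMode α (i - s - 1) := by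
  rw [expResidue_apply, Polynomial.C_mul_X_pow_eq_monomial, Polynomial.sum_monomial_index]
  simp

/-- The zero mode of `e^α` on `M(1) ⊗ e^γ`, where `⟨α, γ⟩ = s`. -/
def expZero (G : Matrix ι ι ℚ) (α : ι → ℚ) (s : ℤ) (q : Heis ι) : Heis ι :=
  expResidue α s (annihPoly G α q)

/-- The mode with index `0` is the coefficient of `z^(-1)`. Expanding the annihilation part by
powers of the inverse variable leaves precisely the residue sum. -/
theorem coeff_vertexSeries_exp (G : Matrix ι ι ℚ) (α γ : ι → ℚ) {s : ℤ}
    (hs : pairing G α γ = s) (q : Heis ι) :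
    (vertexSeries G α γ 1 q).coeff (-1) = expZero G α s q := by
  have h1 : MvPolynomial.aeval (annihAt G α) (toSer q) =
      (annihPoly G α q).sum fun i qi => HahnSeries.single (-i : ℤ) qi := by
    have : ((MvPolynomial.aeval (annihAt G α)).toRingHom).comp toSer =
        (Polynomial.eval₂RingHom (HahnSeries.C : Heis ι →+* Ser ι)
          (HahnSeries.single (-1 : ℤ) (1 : Heis ι))).comp (annihPoly G α) := by
      refine MvPolynomial.ringHom_ext (fun c => ?_) fun x => ?_
      · simp [annihPoly_C, toSer, constHom_apply]
      · simp [annihPoly_X, toSer, annihAt, gramCoeff, HahnSeries.C_apply,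
          HahnSeries.single_mul_single, HahnSeries.single_pow]
    refine (congrArg (fun f => f q) this).trans ?_
    change Polynomial.eval₂ _ _ _ = _
    rw [Polynomial.eval₂_eq_sum]
    refine Finset.sum_congr rfl fun j _ => ?_
    simp [HahnSeries.C_apply, HahnSeries.single_mul_single, HahnSeries.single_pow]
  rw [vertexSeries_eq, map_one, wick_one, h1, hs, zpowRat_intCast, Polynomial.sum, Finset.mul_sum,
    HahnSeries.coeff_sum, expZero, expResidue_apply, Polynomial.sum]
  refine Finset.sum_congr rfl fun i _ => ?_
  rw [mul_assoc, HahnSeries.single_mul_single, map_one, one_mul]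
  have := HahnSeries.coeff_mul_single_add (x := expCreation α) (r := (annihPoly G α q).coeff i)
    (a := i - s - 1) (b := s + -i)
  rw [show (i : ℤ) - s - 1 + (s + -i) = -1 by ring] at this
  rw [this, mul_comm]
  rfl

end Exponential

section Series

open PowerSeries (derivative)

/-- If `F` is the exponential of an integral of `l` and `D l = μ'`, then `D F - μ F` solves `G' = l
G` with initial value zero, hence vanishes. -/
theorem derivation_isExpInt {R A : Type*} [CommRing R] [CommRing A] [Algebra R A] [Algebra ℚ A]
    (D : Derivation R A A) {l F μ : PowerSeries A} (hF : IsExpInt l F)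
    (hμ : derivative A μ = PowerSeries.mk fun n => D (PowerSeries.coeff n l))
    (h0 : PowerSeries.constantCoeff μ = 0) :
    PowerSeries.mk (fun n => D (PowerSeries.coeff n F)) = μ * F := by
  have h1 : derivative A (PowerSeries.mk fun n => D (PowerSeries.coeff n F)) =
      PowerSeries.mk fun n => D (PowerSeries.coeff n (derivative A F)) := by
    ext n
    rw [PowerSeries.coeff_derivative, PowerSeries.coeff_mk, PowerSeries.coeff_mk,
      PowerSeries.coeff_derivative, Derivation.leibniz]
    simp [mul_comm]
  have h2 : (PowerSeries.mk fun n => D (PowerSeries.coeff n (l * F))) =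
      (PowerSeries.mk fun n => D (PowerSeries.coeff n l)) * F +
        l * PowerSeries.mk fun n => D (PowerSeries.coeff n F) := by
    ext n
    simp only [PowerSeries.coeff_mk, PowerSeries.coeff_mul, map_add, map_sum, Derivation.leibniz,
      smul_eq_mul, Finset.sum_add_distrib]
    rw [add_comm]
    congr 1
    exact Finset.sum_congr rfl fun _ _ => mul_comm _ _
  refine sub_eq_zero.1 (powerSeries_ode_unique (l := l) (G := 0) ?_ ?_ ?_)
  · rw [map_sub, h1, Derivation.leibniz, hμ, hF.deriv, h2, smul_eq_mul, smul_eq_mul]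
    ring
  · rw [map_zero, mul_zero]
  · rw [map_sub, map_mul, h0, ← PowerSeries.coeff_zero_eq_constantCoeff_apply,
      PowerSeries.coeff_mk, PowerSeries.coeff_zero_eq_constantCoeff_apply, hF.constantCoeff]
    simp

end Series

/-! ### Expansion for `|w| > |z|`: the annihilation part of `e^α(w)` acting on `Y(u,z) v` -/

section Exponential

variable {ι : Type} [Fintype ι] [DecidableEq ι]

theorem map_wick_toSer {T : Type*} [CommRing T] (φ : Ser ι →+* T) (c d : ι × ℕ → Ser ι)
    (m : ι × ℕ → ι × ℕ → Ser ι) (p q : Heis ι) :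
    φ (wick c d m (toSer p) (toSer q)) =
      wick (fun x => φ (c x)) (fun x => φ (d x)) (fun x y => φ (m x y))
        (MvPolynomial.map (φ.comp (constHom ι)) p) (MvPolynomial.map (φ.comp (constHom ι)) q) := by
  rw [map_wick, toSer, MvPolynomial.map_map, MvPolynomial.map_map]

theorem pairing_comm {G : Matrix ι ι ℚ} (hG : G.transpose = G) (α β : ι → ℚ) :
    pairing G α β = pairing G β α := by
  rw [pairing, pairing, Matrix.dotProduct_mulVec, ← Matrix.mulVec_transpose, hG, dotProduct_comm]

theorem sum_mul_gramCoeff' {G : Matrix ι ι ℚ} {α β : ι → ℚ} {r : ℤ}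
    (hr : pairing G α β = r) (k : ℕ) :
    ∑ i, (MvPolynomial.C ((α i : ℚ) : ℂ) : Heis ι) * MvPolynomial.C (gramCoeff G β (i, k)) =
      (r : Heis ι) := by
  rw [← map_intCast (MvPolynomial.C : ℂ →+* Heis ι) r, show (r : ℂ) = ((r : ℚ) : ℂ) by simp, ← hr,
    ← sum_mul_gramCoeff G α β k, map_sum]
  simp

theorem annihPoly_linForm {G : Matrix ι ι ℚ} {α β : ι → ℚ} {r : ℤ} (hr : pairing G β α = r)
    (k : ℕ) : annihPoly G α (linForm β k) =
      Polynomial.C (linForm β k) - Polynomial.C (r : Heis ι) * Polynomial.X ^ (k + 1) := by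
  rw [sum_mul_linForm, ← sum_mul_gramCoeff' hr k]
  simp only [annihPoly_C, annihPoly_X, mul_sub, Finset.sum_sub_distrib, linForm, map_sum,
    Finset.sum_mul, map_mul, mul_assoc]

/-- With `X = w⁻¹`, moving the annihilation part of `e^α(w)` past the creation part of `e^β(z)`
costs the factor `(1 - z/w)^⟨β,α⟩`. -/
theorem annihPoly_expSeries {G : Matrix ι ι ℚ} {α β : ι → ℚ} {r : ℤ} (hr : pairing G β α = r) :
    PowerSeries.map (annihPoly G α) (expSeries β) =
      PowerSeries.map Polynomial.C (expSeries β) * binom Polynomial.X r := by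
  refine IsExpInt.unique ((isExpInt_expSeries β).map _) ?_
  convert ((isExpInt_expSeries β).map Polynomial.C).mul (isExpInt_binom Polynomial.X r) using 1
  ext1 n
  simp [annihPoly_linForm hr, sub_eq_add_neg]

/-- The expansion of `η / (1 - η z)`. -/
def geomEta (ι : Type) : LaurentSeries (Polynomial (Heis ι)) :=
  HahnSeries.ofPowerSeries ℤ _ (PowerSeries.C Polynomial.X * binom Polynomial.X (-1))

theorem geomEta_pow (j : ℕ) : geomEta ι ^ j =
    HahnSeries.ofPowerSeries ℤ _ (PowerSeries.C (Polynomial.X ^ j) * binom Polynomial.X (-j)) := by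
  rw [geomEta, ← map_pow, mul_pow, binom_pow, map_pow, mul_neg_one]

/-- The shifts of all `α_i(-k-m-1)` add up, by the negative binomial series, to a single power of `η
/ (1 - ηz)`, which is `1/(w-z)` for `η = w⁻¹`. The zero mode is a scalar and does not move. -/
theorem laurentMap_annihPoly_createAt (G : Matrix ι ι ℚ) (α γ : ι → ℚ) (x : ι × ℕ) :
    laurentMap (annihPoly G α) (createAt G γ x) = laurentMap Polynomial.C (createAt G γ x) +
      -(((laurentMap Polynomial.C).comp (constHom ι)) (gramCoeff G α x) *
        geomEta ι ^ (x.2 + 1)) := by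
  have h1 : laurentMap (annihPoly G α) (zeroMode G γ x) =
      laurentMap Polynomial.C (zeroMode G γ x) := by
    rw [zeroMode, laurentMap_single, laurentMap_single, annihPoly_C]
  rw [createAt, map_add, map_add, h1, creation, laurentMap_ofPowerSeries, laurentMap_ofPowerSeries,
    geomEta_pow, RingHom.comp_apply, constHom_apply, laurentMap_single, add_right_comm]
  congr 1
  rw [← HahnSeries.C_apply, ← HahnSeries.ofPowerSeries_C, ← map_mul, ← map_neg, ← map_add]
  congr 1
  ext1 n
  rw [map_add, map_neg, PowerSeries.coeff_C_mul, PowerSeries.coeff_C_mul, Nat.cast_succ, 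
    coeff_binom_neg, PowerSeries.coeff_map, PowerSeries.coeff_map, PowerSeries.coeff_mk, map_mul,
    annihPoly_C, annihPoly_X, map_mul]
  simp only [map_natCast, gramCoeff]
  ring

theorem laurentMap_annihPoly_annihAt (G : Matrix ι ι ℚ) (α β : ι → ℚ) (x : ι × ℕ) :
    laurentMap (annihPoly G α) (annihAt G β x) = laurentMap Polynomial.C (annihAt G β x) +
      -(((laurentMap Polynomial.C).comp (constHom ι)) (gramCoeff G α x) *
        HahnSeries.C Polynomial.X ^ (x.2 + 1)) := by
  rw [annihAt, map_sub, map_sub, laurentMap_single, laurentMap_single, laurentMap_single,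
    laurentMap_single, annihPoly_C, annihPoly_X, ← map_pow, RingHom.comp_apply, constHom_apply,
    laurentMap_single, HahnSeries.C_apply, HahnSeries.single_mul_single, HahnSeries.single_sub]
  simp only [add_zero, gramCoeff]
  ring

/-- The shift on `p` has `ζ = 1/(w-z)` and that on `q` has `ζ = 1/w`. Together with the exponential
factor they give `w^(-r-i) (w-z)^(r-j)`, written in `η = w⁻¹`. -/
theorem laurentMap_annihPoly_vertexSeries {G : Matrix ι ι ℚ} {α β : ι → ℚ} {r : ℤ}
    (hr : pairing G β α = r) (γ : ι → ℚ) (p q : Heis ι) :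
    laurentMap (annihPoly G α) (vertexSeries G β γ p q) =
      (annihPoly G α p).sum fun j pj => (annihPoly G α q).sum fun i qi =>
        HahnSeries.ofPowerSeries ℤ _ (PowerSeries.C (Polynomial.X ^ (i + j)) *
          binom Polynomial.X (r - j)) * laurentMap Polynomial.C (vertexSeries G β γ pj qi) := by
  have h1 : ∀ k c, laurentMap (annihPoly G α) (zmon k c) =
      laurentMap Polynomial.C (zmon (ι := ι) k c) := fun k c => by
    rw [laurentMap_single, laurentMap_single, annihPoly_C]
  have h2 : laurentMap (annihPoly G α) (zpowRat (pairing G β γ)) =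
      laurentMap Polynomial.C (zpowRat (ι := ι) (pairing G β γ)) := by
    rw [zpowRat]; split_ifs
    · exact h1 _ _
    · rw [map_zero, map_zero]
  have h3 : (laurentMap (annihPoly G α)).comp (constHom ι) =
      (laurentMap Polynomial.C).comp (constHom ι) := RingHom.ext fun c => h1 0 c
  rw [vertexSeries_eq, map_mul, map_mul, h2, map_wick_toSer, h3]
  simp only [laurentMap_annihPoly_createAt, laurentMap_annihPoly_annihAt]
  have h4 : ∀ x y, laurentMap (annihPoly G α) (contractAt G x y) =
      laurentMap Polynomial.C (contractAt G x y) := fun x y => h1 _ _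
  simp only [h4]
  rw [wick_shift_map, expCreation_eq, laurentMap_ofPowerSeries, annihPoly_expSeries hr, 
    Polynomial.sum, Polynomial.sum, Finset.mul_sum]
  refine Finset.sum_congr rfl fun j _ => ?_
  rw [wick_shift_map_right, Polynomial.sum, Polynomial.sum, Finset.mul_sum, Finset.mul_sum]
  refine Finset.sum_congr rfl fun i _ => ?_
  rw [← map_wick_toSer, vertexSeries_eq, map_mul, map_mul, map_mul, map_mul, geomEta_pow,
    sub_eq_add_neg, binom_add, map_mul, map_mul, ← laurentMap_ofPowerSeries, ← expCreation_eq,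
    pow_add, map_mul, map_mul, HahnSeries.ofPowerSeries_C, HahnSeries.ofPowerSeries_C,
    map_pow (HahnSeries.C : Polynomial (Heis ι) →+* _) _ i]
  ring

end Exponential

/-! ### Expansion for `|z| > |w|`: `Y(u,z)` acting on the modes of `e^α(w)` -/

section Exponential

open PowerSeries (derivative)

variable {ι : Type} [Fintype ι] [DecidableEq ι]

theorem zeroMode_add (G : Matrix ι ι ℚ) (α γ : ι → ℚ) (x : ι × ℕ) :
    zeroMode G (α + γ) x = zeroMode G γ x + zeroMode G α x := by
  rw [zeroMode, zeroMode, zeroMode, ← HahnSeries.single_add, ← map_add, Matrix.mulVec_add, 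
    Pi.add_apply]
  congr 2
  push_cast
  ring

theorem pairing_add_right (G : Matrix ι ι ℚ) (β α γ : ι → ℚ) :
    pairing G β (α + γ) = pairing G β α + pairing G β γ := by
  rw [pairing, pairing, pairing, Matrix.mulVec_add, dotProduct_add]

theorem pairing_add_left (G : Matrix ι ι ℚ) (α β γ : ι → ℚ) :
    pairing G (α + β) γ = pairing G α γ + pairing G β γ := by
  rw [pairing, pairing, pairing, add_dotProduct]

/-- The expansion of `1 / (w - z)` in powers of `w`. -/
def geomInv (ι : Type) : PowerSeries (Ser ι) :=
  -(PowerSeries.C (zmon (-1) 1) * binom (zmon (-1) 1) (-1))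

theorem geomInv_pow (j : ℕ) : geomInv ι ^ j =
    (-1) ^ j * (PowerSeries.C (zmon (-j) 1) * binom (zmon (-1) 1) (-j)) := by
  refine (neg_pow (PowerSeries.C (zmon (-1) 1 : Ser ι) * binom (zmon (-1) 1) (-1)) j).trans ?_
  rw [mul_pow, ← map_pow, binom_pow, mul_neg_one, zmon, HahnSeries.single_pow,
    ← map_pow, one_pow]
  simp [zmon]

theorem coeff_geomInv_pow (m k : ℕ) : PowerSeries.coeff k (geomInv ι ^ (m + 1)) =
    zmon (-(k : ℤ) - 1 - m) ((-1) ^ (m + 1) * ((k + m).choose m : ℕ)) := by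
  rw [geomInv_pow, show ((-1 : PowerSeries (Ser ι)) ^ (m + 1)) =
    PowerSeries.C ((-1) ^ (m + 1) : Ser ι) by simp, PowerSeries.coeff_C_mul, PowerSeries.coeff_C_mul,
    Nat.cast_succ, coeff_binom_neg, zmon, zmon, HahnSeries.single_pow, ← map_pow, one_pow, 
    show ((-1 : Ser ι) ^ (m + 1)) = zmon 0 ((-1) ^ (m + 1)) by
      rw [← constHom_apply, map_pow, map_neg, map_one],
    show (((k + m).choose m : ℕ) : Ser ι) = zmon 0 (((k + m).choose m : ℕ) : ℂ) by
      rw [← constHom_apply, map_natCast], zmon_mul, zmon_mul, zmon_mul]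
  congr 1
  · simp; ring_nf
  · ring_nf

/-- The generating function of the derivations `contractAt x` on the modes of `e^α(w)`. -/
def contractExp (G : Matrix ι ι ℚ) (α : ι → ℚ) (x : ι × ℕ) : PowerSeries (Ser ι) :=
  -(PowerSeries.C (constHom ι (gramCoeff G α x)) * geomInv ι ^ (x.2 + 1)) - 
    PowerSeries.C (zeroMode G α x)

theorem isExpInt_toSer (α : ι → ℚ) : 
    IsExpInt (PowerSeries.mk fun n => toSer (linForm α n)) (PowerSeries.map toSer (expSeries α)) := by
  convert IsExpInt.map (B := MvPolynomial (ι × ℕ) (Ser ι)) (isExpInt_expSeries α) toSer using 1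
  ext1 n
  simp

theorem toSer_linForm (α : ι → ℚ) (n : ℕ) : toSer (linForm α n) =
    ∑ i, MvPolynomial.C (constHom ι ((α i : ℚ) : ℂ)) * MvPolynomial.X (i, n) := by
  simp [linForm, toSer]

/-- Together with `constantCoeff_contractExp` this identifies `contractExp` as the `w`-integral of
the contraction with `α(w)`, as required by `derivation_isExpInt`. -/
theorem coeff_succ_contractExp (G : Matrix ι ι ℚ) (α : ι → ℚ) (x : ι × ℕ) (n : ℕ) :
    PowerSeries.coeff (n + 1) (contractExp G α x) * ((n : Ser ι) + 1) =
      ∑ i, constHom ι ((α i : ℚ) : ℂ) * contractAt G x (i, n) := by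
  have h0 : PowerSeries.coeff (n + 1) (PowerSeries.C (zeroMode G α x)) = 0 := by
    rw [PowerSeries.coeff_C, if_neg (Nat.succ_ne_zero _)]
  have h1 : gramCoeff G α x = ∑ i, (G x.1 i : ℂ) * (α i : ℂ) := by
    simp [gramCoeff, Matrix.mulVec, dotProduct]
  rw [contractExp, map_sub, h0, sub_zero, map_neg, PowerSeries.coeff_C_mul, coeff_geomInv_pow,
    constHom_apply, zmon_mul, show (n : Ser ι) + 1 = zmon 0 ((n : ℂ) + 1) by
      rw [← constHom_apply, map_add, map_natCast, map_one], ← HahnSeries.single_neg, ← map_neg,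
    zmon_mul, h1]
  simp only [contractAt, constHom_apply, zmon_mul]
  rw [sum_zmon]
  congr 1
  · push_cast; ring
  · rw [neg_eq_neg_one_mul, Finset.sum_mul, Finset.mul_sum, Finset.sum_mul]
    refine Finset.sum_congr rfl fun i _ => ?_
    push_cast
    ring

theorem derivative_map_contractExp (G : Matrix ι ι ℚ) (α : ι → ℚ) (x : ι × ℕ) :
    derivative _ (PowerSeries.map MvPolynomial.C (contractExp G α x)) =
      PowerSeries.mk fun n => contract (contractAt G) x
        (PowerSeries.coeff n (PowerSeries.mk fun n => toSer (linForm α n))) := by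
  ext1 n
  rw [PowerSeries.coeff_derivative, PowerSeries.coeff_mk, PowerSeries.coeff_mk,
    PowerSeries.coeff_map, toSer_linForm, map_sum]
  have h : ∀ (a : Ser ι) y, contract (contractAt G) x (MvPolynomial.C a * MvPolynomial.X y) =
      MvPolynomial.C (a * contractAt G x y) := fun a y => by
    rw [← MvPolynomial.smul_eq_C_mul, Derivation.map_smul, contract_X, MvPolynomial.smul_eq_C_mul,
      ← map_mul]
  simp only [h]
  rw [← map_sum, ← map_natCast (MvPolynomial.C), ← map_one MvPolynomial.C, ← map_add, ← map_mul,
    coeff_succ_contractExp]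

/-- At `w = 0` the pole term equals the zero mode of `α`, which is why that mode is subtracted in
`contractExp`. It reappears with the opposite sign when `γ` is replaced by `α + γ`, and cancels in
`vertexSeries_exp_right`. -/
theorem constantCoeff_contractExp (G : Matrix ι ι ℚ) (α : ι → ℚ) (x : ι × ℕ) :
    PowerSeries.coeff 0 (contractExp G α x) = 0 := by
  rw [contractExp, map_sub, map_neg, PowerSeries.coeff_C_mul, coeff_geomInv_pow,
    PowerSeries.coeff_zero_C, constHom_apply, zmon_mul, zeroMode, ← HahnSeries.single_neg, ← map_neg,
    sub_eq_zero]
  congr 1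
  · simp
  · congr 1
    simp [gramCoeff, pow_succ]
    ring

theorem contract_toSer_expSeries (G : Matrix ι ι ℚ) (α : ι → ℚ) (x : ι × ℕ) (n : ℕ) :
    contract (contractAt G) x (toSer (PowerSeries.coeff n (expSeries α))) =
      ∑ ij ∈ Finset.HasAntidiagonal.antidiagonal n, PowerSeries.coeff ij.1 (contractExp G α x) •
        toSer (PowerSeries.coeff ij.2 (expSeries α)) := by
  have h := derivation_isExpInt (contract (contractAt G) x) (isExpInt_toSer α)
    (derivative_map_contractExp G α x) (by
      rw [← PowerSeries.coeff_zero_eq_constantCoeff_apply, PowerSeries.coeff_map,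
        constantCoeff_contractExp, map_zero])
  have := congrArg (PowerSeries.coeff n) h
  rw [PowerSeries.coeff_mk, PowerSeries.coeff_mul, PowerSeries.coeff_map] at this
  rw [this]
  refine Finset.sum_congr rfl fun ij _ => ?_
  rw [PowerSeries.coeff_map, PowerSeries.coeff_map, MvPolynomial.smul_eq_C_mul]

/-- The annihilation part of `e^β(z)` meets the creation part of `e^α(w)` and produces `(1 -
w/z)^⟨α,β⟩`. -/
theorem aeval_annihAt_expSeries {G : Matrix ι ι ℚ} {α β : ι → ℚ} {r : ℤ}
    (hr : pairing G α β = r) :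
    (PowerSeries.mk fun n => MvPolynomial.aeval (annihAt G β)
      (toSer (PowerSeries.coeff n (expSeries α)))) =
      PowerSeries.map HahnSeries.C (expSeries α) * binom (zmon (-1) 1) r := by
  have h : (PowerSeries.mk fun n => MvPolynomial.aeval (annihAt G β)
      (toSer (PowerSeries.coeff n (expSeries α)))) =
      PowerSeries.map (MvPolynomial.aeval (annihAt G β)).toRingHom
        (PowerSeries.map toSer (expSeries α)) := by
    ext1 n; simp
  rw [h]
  refine IsExpInt.unique ((isExpInt_toSer α).map _) ?_
  convert ((isExpInt_expSeries α).map (HahnSeries.C : Heis ι →+* Ser ι)).mul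
    (isExpInt_binom (zmon (-1) 1) r) using 1
  ext1 n
  have h1 : (r : Ser ι) = constHom ι r := by simp
  have h2 : ∀ c : ℂ, (HahnSeries.C (MvPolynomial.C c) : Ser ι) = constHom ι c := fun c => rfl
  rw [map_add, PowerSeries.coeff_map, PowerSeries.coeff_map, PowerSeries.coeff_mk,
    PowerSeries.coeff_mk, PowerSeries.coeff_mk, toSer_linForm, map_sum, h1,
    show (r : ℂ) = ((r : ℚ) : ℂ) by simp, ← hr, ← sum_mul_gramCoeff G α β n, linForm, map_sum,
    map_sum, ← Finset.sum_neg_distrib, Finset.sum_mul, ← Finset.sum_add_distrib]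
  refine Finset.sum_congr rfl fun i _ => ?_
  simp only [AlgHom.toRingHom_eq_coe, RingHom.coe_coe, map_mul, MvPolynomial.aeval_X,
    MvPolynomial.aeval_C, annihAt, Algebra.algebraMap_self, RingHom.id_apply, h2, mul_sub]
  rw [zmon, HahnSeries.single_pow, ← map_pow, one_pow, gramCoeff, HahnSeries.C_apply (MvPolynomial.X _)]
  have h3 : constHom ι ((G.mulVec β i : ℚ) : ℂ) * zmon ((n + 1) • -1) 1 =
      zmon (-((n : ℤ) + 1)) ((G.mulVec β i : ℚ) : ℂ) := by
    rw [constHom_apply, zmon_mul]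
    simp
  linear_combination constHom ι ((α i : ℚ) : ℂ) * h3

/-- The exponentials contribute `(z-w)^r`, and contractions of total order `j` between `p` and
`e^α(w)` contribute `(w-z)^(-j)`. The result is `(-1)^j (z-w)^(r-j)`, expanded in powers of `w`. -/
theorem vertexSeries_exp_right {G : Matrix ι ι ℚ} {α β γ : ι → ℚ} {r t : ℤ}
    (hr : pairing G α β = r) (hr' : pairing G β α = r) (ht : pairing G β γ = t) (p q : Heis ι) :
    (PowerSeries.mk fun n => vertexSeries G β (α + γ) p (q * PowerSeries.coeff n (expSeries α))) =
      (annihPoly G α p).sum fun j pj => PowerSeries.C (zmon (r - j) 1) *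
        (-1) ^ j * binom (zmon (-1) 1) (r - j) * PowerSeries.map HahnSeries.C (expSeries α) *
          PowerSeries.C (vertexSeries G β γ pj q) := by
  have hz : zpowRat (ι := ι) (pairing G β (α + γ)) = zmon r 1 * zmon t 1 := by
    rw [pairing_add_right, hr', ht, ← Int.cast_add, zpowRat_intCast, zmon_mul, mul_one]
  have h0 : (PowerSeries.mk fun n =>
      vertexSeries G β (α + γ) p (q * PowerSeries.coeff n (expSeries α))) =
      PowerSeries.C (expCreation β * (zmon r 1 * zmon t 1)) * PowerSeries.mk fun n =>
        wick (createAt G (α + γ)) (annihAt G β) (contractAt G) (toSer p)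
          (toSer q * toSer (PowerSeries.coeff n (expSeries α))) := by
    ext1 n
    rw [PowerSeries.coeff_mk, PowerSeries.coeff_C_mul, PowerSeries.coeff_mk, vertexSeries_eq, hz,
      map_mul]
  have h1 : (fun x => PowerSeries.C (createAt G (α + γ) x) + contractExp G α x) =
      fun x => PowerSeries.C (createAt G γ x) +
        -((PowerSeries.C.comp (constHom ι)) (gramCoeff G α x) * geomInv ι ^ (x.2 + 1)) := by
    funext x
    rw [contractExp, createAt, createAt, zeroMode_add, map_add, map_add, map_add, RingHom.comp_apply]
    ring
  rw [h0, wick_mul_exp _ _ _ (contractExp G α) _ (contract_toSer_expSeries G α), h1,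
    aeval_annihAt_expSeries hr, toSer, MvPolynomial.map_map, wick_shift_map, Polynomial.sum,
    Polynomial.sum, Finset.mul_sum, Finset.mul_sum]
  refine Finset.sum_congr rfl fun j _ => ?_
  rw [MvPolynomial.map_map, ← map_wick_toSer, vertexSeries_eq, ht, zpowRat_intCast, geomInv_pow,
    sub_eq_add_neg, binom_add, ← one_mul (1 : ℂ), ← zmon_mul, ← one_mul (1 : ℂ)]
  simp only [map_mul, one_mul]
  ring

end Exponential

/-! ### Expansion at `w = z`: vertex operators of the modes of `e^α` -/

section Exponential

open PowerSeries (derivative)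

variable {ι : Type} [Fintype ι] [DecidableEq ι]

theorem taylor_zmon_neg (n : ℕ) (k : ℕ) : PowerSeries.coeff k (taylor (zmon (ι := ι) (-(n : ℤ) - 1) 1)) =
    zmon (-((n : ℤ) + 1) - k) ((-1) ^ k * ((k + n).choose k : ℕ)) := by
  rw [coeff_taylor, LaurentSeries.hasseDeriv_single, ringChoose_neg_succ, zmon,
    show -(n : ℤ) - 1 - k = -((n : ℤ) + 1) - k by ring]
  congr 1
  simp [zsmul_eq_mul]

/-- The generating function of the derivations `contractAt · y` on the modes of `e^α(w)`. -/
def contractExp' (G : Matrix ι ι ℚ) (α : ι → ℚ) (y : ι × ℕ) : PowerSeries (Ser ι) :=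
  -(PowerSeries.C (constHom ι (gramCoeff G α y)) * taylor (zmon (-(y.2 : ℤ) - 1) 1)) +
    PowerSeries.C (zmon (-(y.2 : ℤ) - 1) (gramCoeff G α y))

theorem coeff_succ_contractExp' {G : Matrix ι ι ℚ} (hG : G.transpose = G) (α : ι → ℚ) (y : ι × ℕ)
    (n : ℕ) :
    PowerSeries.coeff (n + 1) (contractExp' G α y) * ((n : Ser ι) + 1) =
      ∑ i, constHom ι ((α i : ℚ) : ℂ) * contractAt G (i, n) y := by
  have h0 : PowerSeries.coeff (n + 1)
      (PowerSeries.C (zmon (ι := ι) (-(y.2 : ℤ) - 1) (gramCoeff G α y))) = 0 := by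
    rw [PowerSeries.coeff_C, if_neg (Nat.succ_ne_zero _)]
  have hs : ∀ i, G i y.1 = G y.1 i := fun i => by
    conv_lhs => rw [← hG, Matrix.transpose_apply]
  have h1 : gramCoeff G α y = ∑ i, (G i y.1 : ℂ) * (α i : ℂ) := by
    simp [gramCoeff, Matrix.mulVec, dotProduct, hs]
  have h2 : (((n + 1 + y.2).choose (n + 1) : ℕ) : ℂ) * ((n : ℂ) + 1) =
      ((y.2 + 1 + n).choose n : ℕ) * ((y.2 + 1 : ℕ) : ℂ) := by
    have := Nat.choose_succ_right_eq (n + 1 + y.2) n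
    rw [show n + 1 + y.2 - n = y.2 + 1 by omega] at this
    rw [show y.2 + 1 + n = n + 1 + y.2 by ring]
    exact_mod_cast this
  rw [contractExp', map_add, h0, add_zero, map_neg, PowerSeries.coeff_C_mul, taylor_zmon_neg,
    constHom_apply, zmon_mul, show (n : Ser ι) + 1 = zmon 0 ((n : ℂ) + 1) by
      rw [← constHom_apply, map_add, map_natCast, map_one], ← HahnSeries.single_neg, ← map_neg,
    zmon_mul, h1]
  simp only [contractAt, constHom_apply, zmon_mul]
  rw [sum_zmon]
  congr 1
  · push_cast; ring
  · rw [neg_eq_neg_one_mul, Finset.sum_mul, Finset.mul_sum, Finset.sum_mul]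
    refine Finset.sum_congr rfl fun i _ => ?_
    linear_combination (-1) ^ n * (G i y.1 : ℂ) * (α i : ℂ) * h2

theorem derivative_map_contractExp' {G : Matrix ι ι ℚ} (hG : G.transpose = G) (α : ι → ℚ)
    (y : ι × ℕ) :
    derivative _ (PowerSeries.map MvPolynomial.C (contractExp' G α y)) =
      PowerSeries.mk fun n => contract (fun a b => contractAt G b a) y
        (PowerSeries.coeff n (PowerSeries.mk fun n => toSer (linForm α n))) := by
  ext1 n
  rw [PowerSeries.coeff_derivative, PowerSeries.coeff_mk, PowerSeries.coeff_mk,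
    PowerSeries.coeff_map, toSer_linForm, map_sum]
  have h : ∀ (a : Ser ι) x, contract (fun a b => contractAt G b a) y
      (MvPolynomial.C a * MvPolynomial.X x) = MvPolynomial.C (a * contractAt G x y) := fun a x => by
    rw [← MvPolynomial.smul_eq_C_mul, Derivation.map_smul, contract_X, MvPolynomial.smul_eq_C_mul,
      ← map_mul]
  simp only [h]
  rw [← map_sum, ← map_natCast (MvPolynomial.C), ← map_one MvPolynomial.C, ← map_add, ← map_mul,
    coeff_succ_contractExp' hG]

theorem constantCoeff_contractExp' (G : Matrix ι ι ℚ) (α : ι → ℚ) (x : ι × ℕ) :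
    PowerSeries.coeff 0 (contractExp' G α x) = 0 := by
  rw [contractExp', map_add, map_neg, PowerSeries.coeff_C_mul, taylor_zmon_neg,
    PowerSeries.coeff_zero_C, constHom_apply, zmon_mul, neg_add_eq_zero]
  congr 1
  · simp; ring_nf
  · simp

theorem contract_toSer_expSeries' {G : Matrix ι ι ℚ} (hG : G.transpose = G) (α : ι → ℚ)
    (y : ι × ℕ) (n : ℕ) :
    contract (fun a b => contractAt G b a) y (toSer (PowerSeries.coeff n (expSeries α))) =
      ∑ ij ∈ Finset.HasAntidiagonal.antidiagonal n, PowerSeries.coeff ij.1 (contractExp' G α y) •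
        toSer (PowerSeries.coeff ij.2 (expSeries α)) := by
  have h := derivation_isExpInt (contract (fun a b => contractAt G b a) y) (isExpInt_toSer α)
    (derivative_map_contractExp' hG α y) (by
      rw [← PowerSeries.coeff_zero_eq_constantCoeff_apply, PowerSeries.coeff_map,
        constantCoeff_contractExp', map_zero])
  have := congrArg (PowerSeries.coeff n) h
  rw [PowerSeries.coeff_mk, PowerSeries.coeff_mul, PowerSeries.coeff_map] at this
  rw [this]
  refine Finset.sum_congr rfl fun ij _ => ?_
  rw [PowerSeries.coeff_map, PowerSeries.coeff_map, MvPolynomial.smul_eq_C_mul]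

/-- The creation part and the zero mode of `α(z)`. -/
def createField (G : Matrix ι ι ℚ) (α γ : ι → ℚ) (k : ℕ) : Ser ι :=
  ∑ i, constHom ι ((α i : ℚ) : ℂ) * createAt G γ (i, k)

/-- Variables with second index `k` stand for `k`-th divided derivatives of the field, so the
generating series over `k` is a Taylor expansion. -/
theorem hasseDeriv_createAt (G : Matrix ι ι ℚ) (γ : ι → ℚ) (i : ι) (k : ℕ) :
    LaurentSeries.hasseDeriv (Heis ι) k (createAt G γ (i, 0)) = createAt G γ (i, k) := by
  rw [createAt, createAt, map_add]
  congr 1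
  · ext1; funext n
    rw [coeff_hasseDeriv, creation, creation, coeff_ofPowerSeries, coeff_ofPowerSeries]
    rcases lt_or_ge n 0 with hn | hn
    · rw [if_pos hn]
      split_ifs with h
      · rw [mul_zero]
      · rw [ringChoose_eq_zero (by omega) (by omega)]; simp
    · rw [if_neg (by omega), if_neg (by omega), PowerSeries.coeff_mk, PowerSeries.coeff_mk]
      lift n to ℕ using hn
      rw [← Nat.cast_add, Ring.choose_natCast, Int.natAbs_natCast, Int.natAbs_natCast]
      simp
  · rw [zeroMode, zeroMode, LaurentSeries.hasseDeriv_single, 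
      show (-1 - ((0 : ℕ) : ℤ)) = -((0 : ℕ) : ℤ) - 1 by ring, ringChoose_neg_succ]
    simp [zmon]

theorem hasseDeriv_createField (G : Matrix ι ι ℚ) (α γ : ι → ℚ) (k : ℕ) :
    LaurentSeries.hasseDeriv (Heis ι) k (createField G α γ 0) = createField G α γ k := by
  rw [createField, createField, map_sum]
  refine Finset.sum_congr rfl fun i _ => ?_
  have h : ∀ f : Ser ι, constHom ι ((α i : ℚ) : ℂ) * f =
      (MvPolynomial.C ((α i : ℚ) : ℂ) : Heis ι) • f := fun f => HahnSeries.C_mul_eq_smul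
  rw [h, h, map_smul, hasseDeriv_createAt]

theorem createField_zero_eq {G : Matrix ι ι ℚ} {α γ : ι → ℚ} {s : ℤ} (hs : pairing G α γ = s) :
    createField G α γ 0 =
      HahnSeries.ofPowerSeries ℤ _ (PowerSeries.mk (linForm α)) + zmon (-1) s := by
  have h1 : (s : ℂ) = ((s : ℚ) : ℂ) := by simp
  rw [h1, ← hs, ← sum_mul_gramCoeff G α γ 0, ← sum_zmon]
  have h2 : (PowerSeries.mk (linForm α)) = ∑ i, PowerSeries.C (MvPolynomial.C ((α i : ℚ) : ℂ)) * 
      PowerSeries.mk fun k => (MvPolynomial.X (i, k) : Heis ι) := by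
    ext1 n
    simp [linForm]
  rw [h2, map_sum, ← Finset.sum_add_distrib, createField]
  refine Finset.sum_congr rfl fun i _ => ?_
  rw [createAt, mul_add, map_mul, HahnSeries.ofPowerSeries_C, zeroMode, constHom_apply, zmon_mul,
    HahnSeries.C_apply, creation, gramCoeff]
  simp

/-- Here `z^s` accounts for the zero mode of `α(z)` on `e^γ` and the exponential series for its
creation part. -/
theorem hasseDeriv_expCreation {G : Matrix ι ι ℚ} {α γ : ι → ℚ} {s : ℤ}
    (hs : pairing G α γ = s) :
    LaurentSeries.hasseDeriv (Heis ι) 1 (HahnSeries.single s 1 * expCreation α) =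
      createField G α γ 0 * (HahnSeries.single s 1 * expCreation α) := by
  have h1 : LaurentSeries.hasseDeriv (Heis ι) 1 (expCreation α) =
      HahnSeries.ofPowerSeries ℤ _ (PowerSeries.mk (linForm α)) * expCreation α := by
    rw [expCreation_eq, ← map_mul, ← (isExpInt_expSeries α).deriv]
    ext1; funext n
    rw [coeff_hasseDeriv, coeff_ofPowerSeries, coeff_ofPowerSeries, Nat.cast_one, Ring.choose_one_right]
    rcases lt_trichotomy n (-1) with hn | hn | hn
    · rw [if_pos (by omega), if_pos (by omega), mul_zero]
    · subst hn; simp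
    · lift n to ℕ using (by omega)
      rw [if_neg (by omega), if_neg (by omega), PowerSeries.coeff_derivative,
        ← Nat.cast_succ, Int.natAbs_natCast, Int.natAbs_natCast, mul_comm]
      simp
  rw [hasseDeriv_one_mul, h1, LaurentSeries.hasseDeriv_single, createField_zero_eq hs]
  have h2 : (zmon (-1) s : Ser ι) * HahnSeries.single s 1 = 
      HahnSeries.single (s - (1 : ℕ)) (Ring.choose s 1 • (1 : Heis ι)) := by
    rw [HahnSeries.single_mul_single]
    congr 1
    · simp; ring_nf
    · simp
  rw [← h2]
  ring

/-- As series in `w`, both sides solve `F' = a(z+w) F`, where `a` is the creation part plus zero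
mode of `α`, and both start from `z^s` times the creation series. -/
theorem aeval_createAt_expSeries {G : Matrix ι ι ℚ} {α γ : ι → ℚ} {s : ℤ}
    (hs : pairing G α γ = s) :
    PowerSeries.C (HahnSeries.single s 1 * expCreation α) *
      (PowerSeries.mk fun n => MvPolynomial.aeval (createAt G γ)
        (toSer (PowerSeries.coeff n (expSeries α)))) =
      taylor (HahnSeries.single s 1 * expCreation α) := by
  have h : (PowerSeries.mk fun n => MvPolynomial.aeval (createAt G γ)
      (toSer (PowerSeries.coeff n (expSeries α)))) =
      PowerSeries.map (MvPolynomial.aeval (createAt G γ)).toRingHom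
        (PowerSeries.map toSer (expSeries α)) := by
    ext1 n; simp
  have h1 := (isExpInt_toSer α).map (MvPolynomial.aeval (createAt G γ)).toRingHom
  rw [← h] at h1
  have h2 : PowerSeries.map (MvPolynomial.aeval (createAt G γ)).toRingHom
      (PowerSeries.mk fun n => toSer (linForm α n)) = taylor (createField G α γ 0) := by
    ext1 n
    rw [coeff_taylor, hasseDeriv_createField, PowerSeries.coeff_map, PowerSeries.coeff_mk,
      toSer_linForm, createField, map_sum]
    refine Finset.sum_congr rfl fun i _ => ?_
    simp
  rw [h2] at h1
  refine powerSeries_ode_unique (l := taylor (createField G α γ 0)) ?_ ?_ ?_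
  · rw [Derivation.leibniz, h1.deriv, PowerSeries.derivative_C, smul_zero, add_zero, smul_eq_mul]
    ring
  · rw [derivative_taylor, hasseDeriv_expCreation hs, map_mul]
  · rw [map_mul, h1.constantCoeff, PowerSeries.constantCoeff_C, mul_one,
      ← PowerSeries.coeff_zero_eq_constantCoeff_apply, coeff_taylor]
    simp

/-- The exponential now sits in the first argument; `wick_symm` moves it to the second, and symmetry
of `G` keeps the contractions in the right form. The factor obtained is `z^(s-i)` times the creation
part of `e^α`, taken at `z + w`. -/
theorem vertexSeries_exp_left {G : Matrix ι ι ℚ} (hG : G.transpose = G) {α β γ : ι → ℚ} {s t : ℤ}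
    (hs : pairing G α γ = s) (ht : pairing G β γ = t) (p q : Heis ι) :
    (PowerSeries.mk fun n => vertexSeries G (α + β) γ (p * PowerSeries.coeff n (expSeries α)) q) =
      (annihPoly G α q).sum fun i qi => 
        taylor (HahnSeries.single (s - i : ℤ) 1 * expCreation α) *
          PowerSeries.C (vertexSeries G β γ p qi) := by
  have hz : zpowRat (ι := ι) (pairing G (α + β) γ) = zmon s 1 * zmon t 1 := by
    rw [pairing_add_left, hs, ht, ← Int.cast_add, zpowRat_intCast, zmon_mul, mul_one]
  have h0 : (PowerSeries.mk fun n =>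
      vertexSeries G (α + β) γ (p * PowerSeries.coeff n (expSeries α)) q) =
      PowerSeries.C (expCreation (α + β) * (zmon s 1 * zmon t 1)) * PowerSeries.mk fun n =>
        wick (annihAt G (α + β)) (createAt G γ) (fun a b => contractAt G b a) (toSer q)
          (toSer p * toSer (PowerSeries.coeff n (expSeries α))) := by
    ext1 n
    rw [PowerSeries.coeff_mk, PowerSeries.coeff_C_mul, PowerSeries.coeff_mk, vertexSeries_eq, hz,
      map_mul, wick_symm]
  have h1 : (fun x => PowerSeries.C (annihAt G (α + β) x) + contractExp' G α x) =
      fun x => PowerSeries.C (annihAt G β x) + -((PowerSeries.C.comp (constHom ι)) (gramCoeff G α x) *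
        taylor (HahnSeries.single (-1 : ℤ) 1) ^ (x.2 + 1)) := by
    funext x
    have h2 : annihAt G (α + β) x = annihAt G β x - zmon (-(x.2 : ℤ) - 1) (gramCoeff G α x) := by
      rw [annihAt, annihAt, Matrix.mulVec_add, Pi.add_apply, gramCoeff, sub_sub, 
        show -(x.2 : ℤ) - 1 = -((x.2 : ℤ) + 1) by ring, ← HahnSeries.single_add, ← map_add]
      congr 3
      push_cast
      ring
    have h3 : (HahnSeries.single (-1 : ℤ) (1 : Heis ι)) ^ (x.2 + 1) = zmon (-(x.2 : ℤ) - 1) 1 := by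
      rw [HahnSeries.single_pow, one_pow, zmon, map_one MvPolynomial.C]
      congr 1
      simp; ring_nf
    rw [contractExp', h2, ← map_pow, h3, map_sub, RingHom.comp_apply]
    ring
  have hm : ∀ f, MvPolynomial.map PowerSeries.C (toSer f) =
      MvPolynomial.map (PowerSeries.C.comp (constHom ι)) f := fun f => MvPolynomial.map_map _ _ _
  rw [h0, wick_mul_exp _ _ _ (contractExp' G α) _ (contract_toSer_expSeries' hG α), h1,
    hm, hm, wick_shift_map, Polynomial.sum,
    Polynomial.sum, Finset.mul_sum, Finset.mul_sum]
  refine Finset.sum_congr rfl fun i _ => ?_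
  rw [← map_wick_toSer (PowerSeries.C), vertexSeries_eq, ht, zpowRat_intCast,
    wick_symm _ _ _ (toSer p)]
  have h4 : taylor (HahnSeries.single (s - i : ℤ) 1 * expCreation α) =
      taylor (HahnSeries.single s 1 * expCreation α) * taylor (HahnSeries.single (-1 : ℤ) 1) ^ i := by
    rw [← map_pow, ← map_mul, mul_right_comm, HahnSeries.single_pow, HahnSeries.single_mul_single]
    congr 3
    · simp; ring_nf
    · simp
  rw [h4, ← aeval_createAt_expSeries hs, expCreation_add, show zmon (ι := ι) s 1 = HahnSeries.single s 1 by
    rw [zmon, map_one MvPolynomial.C]]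
  simp only [map_mul]
  ring

end Exponential

/-! ### Residues: the zero mode of `e^α` is a derivation -/

section Exponential

variable {ι : Type} [Fintype ι] [DecidableEq ι]

/-- The residue in `w` is linear over `M(1)`, so it passes through multiplication by a series in `z`
alone. -/
theorem expResidue_coeff_mul (α : ι → ℚ) (u : ℤ) (D : LaurentSeries (Polynomial (Heis ι)))
    (f : Ser ι) (n : ℤ) :
    expResidue α u ((D * laurentMap Polynomial.C f).coeff n) =
      (D.map (expResidue α u) * f).coeff n := by
  have h1 : (laurentMap (Polynomial.C : Heis ι →+* _) f).support ⊆ f.support := by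
    intro m hm h0
    exact hm (by rw [coeff_laurentMap, h0, map_zero])
  have h2 : (D.map (expResidue α u)).support ⊆ D.support := by
    intro m hm h0
    exact hm (by rw [HahnSeries.map_coeff, h0, map_zero])
  rw [HahnSeries.coeff_mul_right' f.isPWO_support h1, HahnSeries.coeff_mul_left' D.isPWO_support h2,
    map_sum]
  refine Finset.sum_congr rfl fun ij _ => ?_
  rw [coeff_laurentMap, HahnSeries.map_coeff, mul_comm, ← Polynomial.smul_eq_C_mul, map_smul,
    smul_eq_mul, mul_comm]

/-- The `k`-th coefficient in `w` of the expansion at `z` of `w ^ b` times the creation part of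
`e^α(w)`. -/
def taylorMode (α : ι → ℚ) (k b : ℤ) : Ser ι :=
  if 0 ≤ k then LaurentSeries.hasseDeriv (Heis ι) k.toNat (HahnSeries.single b 1 * expCreation α)
  else 0

/-- The `k`-th coefficient in `w` of `(z - w) ^ a` times the creation part of `e^α(w)`. -/
def originMode (α : ι → ℚ) (k a : ℤ) : Ser ι :=
  if 0 ≤ k then PowerSeries.coeff k.toNat (PowerSeries.C (zmon a 1) * binom (zmon (-1) 1) a *
    PowerSeries.map HahnSeries.C (expSeries α))
  else 0

theorem vertexSeries_mul_expMode_left {G : Matrix ι ι ℚ} (hG : G.transpose = G)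
    {α β γ : ι → ℚ} {s t : ℤ} (hs : pairing G α γ = s) (ht : pairing G β γ = t) (p q : Heis ι)
    (k : ℤ) :
    vertexSeries G (α + β) γ (p * expMode α k) q =
      (annihPoly G α q).sum fun i qi => taylorMode α k (s - i) * vertexSeries G β γ p qi := by
  rcases lt_or_ge k 0 with hk | hk
  · rw [expMode_of_neg α hk, mul_zero, Polynomial.sum]
    simp [taylorMode, not_le.2 hk, vertexSeries_eq]
  · lift k to ℕ using hk
    have h := congrArg (PowerSeries.coeff k) (vertexSeries_exp_left hG hs ht p q)
    rw [PowerSeries.coeff_mk, ← expMode_natCast, Polynomial.sum, map_sum] at h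
    rw [h, Polynomial.sum]
    refine Finset.sum_congr rfl fun i _ => ?_
    rw [PowerSeries.coeff_mul_C, coeff_taylor, taylorMode, if_pos (by omega), Int.toNat_natCast]

theorem vertexSeries_mul_expMode_right {G : Matrix ι ι ℚ} {α β γ : ι → ℚ} {r t : ℤ}
    (hr : pairing G α β = r) (hr' : pairing G β α = r) (ht : pairing G β γ = t) (p q : Heis ι)
    (k : ℤ) :
    vertexSeries G β (α + γ) p (q * expMode α k) =
      (annihPoly G α p).sum fun j pj =>
        (-1) ^ j * originMode α k (r - j) * vertexSeries G β γ pj q := by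
  rcases lt_or_ge k 0 with hk | hk
  · rw [expMode_of_neg α hk, mul_zero, Polynomial.sum]
    simp [originMode, not_le.2 hk, vertexSeries_eq]
  · lift k to ℕ using hk
    have h := congrArg (PowerSeries.coeff k) (vertexSeries_exp_right hr hr' ht p q)
    rw [PowerSeries.coeff_mk, ← expMode_natCast, Polynomial.sum, map_sum] at h
    rw [h, Polynomial.sum]
    refine Finset.sum_congr rfl fun j _ => ?_
    have e : PowerSeries.C (zmon (r - j) 1) * (-1) ^ j * binom (zmon (-1) 1) (r - j) *
        PowerSeries.map HahnSeries.C (expSeries α) = PowerSeries.C ((-1 : Ser ι) ^ j) *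
          (PowerSeries.C (zmon (r - j) 1) * binom (zmon (-1) 1) (r - j) *
            PowerSeries.map HahnSeries.C (expSeries α)) := by
      rw [map_pow, map_neg, map_one]
      ring
    rw [e, PowerSeries.coeff_mul_C, PowerSeries.coeff_C_mul, originMode, if_pos (by omega),
      Int.toNat_natCast]

theorem coeff_taylorMode (α : ι → ℚ) (k b N : ℤ) :
    (taylorMode α k b).coeff N =
      if 0 ≤ k then (Ring.choose (N + k) k.toNat : ℤ) * expMode α (N + k - b) else 0 := by
  rw [taylorMode]
  split_ifs with hk
  · rw [coeff_hasseDeriv, Int.toNat_of_nonneg hk, expMode]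
    have := HahnSeries.coeff_single_mul_add (r := (1 : Heis ι)) (x := expCreation α)
      (a := N + k - b) (b := b)
    rw [sub_add_cancel, one_mul] at this
    rw [this]
  · rfl

theorem coeff_originMode (α : ι → ℚ) (a N : ℤ) {k : ℤ} (hk : 0 ≤ k) :
    (originMode α k a).coeff N = if 0 ≤ a - N then
      (((-1) ^ (a - N).toNat * Ring.choose a (a - N).toNat : ℤ) : Heis ι) *
        expMode α (k - (a - N)) else 0 := by
  lift k to ℕ using hk
  have hterm : ∀ l m, PowerSeries.coeff l (PowerSeries.C (zmon a 1) * binom (zmon (-1) 1) a) *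
      PowerSeries.coeff m (PowerSeries.map (HahnSeries.C : Heis ι →+* Ser ι) (expSeries α)) =
      HahnSeries.single (a - l) ((((-1) ^ l * Ring.choose a l : ℤ) : Heis ι) * expMode α m) := by
    intro l m
    have e1 : ((Ring.choose a l : ℤ) : Ser ι) = HahnSeries.single 0 ((Ring.choose a l : ℤ) : Heis ι) :=
      (map_intCast (HahnSeries.C : Heis ι →+* Ser ι) _).symm
    have e2 : (-zmon (-1) 1 : Ser ι) ^ l = HahnSeries.single (-l : ℤ) ((-1) ^ l) := by
      rw [← HahnSeries.single_neg, HahnSeries.single_pow, map_one MvPolynomial.C]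
      simp
    have e3 : (zmon a 1 : Ser ι) = HahnSeries.single a 1 := by rw [zmon, map_one MvPolynomial.C]
    rw [PowerSeries.coeff_C_mul, coeff_binom, PowerSeries.coeff_map, HahnSeries.C_apply,
      ← expMode_natCast, e1, e2, e3, HahnSeries.single_mul_single,
      HahnSeries.single_mul_single, HahnSeries.single_mul_single]
    congr 1
    · ring_nf
    · push_cast; ring
  rw [originMode, if_pos (by omega), Int.toNat_natCast, PowerSeries.coeff_mul,
    HahnSeries.coeff_sum]
  simp only [hterm, HahnSeries.coeff_single]
  rw [Finset.Nat.sum_antidiagonal_eq_sum_range_succ_mk]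
  split_ifs with h
  · obtain ⟨l, hl⟩ := Int.eq_ofNat_of_zero_le h
    rw [hl, Int.toNat_natCast]
    have : ∀ i : ℕ, (N = a - i) = (i = l) := fun i => propext (by omega)
    simp only [this]
    rw [Finset.sum_ite_eq']
    split_ifs with h'
    · rw [Finset.mem_range] at h'
      rw [Nat.cast_sub (by omega)]
    · rw [Finset.mem_range] at h'
      rw [expMode_of_neg α (by omega), mul_zero]
  · refine Finset.sum_eq_zero fun i _ => if_neg (by omega)

/-- The residue theorem for `w^(s-i) (w-z)^(r-j)` times the creation part of `e^α(w)`. Each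
coefficient in `z` is one instance of `choose_residue` times the same mode of that creation part;
the two terms on the right belong to the poles `z` and `0`. -/
theorem map_expResidue_eq (α : ι → ℚ) {r s : ℤ} (hr : Even r) (i j : ℕ) :
    (HahnSeries.ofPowerSeries ℤ _ (PowerSeries.C (Polynomial.X ^ (i + j)) *
      binom Polynomial.X (r - j))).map (expResidue α (r + s)) =
      taylorMode α (j - r - 1) (s - i) + (-1) ^ j * originMode α (i - s - 1) (r - j) := by
  ext1; funext N
  have h1 : ((-1 : Ser ι) ^ j * originMode α (i - s - 1) (r - j)).coeff N =
      (-1) ^ j * (originMode α (i - s - 1) (r - j)).coeff N := by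
    rw [show (-1 : Ser ι) ^ j = HahnSeries.C ((-1) ^ j) by rw [map_pow, map_neg, map_one], HahnSeries.C_mul_eq_smul, 
      HahnSeries.coeff_smul, smul_eq_mul]
  have h2 : expResidue α (r + s) ((HahnSeries.ofPowerSeries ℤ _
      (PowerSeries.C (Polynomial.X ^ (i + j)) * binom Polynomial.X (r - j))).coeff N) =
      (if 0 ≤ N then (((-1) ^ N.natAbs * Ring.choose (r - j) N.toNat : ℤ) : Heis ι) else 0) *
        expMode α (N - (r - j) - (s - i) - 1) := by
    rcases lt_or_ge N 0 with hN | hN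
    · rw [coeff_ofPowerSeries, if_pos hN, if_neg (not_le.2 hN), map_zero, zero_mul]
    · lift N to ℕ using hN
      rw [coeff_ofPowerSeries_natCast, PowerSeries.coeff_C_mul, coeff_binom, if_pos (by omega),
        show (Polynomial.X : Polynomial (Heis ι)) ^ (i + j) *
          ((-Polynomial.X) ^ N * ((Ring.choose (r - j) N : ℤ) : Polynomial (Heis ι))) =
          Polynomial.C (((-1) ^ N * Ring.choose (r - j) N : ℤ) : Heis ι) *
            Polynomial.X ^ (i + j + N) by
          rw [neg_pow, pow_add, pow_add]; push_cast; simp; ring_nf, expResidue_C_mul_X_pow]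
      congr 2
      push_cast
      ring
  rw [HahnSeries.map_coeff, HahnSeries.coeff_add, h1, h2, coeff_taylorMode]
  have key := choose_residue (r - j) N
  have key2 := congrArg (Int.cast (R := Heis ι)) key
  rw [Int.cast_add] at key2
  have h3 : (if 0 ≤ N then (((-1) ^ N.natAbs * Ring.choose (r - j) N.toNat : ℤ) : Heis ι) else 0) =
      ((if 0 ≤ N then (-1) ^ N.natAbs * Ring.choose (r - j) N.toNat else 0 : ℤ) : Heis ι) := by
    split_ifs <;> simp
  rw [h3, key2, add_mul, add_comm]
  congr 1
  · rw [show -(r - (j : ℤ)) - 1 = j - r - 1 by ring, show N - (r - (j : ℤ)) - 1 = N + (j - r - 1) by ring,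
      show N - (r - (j : ℤ)) - (s - i) - 1 = N + (j - r - 1) - (s - i) by ring]
    split_ifs <;> simp
  -- If `i - s - 1 < 0` there is no pole at the origin, and the mode of the creation series has
  -- negative index.
  · rcases lt_or_ge ((i : ℤ) - s - 1) 0 with hk | hk
    · rw [originMode, if_neg (not_le.2 hk), HahnSeries.coeff_zero, mul_zero]
      split_ifs with h
      · rw [expMode_of_neg α (by omega), mul_zero]
      · rw [Int.cast_zero, zero_mul]
    · rw [coeff_originMode α _ _ hk]
      split_ifs with h
      · rw [show (i : ℤ) - s - 1 - (r - j - N) = N - (r - j) - (s - i) - 1 by ring, ← mul_assoc]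
        congr 1
        -- Evenness of `r` is needed here: it turns `(w-z)^(r-j)` into `(-1)^j (z-w)^(r-j)` without
        -- a further sign.
        have : (-1 : ℤ) ^ N.natAbs = (-1) ^ j * (-1) ^ (r - j - N).toNat := by
          rw [← pow_add]
          refine neg_one_pow_congr ?_
          rw [Int.natAbs_even, ← Int.even_coe_nat]
          push_cast
          rw [Int.toNat_of_nonneg h, show (j : ℤ) + (r - j - N) = r - N by ring]
          rw [Int.even_sub]
          simp [hr]
        rw [this]
        push_cast
        ring
      · simp

theorem vertexSeries_sum_left (G : Matrix ι ι ℚ) (β γ : ι → ℚ) {κ : Type*} (S : Finset κ)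
    (f : κ → Heis ι) (q : Heis ι) :
    vertexSeries G β γ (∑ i ∈ S, f i) q = ∑ i ∈ S, vertexSeries G β γ (f i) q :=
  map_sum (AddMonoidHom.mk' (fun p => vertexSeries G β γ p q)
    fun a b => vertexSeries_add_left G β γ a b q) _ _

theorem vertexSeries_sum_right (G : Matrix ι ι ℚ) (β γ : ι → ℚ) {κ : Type*} (S : Finset κ)
    (f : κ → Heis ι) (p : Heis ι) :
    vertexSeries G β γ p (∑ i ∈ S, f i) = ∑ i ∈ S, vertexSeries G β γ p (f i) :=
  map_sum (AddMonoidHom.mk' (fun q => vertexSeries G β γ p q)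
    fun a b => vertexSeries_add_right G β γ p a b) _ _

/-- The zero mode of `e^α` is a derivation of all vertex operators. -/
theorem expZero_coeff_vertexSeries {G : Matrix ι ι ℚ} (hG : G.transpose = G)
    {α β γ : ι → ℚ} {r s t : ℤ} (hr : pairing G α β = r) (hs : pairing G α γ = s)
    (ht : pairing G β γ = t) (he : Even r) (p q : Heis ι) (n : ℤ) :
    expZero G α (r + s) ((vertexSeries G β γ p q).coeff n) =
      (vertexSeries G (α + β) γ (expZero G α r p) q).coeff n +
        (vertexSeries G β (α + γ) p (expZero G α s q)).coeff n := by
  have hr' : pairing G β α = r := by rw [pairing_comm hG, hr]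
  rw [expZero, ← coeff_laurentMap, laurentMap_annihPoly_vertexSeries hr', ← HahnSeries.coeff_add,
    expZero, expZero, expResidue_apply α r, expResidue_apply α s, Polynomial.sum, Polynomial.sum,
    Polynomial.sum, vertexSeries_sum_left, vertexSeries_sum_right, HahnSeries.coeff_add,
    HahnSeries.coeff_sum, HahnSeries.coeff_sum, HahnSeries.coeff_sum, map_sum]
  -- All three terms are now double sums over the degrees `j` of `p` and `i` of `q` under
  -- `annihPoly`, with the common factor `vertexSeries G β γ pj qi`. They are compared term by term.
  simp only [vertexSeries_mul_expMode_left hG hs ht, vertexSeries_mul_expMode_right hr hr' ht,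
    Polynomial.sum, HahnSeries.coeff_sum, map_sum, expResidue_coeff_mul, map_expResidue_eq α he]
  rw [Finset.sum_comm (s := (annihPoly G α q).support), ← Finset.sum_add_distrib]
  refine Finset.sum_congr rfl fun j _ => ?_
  rw [← Finset.sum_add_distrib]
  refine Finset.sum_congr rfl fun i _ => ?_
  rw [add_mul, HahnSeries.coeff_add]

end Exponential

/-! ### Exponentials of locally nilpotent operators -/

section LocallyNilpotent

variable {M : Type*} [AddCommMonoid M] [Module ℂ M]

/-- `D ^ k / k!`. -/
def dividedPow (D : Module.End ℂ M) (k : ℕ) : Module.End ℂ M := ((k.factorial : ℂ)⁻¹) • D ^ k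

theorem dividedPow_eq_zero {D : Module.End ℂ M} {u : M} {n k : ℕ} (h : (D ^ n) u = 0)
    (hk : n ≤ k) : dividedPow D k u = 0 := by
  obtain ⟨m, rfl⟩ := Nat.exists_eq_add_of_le' hk
  rw [dividedPow, LinearMap.smul_apply, pow_add, Module.End.mul_apply, h, map_zero, smul_zero]

/-- The exponential of a locally nilpotent operator. -/
def locExp (D : Module.End ℂ M) (u : M) : M := ∑ᶠ k, dividedPow D k u

theorem support_dividedPow {D : Module.End ℂ M} {u : M} {n : ℕ} (h : (D ^ n) u = 0) :
    (Function.support fun k => dividedPow D k u) ⊆ (Finset.range n : Set ℕ) := by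
  intro k hk
  by_contra hc
  exact hk (dividedPow_eq_zero h (by simpa using hc))

theorem locExp_eq_sum {D : Module.End ℂ M} {u : M} {n : ℕ} (h : (D ^ n) u = 0) :
    locExp D u = ∑ k ∈ Finset.range n, dividedPow D k u :=
  finsum_eq_sum_of_support_subset _ (support_dividedPow h)

/-- `locExp` as a linear map. -/
def locExpLin (D : Module.End ℂ M) (hD : ∀ u, ∃ n, (D ^ n) u = 0) : M →ₗ[ℂ] M where
  toFun := locExp D
  map_add' u v := by
    obtain ⟨m, hm⟩ := hD u
    obtain ⟨n, hn⟩ := hD v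
    simp only [locExp, map_add]
    exact finsum_add_distrib ((Finset.finite_toSet _).subset (support_dividedPow hm))
      ((Finset.finite_toSet _).subset (support_dividedPow hn))
  map_smul' c u := by
    obtain ⟨m, hm⟩ := hD u
    simp only [locExp, map_smul, RingHom.id_apply]
    rw [smul_finsum' _ ((Finset.finite_toSet _).subset (support_dividedPow hm))]

/-- On the tensor square `D` becomes `D ⊗ 1 + 1 ⊗ D`, a sum of commuting operators, and the binomial
theorem applies. -/
theorem pow_bilin {D : Module.End ℂ M} {B : M →ₗ[ℂ] M →ₗ[ℂ] M}
    (h : ∀ u v, D (B u v) = B (D u) v + B u (D v)) (n : ℕ) (u v : M) :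
    (D ^ n) (B u v) = ∑ ij ∈ Finset.HasAntidiagonal.antidiagonal n,
      (n.choose ij.1) • B ((D ^ ij.1) u) ((D ^ ij.2) v) := by
  have h1 : D ∘ₗ TensorProduct.lift B =
      TensorProduct.lift B ∘ₗ (D.rTensor M + D.lTensor M) := by
    ext u v
    simp [h]
  have h2 : ∀ n : ℕ, (D ^ n) ∘ₗ TensorProduct.lift B =
      TensorProduct.lift B ∘ₗ ((D.rTensor M + D.lTensor M) ^ n) := by
    intro n
    induction n with
    | zero => rfl
    | succ n ih =>
      rw [pow_succ', Module.End.mul_eq_comp, LinearMap.comp_assoc, ih, ← LinearMap.comp_assoc, h1,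
        pow_succ', Module.End.mul_eq_comp, LinearMap.comp_assoc]
  have hc : Commute (D.rTensor M) (D.lTensor M) := by
    refine LinearMap.ext fun x => ?_
    induction x using TensorProduct.induction_on with
    | zero => simp
    | add x y hx hy => rw [map_add, map_add, hx, hy]
    | tmul x y => simp
  have h3 := LinearMap.congr_fun (h2 n) (u ⊗ₜ v)
  rw [hc.add_pow'] at h3
  simpa [LinearMap.rTensor_pow, LinearMap.lTensor_pow] using h3

theorem dividedPow_bilin {D : Module.End ℂ M} {B : M →ₗ[ℂ] M →ₗ[ℂ] M}
    (h : ∀ u v, D (B u v) = B (D u) v + B u (D v)) (n : ℕ) (u v : M) :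
    dividedPow D n (B u v) = ∑ ij ∈ Finset.HasAntidiagonal.antidiagonal n,
      B (dividedPow D ij.1 u) (dividedPow D ij.2 v) := by
  rw [dividedPow, LinearMap.smul_apply, pow_bilin h, Finset.smul_sum]
  refine Finset.sum_congr rfl fun ij hij => ?_
  have hn : ij.1 + ij.2 = n := Finset.HasAntidiagonal.mem_antidiagonal.1 hij
  subst hn
  simp only [dividedPow, LinearMap.smul_apply, map_smul, smul_smul]
  rw [← Nat.cast_smul_eq_nsmul ℂ, smul_smul]
  congr 1
  have := Nat.add_choose_mul_factorial_mul_factorial ij.1 ij.2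
  have h1 : ((ij.1.factorial : ℂ)) ≠ 0 := Nat.cast_ne_zero.2 (Nat.factorial_ne_zero _)
  have h2 : ((ij.2.factorial : ℂ)) ≠ 0 := Nat.cast_ne_zero.2 (Nat.factorial_ne_zero _)
  have h3 : (((ij.1 + ij.2).factorial : ℂ)) ≠ 0 := Nat.cast_ne_zero.2 (Nat.factorial_ne_zero _)
  field_simp
  rw [mul_comm]
  exact_mod_cast (by rw [← this, Nat.choose_symm_add]; ring)

theorem pow_bilin_eq_zero {D : Module.End ℂ M} {B : M →ₗ[ℂ] M →ₗ[ℂ] M}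
    (h : ∀ u v, D (B u v) = B (D u) v + B u (D v)) {m n : ℕ} {u v : M} (hm : (D ^ m) u = 0)
    (hn : (D ^ n) v = 0) : (D ^ (m + n)) (B u v) = 0 := by
  have hz : ∀ {k l : ℕ} {w : M}, (D ^ k) w = 0 → k ≤ l → (D ^ l) w = 0 := by
    intro k l w hw hkl
    obtain ⟨j, rfl⟩ := Nat.exists_eq_add_of_le' hkl
    rw [pow_add, Module.End.mul_apply, hw, map_zero]
  rw [pow_bilin h]
  refine Finset.sum_eq_zero fun ij hij => ?_
  have := Finset.HasAntidiagonal.mem_antidiagonal.1 hij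
  rcases le_or_gt m ij.1 with h' | h'
  · rw [hz hm h', map_zero, LinearMap.zero_apply, smul_zero]
  · rw [hz hn (by omega : n ≤ ij.2), map_zero, smul_zero]

theorem locExp_bilin {D : Module.End ℂ M} {B : M →ₗ[ℂ] M →ₗ[ℂ] M}
    (h : ∀ u v, D (B u v) = B (D u) v + B u (D v)) {m n : ℕ} {u v : M} (hm : (D ^ m) u = 0)
    (hn : (D ^ n) v = 0) : locExp D (B u v) = B (locExp D u) (locExp D v) := by
  rw [locExp_eq_sum (pow_bilin_eq_zero h hm hn), locExp_eq_sum hm, locExp_eq_sum hn]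
  simp only [map_sum, LinearMap.sum_apply, dividedPow_bilin h]
  -- The product of the two exponentials is a sum over a rectangle, regrouped by total degree. Pairs
  -- on an antidiagonal outside the rectangle contribute zero by nilpotency.
  rw [Finset.sum_comm (s := Finset.range n), ← Finset.sum_product', ← Finset.sum_fiberwise_of_maps_to (t := Finset.range (m + n))
    (g := fun ij : ℕ × ℕ => ij.1 + ij.2)]
  · refine Finset.sum_congr rfl fun k _ => (Finset.sum_subset ?_ ?_).symm
    · intro ij hij
      exact Finset.HasAntidiagonal.mem_antidiagonal.2 (Finset.mem_filter.1 hij).2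
    · intro ij hij hij'
      have := Finset.HasAntidiagonal.mem_antidiagonal.1 hij
      rw [Finset.mem_filter, Finset.mem_product, Finset.mem_range, Finset.mem_range] at hij'
      by_cases h1 : ij.1 < m
      · rw [dividedPow_eq_zero hn (k := ij.2) (by by_contra hc; exact hij' ⟨⟨h1, by omega⟩, this⟩),
          map_zero]
      · rw [dividedPow_eq_zero hm (by omega), map_zero, LinearMap.zero_apply]
  · intro ij hij
    rw [Finset.mem_product, Finset.mem_range, Finset.mem_range] at hij
    exact Finset.mem_range.2 (by omega)

end LocallyNilpotent

/-! ### Generation by modes -/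

section Generation

variable {ι : Type} [Fintype ι] [DecidableEq ι]

theorem mem_intLattice {β : ι → ℚ} : β ∈ intLattice ι ↔ ∃ k : ι → ℤ, β = fun i => (k i : ℚ) := by
  constructor
  · intro h
    induction h using AddSubgroup.closure_induction with
    | mem x hx =>
      obtain ⟨i, rfl⟩ := hx
      exact ⟨Pi.single i 1, by funext j; by_cases h : j = i <;> simp [h]⟩
    | zero => exact ⟨0, by funext i; simp⟩
    | add x y _ _ hx hy =>
      obtain ⟨k, rfl⟩ := hx
      obtain ⟨l, rfl⟩ := hy
      exact ⟨k + l, by funext i; simp⟩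
    | neg x _ hx =>
      obtain ⟨k, rfl⟩ := hx
      exact ⟨-k, by funext i; simp⟩
  · rintro ⟨k, rfl⟩
    have : (fun i => (k i : ℚ)) = ∑ i, k i • (Pi.single i (1 : ℚ)) := by
      funext j
      simp [Finset.sum_apply, Pi.single_apply]
    rw [this]
    exact sum_mem fun i _ => zsmul_mem (AddSubgroup.subset_closure (Set.mem_range_self i)) _

theorem aeval_annihAt_zero (G : Matrix ι ι ℚ) (q : Heis ι) :
    MvPolynomial.aeval (annihAt G 0) (toSer q) = HahnSeries.C q := by
  have : ((MvPolynomial.aeval (annihAt G 0)).toRingHom).comp toSer =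
      (HahnSeries.C : Heis ι →+* Ser ι) := by
    refine MvPolynomial.ringHom_ext (fun c => ?_) fun x => ?_
    · simp [toSer, constHom_apply]
    · simp [toSer, annihAt, HahnSeries.C_apply]
  exact congrArg (fun f => f q) this

/-- A contraction carries `z^(-n-1-m)` with `n ≥ 1`, a negative power, so it is invisible to the
modes of negative index. -/
theorem coeff_contract_of_nonneg (G : Matrix ι ι ℚ) (x : ι × ℕ) (q : Heis ι) (m : ℕ) :
    (MvPolynomial.aeval (annihAt G 0) (contract (contractAt G) x (toSer q))).coeff m = 0 := by
  induction q using MvPolynomial.induction_on generalizing m with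
  | C c => simp [toSer]
  | add p q hp hq => rw [map_add, map_add, map_add, HahnSeries.coeff_add, hp, hq, add_zero]
  | mul_X p y hp =>
    have h1 : toSer (MvPolynomial.X y) = (MvPolynomial.X y : MvPolynomial _ (Ser ι)) := by
      simp [toSer]
    rw [map_mul, h1, Derivation.leibniz, contract_X, map_add, smul_eq_mul, smul_eq_mul, map_mul,
      map_mul, aeval_annihAt_zero, MvPolynomial.aeval_C, ← h1, aeval_annihAt_zero,
      HahnSeries.coeff_add, HahnSeries.C_mul_eq_smul, HahnSeries.C_mul_eq_smul,
      HahnSeries.coeff_smul, HahnSeries.coeff_smul, hp, smul_zero, add_zero, contractAt]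
    simp only [Algebra.algebraMap_self, RingHom.id_apply]
    rw [HahnSeries.coeff_single_of_ne (by omega), smul_zero]

/-- In nonnegative powers of `z` only the creation part of `α_i(z)` survives. Hence these modes
build up all of `M(1)` from `1`, which is used in `vec_mem_of_closed`. -/
theorem mode_cartanVec (G : Matrix ι ι ℚ) (i : ι) (m : ℕ) (γ : ι → ℚ) (q : Heis ι) :
    mode G (-(m : ℤ) - 1) (cartanVec i) (vec γ q) = vec γ (MvPolynomial.X (i, m) * q) := by
  have h0 : pairing G 0 γ = ((0 : ℤ) : ℚ) := by simp [pairing]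
  have h1 : toSer (MvPolynomial.X (i, 0)) = (MvPolynomial.X (i, 0) * 1 : MvPolynomial _ (Ser ι)) := by
    simp [toSer]
  rw [cartanVec, mode_vec, zero_add, vertexSeries_eq, h0, zpowRat_intCast, expCreation_eq,
    expSeries_zero, map_one, h1, wick_X_mul, wick_one, wickStep_apply, map_add, map_smul,
    aeval_annihAt_zero, one_mul]
  congr 1
  rw [show zmon (ι := ι) 0 1 = 1 by simp [zmon], one_mul, show -(-(m : ℤ) - 1) - 1 = m by ring,
    HahnSeries.coeff_add, coeff_contract_of_nonneg, add_zero, smul_eq_mul, mul_comm,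
    HahnSeries.C_mul_eq_smul, HahnSeries.coeff_smul, createAt, HahnSeries.coeff_add, creation,
    coeff_ofPowerSeries_natCast, PowerSeries.coeff_mk, zeroMode,
    HahnSeries.coeff_single_of_ne (by omega), add_zero, smul_eq_mul, mul_comm]
  simp

theorem mode_exp_exp (G : Matrix ι ι ℚ) {β γ : ι → ℚ} {s : ℤ} (hs : pairing G β γ = s) (n : ℤ) :
    mode G n (vec β 1) (vec γ 1) = vec (β + γ) (expMode β (-n - 1 - s)) := by
  rw [mode_vec, vertexSeries_eq, hs, zpowRat_intCast, map_one, wick_one, map_one, mul_one, expMode,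
    zmon, map_one MvPolynomial.C]
  congr 1
  have := HahnSeries.coeff_mul_single_add (x := expCreation β) (r := (1 : Heis ι))
    (a := -n - 1 - s) (b := s)
  rw [sub_add_cancel, mul_one] at this
  exact this

theorem expMode_zero (α : ι → ℚ) : expMode α 0 = 1 := by
  have := expMode_natCast α 0
  rw [Nat.cast_zero] at this
  rw [this, PowerSeries.coeff_zero_eq_constantCoeff_apply, (isExpInt_expSeries α).constantCoeff]

theorem expMode_one (α : ι → ℚ) : expMode α 1 = linForm α 0 := by
  have := expMode_natCast α 1
  rw [Nat.cast_one] at this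
  rw [this]
  have h := congrArg (PowerSeries.coeff 0) (isExpInt_expSeries α).deriv
  rw [PowerSeries.coeff_derivative, PowerSeries.coeff_mul] at h
  simpa [(isExpInt_expSeries α).constantCoeff] using h

theorem vec_mem_of_closed {G : Matrix ι ι ℚ} {W : Submodule ℂ (Fock ι)}
    (hW : ∀ n, ∀ u ∈ W, ∀ v ∈ W, mode G n u v ∈ W) (hc : ∀ i, cartanVec i ∈ W) {γ : ι → ℚ}
    (hγ : vec γ 1 ∈ W) (q : Heis ι) : vec γ q ∈ W := by
  induction q using MvPolynomial.induction_on with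
  | C c =>
    have := W.smul_mem c hγ
    rwa [smul_vec, MvPolynomial.smul_eq_C_mul, mul_one] at this
  | add p q hp hq => rw [vec_add]; exact W.add_mem hp hq
  | mul_X p x hp =>
    rw [mul_comm, ← mode_cartanVec G x.1 x.2]
    exact hW _ _ (hc _) _ hp

end Generation

/-! ### Twists by characters and the lift of `-1` -/

section Twist

variable {ι : Type} [Fintype ι] [DecidableEq ι]

/-- The map `p ⊗ e^β ↦ φ(β) p ⊗ e^β`. -/
def twist (φ : (ι → ℚ) → ℂ) : Fock ι →ₗ[ℂ] Fock ι where
  toFun u := u.coeff.sum fun β p => vec β (φ β • p)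
  map_add' u v := by
    rw [AddMonoidAlgebra.coeff_add, Finsupp.sum_add_index']
    · intro β; rw [smul_zero, vec_zero]
    · intro β p q; rw [smul_add, vec_add]
  map_smul' c u := by
    induction u using fock_induction with
    | h0 => simp
    | hadd u v hu hv =>
      rw [smul_add, AddMonoidAlgebra.coeff_add, Finsupp.sum_add_index', hu, hv,
        AddMonoidAlgebra.coeff_add, Finsupp.sum_add_index', smul_add]
      all_goals intros; simp only [smul_zero, smul_add, vec_zero, vec_add]
    | hvec β p =>
      rw [smul_vec, AddMonoidAlgebra.coeff_single, AddMonoidAlgebra.coeff_single,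
        Finsupp.sum_single_index, Finsupp.sum_single_index, RingHom.id_apply, smul_vec, smul_comm]
      all_goals simp only [smul_zero, vec_zero]

theorem twist_vec (φ : (ι → ℚ) → ℂ) (β : ι → ℚ) (p : Heis ι) :
    twist φ (vec β p) = vec β (φ β • p) := by
  change (AddMonoidAlgebra.coeff (vec β p)).sum (fun β p => vec β (φ β • p)) = _
  rw [AddMonoidAlgebra.coeff_single, Finsupp.sum_single_index]
  rw [smul_zero, vec_zero]

/-- Products add lattice degrees, so multiplicativity of `φ` suffices. -/
theorem mode_twist (G : Matrix ι ι ℚ) {φ : (ι → ℚ) → ℂ} (hφ : ∀ β γ, φ (β + γ) = φ β * φ γ) (n : ℤ)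
    (u v : Fock ι) : mode G n (twist φ u) (twist φ v) = twist φ (mode G n u v) := by
  induction u using fock_induction with
  | h0 => simp [mode_zero_left]
  | hadd u u' h h' => simp only [map_add, mode_add_left, h, h']
  | hvec β p =>
  induction v using fock_induction with
  | h0 => simp [mode_zero_right]
  | hadd u u' h h' => simp only [map_add, mode_add_right, h, h']
  | hvec γ q =>
    rw [twist_vec, twist_vec, mode_vec, mode_vec, twist_vec, vertexSeries_smul_left,
      vertexSeries_smul_right, HahnSeries.coeff_smul, HahnSeries.coeff_smul, smul_smul, hφ]

theorem map_mem_V {κ : Type} {X : Set (ι → ℚ)} {Y : Set (κ → ℚ)} (f : Fock ι →ₗ[ℂ] Fock κ)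
    (h : ∀ β ∈ X, ∀ p, f (vec β p) ∈ V Y) {u : Fock ι} (hu : u ∈ V X) : f u ∈ V Y := by
  induction hu using V_induction with
  | h0 => rw [map_zero]; exact zero_mem _
  | hadd u v _ _ h h' => rw [map_add]; exact add_mem h h'
  | hvec β hβ p => exact h β hβ p

theorem twist_mem_V (φ : (ι → ℚ) → ℂ) {X : Set (ι → ℚ)} {u : Fock ι} (hu : u ∈ V X) :
    twist φ u ∈ V X :=
  map_mem_V _ (fun β hβ p => by rw [twist_vec]; exact vec_mem_V hβ _) hu

theorem inducedMap_mem_V {κ : Type} [Fintype κ] [DecidableEq κ] (A : Matrix κ ι ℚ) {X : Set (ι → ℚ)}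
    {Y : Set (κ → ℚ)} (h : ∀ β ∈ X, A.mulVec β ∈ Y) {u : Fock ι} (hu : u ∈ V X) :
    inducedMap A u ∈ V Y :=
  map_mem_V (inducedMap A).toLinearMap
    (fun β hβ p => by
      rw [AlgHom.toLinearMap_apply, inducedMap_vec]; exact vec_mem_V (h β hβ) _) hu

theorem negLift_vec (β : ι → ℚ) (p : Heis ι) :
    negLift (vec β p) = vec (-β) (polyMap (-1) p) := by
  rw [negLift, inducedMap_vec, Matrix.neg_mulVec, Matrix.one_mulVec]

theorem polyMap_neg_one_X (x : ι × ℕ) :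
    polyMap (-1 : Matrix ι ι ℚ) (MvPolynomial.X x) = -MvPolynomial.X x := by
  rw [polyMap_X, Finset.sum_eq_single x.1]
  · simp
  · intro k _ hk
    simp [Matrix.one_apply_ne hk]
  · simp

theorem polyMap_neg_one_neg_one (p : Heis ι) :
    polyMap (-1 : Matrix ι ι ℚ) (polyMap (-1) p) = p := by
  have : (polyMap (-1 : Matrix ι ι ℚ)).comp (polyMap (-1)) = AlgHom.id ℂ (Heis ι) := by
    refine MvPolynomial.algHom_ext fun x => ?_
    simp [polyMap_neg_one_X]
  exact congrArg (fun f => f p) this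

theorem negLift_negLift (u : Fock ι) : negLift (negLift u) = u := by
  induction u using fock_induction with
  | h0 => simp
  | hadd u v h h' => rw [map_add, map_add, h, h']
  | hvec β p => rw [negLift_vec, negLift_vec, neg_neg, polyMap_neg_one_neg_one]

theorem mode_negLift (G : Matrix ι ι ℚ) (n : ℤ) (u v : Fock ι) :
    mode G n (negLift u) (negLift v) = negLift (mode G n u v) :=
  mode_inducedMap (by simp) n u v

theorem negLift_mem_V {X : Set (ι → ℚ)} (hX : ∀ β ∈ X, -β ∈ X) {u : Fock ι} (hu : u ∈ V X) :
    negLift u ∈ V X :=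
  inducedMap_mem_V _ (fun β hβ => by
    rw [Matrix.neg_mulVec, Matrix.one_mulVec]; exact hX β hβ) hu

end Twist

/-! ### Generators of `V_{ℤα}` and the zero mode of `e^α` -/

section RankOne

theorem mem_intLattice_one {β : Fin 1 → ℚ} :
    β ∈ intLattice (Fin 1) ↔ ∃ k : ℤ, β = fun _ => (k : ℚ) := by
  rw [mem_intLattice]
  constructor
  · rintro ⟨k, rfl⟩
    exact ⟨k 0, by funext i; rw [Subsingleton.elim i 0]⟩
  · rintro ⟨k, rfl⟩
    exact ⟨fun _ => k, rfl⟩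

theorem pairing_gramA1 (k l : ℤ) :
    pairing gramA1 (fun _ => (k : ℚ)) (fun _ => (l : ℚ)) = ((2 * k * l : ℤ) : ℚ) := by
  simp [pairing, gramA1, Matrix.mulVec, dotProduct]
  ring

theorem gramA1_transpose : gramA1.transpose = gramA1 := by
  ext i j; fin_cases i; fin_cases j; rfl

theorem expA1_mem (k : ℤ) : expA1 k ∈ V1 := vec_mem_V (mem_intLattice_one.2 ⟨k, rfl⟩) _

theorem vec_zero_mem {ι : Type} [Fintype ι] [DecidableEq ι] {Λ : AddSubgroup (ι → ℚ)} (p : Heis ι) :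
    vec 0 p ∈ V (Λ : Set (ι → ℚ)) :=
  vec_mem_V (zero_mem Λ) _

theorem mode_mem_lattice {ι : Type} [Fintype ι] [DecidableEq ι] {Λ : AddSubgroup (ι → ℚ)}
    (G : Matrix ι ι ℚ) (n : ℤ) {u v : Fock ι} (hu : u ∈ V (Λ : Set (ι → ℚ)))
    (hv : v ∈ V (Λ : Set (ι → ℚ))) : mode G n u v ∈ V (Λ : Set (ι → ℚ)) :=
  mode_mem_V (fun _ hβ _ hγ => add_mem hβ hγ) G n hu hv

/-- The products of `V_{ℤα}`. -/
def modeV1 (n : ℤ) : V1 →ₗ[ℂ] V1 →ₗ[ℂ] V1 :=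
  LinearMap.mk₂ ℂ (fun u v => ⟨mode gramA1 n u v, mode_mem_lattice _ _ u.2 v.2⟩)
    (fun _ _ _ => Subtype.ext (mode_add_left _ _ _ _ _))
    (fun _ _ _ => Subtype.ext (mode_smul_left _ _ _ _ _))
    (fun _ _ _ => Subtype.ext (mode_add_right _ _ _ _ _))
    (fun _ _ _ => Subtype.ext (mode_smul_right _ _ _ _ _))

/-- `e^{kα}` as an element of `V_{ℤα}`. -/
def expV1 (k : ℤ) : V1 := ⟨expA1 k, expA1_mem k⟩

/-- `α(-1)` as an element of `V_{ℤα}`. -/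
def cartanV1 : V1 := ⟨cartanVec 0, vec_zero_mem _⟩

/-- The Virasoro element of `V_{ℤα}`. -/
def virasoroV1 : V1 := ⟨virasoro gramA1, vec_zero_mem _⟩

theorem coe_expV1_zero : (expV1 0 : Fock (Fin 1)) = vacuum := by
  change expA1 0 = _
  rw [expA1, vacuum]
  congr 1

theorem modeV1_exp (k l : ℤ) :
    modeV1 (-1 - 2 * k * l) (expV1 k) (expV1 l) = expV1 (k + l) := by
  refine Subtype.ext ?_
  change mode gramA1 _ (vec _ 1) (vec _ 1) = vec _ 1
  rw [mode_exp_exp gramA1 (pairing_gramA1 k l), show -(-1 - 2 * k * l) - 1 - 2 * k * l = 0 by ring,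
    expMode_zero]
  congr 1
  funext i
  simp

/-- The leading product of `e^{kα}` and `e^{±α}` is `e^{(k±1)α}`, so every `e^{kα}` is reached; the
modes of `α(-1)` then supply the polynomial factors. -/
theorem eq_top_of_closed {W : Submodule ℂ V1} (hW : ∀ n, ∀ u ∈ W, ∀ v ∈ W, modeV1 n u v ∈ W)
    (h0 : expV1 0 ∈ W) (h1 : expV1 1 ∈ W) (h2 : expV1 (-1) ∈ W) (hc : cartanV1 ∈ W) : W = ⊤ := by
  have hexp : ∀ k : ℤ, expV1 k ∈ W := by
    intro k
    induction k using Int.induction_on with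
    | zero => exact h0
    | succ k ih =>
      rw [← modeV1_exp]
      exact hW _ _ ih _ h1
    | pred k ih =>
      rw [sub_eq_add_neg, ← modeV1_exp]
      exact hW _ _ ih _ h2
  have hcl : ∀ n, ∀ u ∈ W.map V1.subtype, ∀ v ∈ W.map V1.subtype,
      mode gramA1 n u v ∈ W.map V1.subtype := by
    rintro n _ ⟨u, hu, rfl⟩ _ ⟨v, hv, rfl⟩
    exact ⟨_, hW n u hu v hv, rfl⟩
  refine eq_top_iff.2 fun u _ => ?_
  have : (u : Fock (Fin 1)) ∈ W.map V1.subtype := by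
    obtain ⟨u, hu⟩ := u
    induction hu using V_induction with
    | h0 => exact zero_mem _
    | hadd u v _ _ h h' => exact add_mem (h trivial) (h' trivial)
    | hvec β hβ p =>
      obtain ⟨k, rfl⟩ := mem_intLattice_one.1 hβ
      refine vec_mem_of_closed hcl (fun i => ?_) ⟨expV1 k, hexp k, rfl⟩ p
      rw [Subsingleton.elim i 0]
      exact ⟨cartanV1, hc, rfl⟩
  obtain ⟨u', hu', h⟩ := this
  rwa [← Subtype.ext (a1 := u') (a2 := u) h]

/-- `e^α_0`. -/
def raise : Module.End ℂ V1 := modeV1 0 (expV1 1)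

theorem mode_zero_exp {l : ℤ} (q : Heis (Fin 1)) :
    mode gramA1 0 (expA1 1) (vec (fun _ => (l : ℚ)) q) = vec (fun _ => ((1 + l : ℤ) : ℚ))
      (expZero gramA1 (fun _ => ((1 : ℤ) : ℚ)) (2 * l) q) := by
  rw [expA1, mode_vec, show -(0 : ℤ) - 1 = -1 by ring,
    coeff_vertexSeries_exp (s := 2 * l) _ _ _ (by rw [pairing_gramA1]; simp)]
  congr 1
  funext i
  simp

/-- The evenness hypothesis of `expZero_coeff_vertexSeries` holds because `⟨α, kα⟩ = 2k`. -/
theorem raise_modeV1 (n : ℤ) (u v : V1) :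
    raise (modeV1 n u v) = modeV1 n (raise u) v + modeV1 n u (raise v) := by
  refine Subtype.ext ?_
  change mode gramA1 0 (expA1 1) (mode gramA1 n u v) =
    mode gramA1 n (mode gramA1 0 (expA1 1) u) v + mode gramA1 n u (mode gramA1 0 (expA1 1) v)
  obtain ⟨u, hu⟩ := u
  obtain ⟨v, hv⟩ := v
  dsimp only
  induction hu using V_induction with
  | h0 => simp only [mode_zero_left, mode_zero_right, add_zero]
  | hadd u u' _ _ h h' => simp only [mode_add_left, mode_add_right, h, h']; abel
  | hvec β hβ p =>
  induction hv using V_induction with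
  | h0 => simp only [mode_zero_right, add_zero]
  | hadd u u' _ _ h h' => simp only [mode_add_right, h, h']; abel
  | hvec γ hγ q =>
    obtain ⟨k, rfl⟩ := mem_intLattice_one.1 hβ
    obtain ⟨l, rfl⟩ := mem_intLattice_one.1 hγ
    have h1 : (fun _ => (k : ℚ)) + (fun _ => (l : ℚ)) = fun _ : Fin 1 => ((k + l : ℤ) : ℚ) := by
      funext i; simp
    have h2 : ∀ m : ℤ, (fun _ : Fin 1 => ((1 + m : ℤ) : ℚ)) =
        (fun _ => ((1 : ℤ) : ℚ)) + fun _ => (m : ℚ) := by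
      intro m; funext i; simp
    have hs : ∀ m : ℤ, pairing gramA1 (fun _ => ((1 : ℤ) : ℚ)) (fun _ => (m : ℚ)) =
        ((2 * m : ℤ) : ℚ) := fun m => by rw [pairing_gramA1]; simp
    rw [mode_vec, h1, mode_zero_exp, mode_zero_exp, mode_zero_exp, mode_vec, mode_vec, mul_add,
      expZero_coeff_vertexSeries gramA1_transpose (hs k) (hs l) (pairing_gramA1 k l)
        (even_two_mul k), vec_add, h2 k, h2 l]
    congr 2
    · rw [← h2 k]; funext i; simp; ring
    · rw [← h2 l]; funext i; simp; ring

theorem expZero_one (l : ℤ) : expZero gramA1 (fun _ => ((1 : ℤ) : ℚ)) l 1 =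
    expMode (fun _ => ((1 : ℤ) : ℚ)) (-l - 1) := by
  have := expResidue_C_mul_X_pow (fun _ : Fin 1 => ((1 : ℤ) : ℚ)) l 1 0
  rw [expZero, map_one]
  simpa using this

theorem raise_expV1_zero : raise (expV1 0) = 0 := by
  refine Subtype.ext ?_
  change mode gramA1 0 (expA1 1) (vec _ _) = 0
  rw [mode_zero_exp, expZero_one, expMode_of_neg _ (by norm_num), vec_zero]

theorem raise_expV1_one : raise (expV1 1) = 0 := by
  refine Subtype.ext ?_
  change mode gramA1 0 (expA1 1) (vec _ _) = 0
  rw [mode_zero_exp, expZero_one, expMode_of_neg _ (by norm_num), vec_zero]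

theorem raise_expV1_neg_one : raise (expV1 (-1)) = cartanV1 := by
  refine Subtype.ext ?_
  change mode gramA1 0 (expA1 1) (vec _ _) = vec _ _
  rw [mode_zero_exp, expZero_one, show -(2 * (-1 : ℤ)) - 1 = 1 by norm_num, expMode_one]
  congr 1
  simp [linForm]

theorem annihPoly_cartan : annihPoly gramA1 (fun _ => ((1 : ℤ) : ℚ)) (MvPolynomial.X (0, 0)) =
    Polynomial.C (MvPolynomial.X (0, 0)) * Polynomial.X ^ 0 +
      Polynomial.C (-2) * Polynomial.X ^ 1 := by
  have h : gramCoeff gramA1 (fun _ => ((1 : ℤ) : ℚ)) (0, 0) = 2 := by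
    simp [gramCoeff, gramA1, Matrix.mulVec, dotProduct]
  rw [annihPoly_X, h, map_ofNat, map_neg, map_ofNat]
  ring

theorem zero_eq_const : (0 : Fin 1 → ℚ) = fun _ => ((0 : ℤ) : ℚ) := by
  funext i; simp

theorem raise_cartanV1 : raise cartanV1 = -(2 : ℂ) • expV1 1 := by
  refine Subtype.ext ?_
  change mode gramA1 0 (expA1 1) (vec _ _) = -(2 : ℂ) • vec _ _
  rw [zero_eq_const, mode_zero_exp, expZero, annihPoly_cartan, map_add, expResidue_C_mul_X_pow,
    expResidue_C_mul_X_pow, expMode_of_neg _ (by norm_num),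
    show ((1 : ℕ) : ℤ) - 2 * 0 - 1 = 0 by norm_num, expMode_zero, smul_vec,
    MvPolynomial.smul_eq_C_mul, map_neg, map_ofNat]
  congr 1
  simp

theorem virasoro_gramA1 : virasoro gramA1 =
    vec 0 (MvPolynomial.C (1 / 4) * (MvPolynomial.X (0, 0) * MvPolynomial.X (0, 0))) := by
  have h : (gramA1⁻¹ 0 0 : ℚ) = 1 / 2 := by
    rw [gramA1, Matrix.inv_def]
    simp
  rw [virasoro]
  congr 1
  simp only [Finset.univ_unique, Fin.default_eq_zero, Finset.sum_singleton, h]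
  rw [← mul_assoc, ← map_mul]
  congr 2
  norm_num

/-- Expanding `(α(-1) - 2η)² / 4` in powers of `η = w⁻¹`, the three terms have residues `0`,
`-α(-1)` and `α(-1)`. It follows that the exponential of this zero mode fixes the Virasoro element.
-/
theorem raise_virasoroV1 : raise virasoroV1 = 0 := by
  refine Subtype.ext ?_
  change mode gramA1 0 (expA1 1) (virasoro gramA1) = 0
  have h : annihPoly gramA1 (fun _ => ((1 : ℤ) : ℚ))
      (MvPolynomial.C (1 / 4) * (MvPolynomial.X (0, 0) * MvPolynomial.X (0, 0))) =
      Polynomial.C (MvPolynomial.C (1 / 4) * (MvPolynomial.X (0, 0) * MvPolynomial.X (0, 0))) *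
        Polynomial.X ^ 0 + Polynomial.C (-MvPolynomial.X (0, 0)) * Polynomial.X ^ 1 +
          Polynomial.C 1 * Polynomial.X ^ 2 := by
    rw [map_mul, map_mul, annihPoly_cartan, annihPoly_C]
    have h4 : (Polynomial.C (MvPolynomial.C (1 / 4)) : Polynomial (Heis (Fin 1))) * 4 = 1 := by
      rw [show (4 : Polynomial (Heis (Fin 1))) = Polynomial.C (MvPolynomial.C 4) by
        rw [map_ofNat, map_ofNat], ← map_mul, ← map_mul]
      norm_num
    simp only [map_mul, map_neg, map_ofNat, map_one, pow_zero, pow_one, mul_one]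
    linear_combination (Polynomial.X ^ 2 -
      Polynomial.C (MvPolynomial.X (0, 0)) * Polynomial.X) * h4
  rw [virasoro_gramA1, zero_eq_const, mode_zero_exp, expZero, h, map_add, map_add,
    expResidue_C_mul_X_pow, expResidue_C_mul_X_pow, expResidue_C_mul_X_pow,
    expMode_of_neg _ (by norm_num), show ((1 : ℕ) : ℤ) - 2 * 0 - 1 = 0 by norm_num, expMode_zero,
    show ((2 : ℕ) : ℤ) - 2 * 0 - 1 = 1 by norm_num, expMode_one]
  simp [linForm]

end RankOne

/-! ### Existence and uniqueness of `σ` -/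

section Sigma

theorem V1_map_sub (f : V1 →ₗ[ℂ] V1) (u v : V1) : f (u - v) = f u - f v := map_sub f u v

theorem V1_neg_zero : -(0 : V1) = 0 := by module

theorem V1_map_neg (f : V1 →ₗ[ℂ] V1) (u : V1) : f (-u) = -f u := map_neg f u

/-- The lift of `-1` on `V_{ℤα}`. -/
def negV1 : V1 →ₗ[ℂ] V1 :=
  (negLift (ι := Fin 1)).toLinearMap.restrict
    fun _ hu => negLift_mem_V (fun _ hβ => neg_mem hβ) hu

theorem coe_negV1 (u : V1) : (negV1 u : Fock (Fin 1)) = negLift (u : Fock (Fin 1)) := rfl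

theorem negV1_negV1 (u : V1) : negV1 (negV1 u) = u := Subtype.ext (negLift_negLift _)

theorem negV1_modeV1 (n : ℤ) (u v : V1) :
    negV1 (modeV1 n u v) = modeV1 n (negV1 u) (negV1 v) :=
  Subtype.ext (mode_negLift _ _ _ _).symm

theorem negV1_expV1 (k : ℤ) : negV1 (expV1 k) = expV1 (-k) := by
  refine Subtype.ext ?_
  change negLift (vec _ 1) = vec _ 1
  rw [negLift_vec, map_one]
  congr 1

theorem negV1_cartanV1 : negV1 cartanV1 = -cartanV1 := by
  refine Subtype.ext ?_
  change negLift (vec _ _) = -vec _ _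
  rw [negLift_vec, polyMap_neg_one_X, neg_zero]
  exact AddMonoidAlgebra.single_neg _ _

theorem negLift_virasoro {ι : Type} [Fintype ι] [DecidableEq ι] (G : Matrix ι ι ℚ) :
    negLift (virasoro G) = virasoro G := by
  rw [virasoro, negLift_vec, neg_zero]
  congr 1
  simp only [map_mul, map_sum, polyMap_neg_one_X, neg_mul_neg]
  simp only [MvPolynomial.algHom_C, MvPolynomial.algebraMap_eq]

theorem negV1_virasoroV1 : negV1 virasoroV1 = virasoroV1 := Subtype.ext (negLift_virasoro _)

/-- `e^{-α}_0`. -/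
def lower : Module.End ℂ V1 := negV1 ∘ₗ raise ∘ₗ negV1

theorem lower_apply (u : V1) : lower u = negV1 (raise (negV1 u)) := rfl

theorem lower_modeV1 (n : ℤ) (u v : V1) :
    lower (modeV1 n u v) = modeV1 n (lower u) v + modeV1 n u (lower v) := by
  simp only [lower_apply, negV1_modeV1, raise_modeV1, map_add, negV1_negV1]

theorem lower_expV1_zero : lower (expV1 0) = 0 := by
  rw [lower_apply, negV1_expV1, neg_zero, raise_expV1_zero, map_zero]

theorem lower_expV1_one : lower (expV1 1) = -cartanV1 := by
  rw [lower_apply, negV1_expV1, raise_expV1_neg_one, negV1_cartanV1]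

theorem lower_expV1_neg_one : lower (expV1 (-1)) = 0 := by
  rw [lower_apply, negV1_expV1, neg_neg, raise_expV1_one, map_zero]

theorem lower_cartanV1 : lower cartanV1 = (2 : ℂ) • expV1 (-1) := by
  rw [lower_apply, negV1_cartanV1, V1_map_neg, raise_cartanV1, V1_map_neg, map_smul, negV1_expV1]
  module

theorem lower_virasoroV1 : lower virasoroV1 = 0 := by
  rw [lower_apply, negV1_virasoroV1, raise_virasoroV1, map_zero]

/-- The vectors killed by some power of a derivation form a subspace closed under all products, so
generators suffice. -/
theorem locallyNilpotent_of_derivation {D : Module.End ℂ V1}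
    (hD : ∀ n u v, D (modeV1 n u v) = modeV1 n (D u) v + modeV1 n u (D v))
    (h0 : ∃ n, (D ^ n) (expV1 0) = 0) (h1 : ∃ n, (D ^ n) (expV1 1) = 0)
    (h2 : ∃ n, (D ^ n) (expV1 (-1)) = 0) (hc : ∃ n, (D ^ n) cartanV1 = 0) (u : V1) :
    ∃ n, (D ^ n) u = 0 := by
  have hz : ∀ {k l : ℕ} {w : V1}, (D ^ k) w = 0 → k ≤ l → (D ^ l) w = 0 := by
    intro k l w hw hkl
    obtain ⟨j, rfl⟩ := Nat.exists_eq_add_of_le' hkl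
    rw [pow_add, Module.End.mul_apply, hw, map_zero]
  let W : Submodule ℂ V1 :=
    { carrier := {u | ∃ n, (D ^ n) u = 0}
      zero_mem' := ⟨0, map_zero _⟩
      add_mem' := by
        rintro u v ⟨m, hm⟩ ⟨n, hn⟩
        exact ⟨max m n, by rw [map_add, hz hm (le_max_left _ _), hz hn (le_max_right _ _), add_zero]⟩
      smul_mem' := by
        rintro c u ⟨m, hm⟩
        exact ⟨m, by rw [map_smul, hm, smul_zero]⟩ }
  have hW : W = ⊤ := by
    refine eq_top_of_closed ?_ h0 h1 h2 hc
    rintro n u ⟨k, hk⟩ v ⟨l, hl⟩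
    exact ⟨k + l, pow_bilin_eq_zero (hD n) hk hl⟩
  exact (hW ▸ Submodule.mem_top : u ∈ W)

/-- The exponents are read from the string `e^{-α} ↦ α(-1) ↦ -2 e^α ↦ 0`, the adjoint action of a
nilpotent element of `sl₂`. -/
theorem raise_locallyNilpotent : ∀ u, ∃ n, (raise ^ n) u = 0 := by
  refine locallyNilpotent_of_derivation raise_modeV1 ⟨1, ?_⟩ ⟨1, ?_⟩ ⟨3, ?_⟩ ⟨2, ?_⟩ <;>
  simp [pow_succ, raise_expV1_zero, raise_expV1_one, raise_expV1_neg_one, raise_cartanV1]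

theorem lower_locallyNilpotent : ∀ u, ∃ n, (lower ^ n) u = 0 := by
  refine locallyNilpotent_of_derivation lower_modeV1 ⟨1, ?_⟩ ⟨3, ?_⟩ ⟨1, ?_⟩ ⟨2, ?_⟩ <;>
  simp [pow_succ, lower_expV1_zero, lower_expV1_one, lower_expV1_neg_one, lower_cartanV1, V1_map_neg, V1_neg_zero]

theorem locExp_eq_self {M : Type*} [AddCommMonoid M] [Module ℂ M] {D : Module.End ℂ M} {u : M}
    (h : D u = 0) : locExp D u = u := by
  rw [locExp_eq_sum (n := 1) (by simpa using h)]
  simp [dividedPow]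

theorem locExp_eq_add {M : Type*} [AddCommMonoid M] [Module ℂ M] {D : Module.End ℂ M} {u : M}
    (h : D (D u) = 0) : locExp D u = u + D u := by
  rw [locExp_eq_sum (n := 2) (by simpa [pow_succ] using h)]
  simp [dividedPow, Finset.sum_range_succ]

theorem locExp_eq_add_add {M : Type*} [AddCommMonoid M] [Module ℂ M] {D : Module.End ℂ M} {u : M}
    (h : D (D (D u)) = 0) : locExp D u = u + D u + (2 : ℂ)⁻¹ • D (D u) := by
  rw [locExp_eq_sum (n := 3) (by simpa [pow_succ] using h)]
  simp [dividedPow, Finset.sum_range_succ, pow_succ]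

/-- The character `kα ↦ (-1/2)^k`. -/
def halfChar (β : Fin 1 → ℚ) : ℂ := Complex.exp ((β 0 : ℚ) * Complex.log (-1 / 2))

/-- Defining the character through a logarithm makes it multiplicative on all of `ℚ`, as
`mode_twist` requires, and not only on the lattice. -/
theorem halfChar_add (β γ : Fin 1 → ℚ) : halfChar (β + γ) = halfChar β * halfChar γ := by
  rw [halfChar, halfChar, halfChar, ← Complex.exp_add, Pi.add_apply]
  congr 1
  push_cast
  ring

theorem halfChar_zero : halfChar 0 = 1 := by simp [halfChar]

/-- The automorphism `e^{kα} ↦ (-1/2)^k e^{kα}`. -/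
def twistV1 : V1 →ₗ[ℂ] V1 := (twist halfChar).restrict fun _ hu => twist_mem_V _ hu

theorem twistV1_modeV1 (n : ℤ) (u v : V1) :
    twistV1 (modeV1 n u v) = modeV1 n (twistV1 u) (twistV1 v) :=
  Subtype.ext (mode_twist _ halfChar_add _ _ _).symm

theorem twistV1_expV1_zero : twistV1 (expV1 0) = expV1 0 := by
  refine Subtype.ext ?_
  change twist _ (vec _ 1) = vec _ 1
  rw [twist_vec, ← zero_eq_const, halfChar_zero, one_smul]

theorem twistV1_expV1_one : twistV1 (expV1 1) = (-1 / 2 : ℂ) • expV1 1 := by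
  refine Subtype.ext ?_
  change twist _ (vec _ 1) = (-1 / 2 : ℂ) • vec _ 1
  rw [twist_vec, smul_vec]
  congr 2
  rw [halfChar]
  simp only [Int.cast_one, Rat.cast_one, one_mul]
  exact Complex.exp_log (by norm_num)

theorem twistV1_expV1_neg_one : twistV1 (expV1 (-1)) = (-2 : ℂ) • expV1 (-1) := by
  refine Subtype.ext ?_
  change twist _ (vec _ 1) = (-2 : ℂ) • vec _ 1
  rw [twist_vec, smul_vec]
  congr 2
  rw [halfChar]
  simp only [Int.cast_neg, Int.cast_one, Rat.cast_neg, Rat.cast_one, neg_one_mul]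
  rw [Complex.exp_neg, Complex.exp_log (by norm_num)]
  norm_num

theorem twistV1_of_vec_zero {p : Heis (Fin 1)} {u : V1} (h : (u : Fock (Fin 1)) = vec 0 p) :
    twistV1 u = u := by
  refine Subtype.ext ?_
  change twist _ (u : Fock (Fin 1)) = u
  rw [h, twist_vec, halfChar_zero, one_smul]

/-- The homomorphism underlying `σ`. -/
def sigmaLin : V1 →ₗ[ℂ] V1 :=
  -- A Gauss decomposition. The raising operator kills `e^α` and the lowering one only adds terms of
  -- lower degree, so the coefficient of `e^α` in `σ(e^α)` is the value of the character at `α`. The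
  -- prescribed values force it to be `-1/2`.
  locExpLin lower lower_locallyNilpotent ∘ₗ twistV1 ∘ₗ locExpLin raise raise_locallyNilpotent

theorem sigmaLin_modeV1 (n : ℤ) (u v : V1) :
    sigmaLin (modeV1 n u v) = modeV1 n (sigmaLin u) (sigmaLin v) := by
  have h1 : ∀ u v, locExp raise (modeV1 n u v) = modeV1 n (locExp raise u) (locExp raise v) :=
    fun u v => locExp_bilin (raise_modeV1 n) (raise_locallyNilpotent u).choose_spec
      (raise_locallyNilpotent v).choose_spec
  have h2 : ∀ u v, locExp lower (modeV1 n u v) = modeV1 n (locExp lower u) (locExp lower v) :=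
    fun u v => locExp_bilin (lower_modeV1 n) (lower_locallyNilpotent u).choose_spec
      (lower_locallyNilpotent v).choose_spec
  change locExp lower (twistV1 (locExp raise _)) = modeV1 n (locExp lower (twistV1 (locExp raise _)))
    (locExp lower (twistV1 (locExp raise _)))
  rw [h1, twistV1_modeV1, h2]

theorem sigmaLin_apply (u : V1) : sigmaLin u =
    locExpLin lower lower_locallyNilpotent (twistV1 (locExp raise u)) := rfl

theorem locExpLin_apply {M : Type*} [AddCommMonoid M] [Module ℂ M] (D : Module.End ℂ M)
    (hD : ∀ u, ∃ n, (D ^ n) u = 0) (u : M) : locExpLin D hD u = locExp D u := rfl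

theorem sigmaLin_expV1_zero : sigmaLin (expV1 0) = expV1 0 := by
  rw [sigmaLin_apply, locExp_eq_self raise_expV1_zero, twistV1_expV1_zero, locExpLin_apply,
    locExp_eq_self lower_expV1_zero]

theorem sigmaLin_virasoroV1 : sigmaLin virasoroV1 = virasoroV1 := by
  rw [sigmaLin_apply, locExp_eq_self raise_virasoroV1, twistV1_of_vec_zero virasoro_gramA1,
    locExpLin_apply, locExp_eq_self lower_virasoroV1]

theorem locExp_lower_expV1_one :
    locExp lower (expV1 1) = expV1 1 - cartanV1 - expV1 (-1) := by
  rw [locExp_eq_add_add] <;> simp only [lower_expV1_one, V1_map_neg, lower_cartanV1, map_smul,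
    lower_expV1_neg_one, smul_zero, V1_neg_zero]
  module

theorem locExp_lower_cartanV1 : locExp lower cartanV1 = cartanV1 + (2 : ℂ) • expV1 (-1) := by
  rw [locExp_eq_add] <;> simp only [lower_cartanV1, map_smul, lower_expV1_neg_one, smul_zero]

theorem sigmaLin_expV1_one :
    sigmaLin (expV1 1) = (-1 / 2 : ℂ) • (expV1 1 - cartanV1 - expV1 (-1)) := by
  rw [sigmaLin_apply, locExp_eq_self raise_expV1_one, twistV1_expV1_one, map_smul, locExpLin_apply,
    locExp_lower_expV1_one]

theorem sigmaLin_cartanV1 : sigmaLin cartanV1 = expV1 1 + expV1 (-1) := by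
  rw [sigmaLin_apply, locExp_eq_add (by rw [raise_cartanV1, map_smul, raise_expV1_one, smul_zero]),
    raise_cartanV1, map_add, map_smul, twistV1_expV1_one, map_add, map_smul, map_smul,
    locExpLin_apply, locExpLin_apply, twistV1_of_vec_zero rfl, locExp_lower_cartanV1,
    locExp_lower_expV1_one]
  module

theorem sigmaLin_expV1_neg_one :
    sigmaLin (expV1 (-1)) = (1 / 2 : ℂ) • (cartanV1 + expV1 1 - expV1 (-1)) := by
  rw [sigmaLin_apply, locExp_eq_add_add (by rw [raise_expV1_neg_one, raise_cartanV1, map_smul,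
    raise_expV1_one, smul_zero]), raise_expV1_neg_one, raise_cartanV1]
  simp only [map_add, map_smul, twistV1_expV1_one, twistV1_expV1_neg_one,
    twistV1_of_vec_zero (u := cartanV1) rfl, locExpLin_apply, locExp_lower_cartanV1,
    locExp_lower_expV1_one, locExp_eq_self lower_expV1_neg_one]
  module

theorem eq_of_eqOn_generators {f g : V1 →ₗ[ℂ] V1}
    (hf : ∀ n u v, f (modeV1 n u v) = modeV1 n (f u) (f v))
    (hg : ∀ n u v, g (modeV1 n u v) = modeV1 n (g u) (g v))
    (h0 : f (expV1 0) = g (expV1 0)) (h1 : f (expV1 1) = g (expV1 1))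
    (h2 : f (expV1 (-1)) = g (expV1 (-1))) (hc : f cartanV1 = g cartanV1) : f = g := by
  have : LinearMap.eqLocus f g = ⊤ := by
    refine eq_top_of_closed ?_ h0 h1 h2 hc
    intro n u hu v hv
    rw [LinearMap.mem_eqLocus] at hu hv ⊢
    rw [hf, hg, hu, hv]
  exact LinearMap.ext fun u => (this ▸ Submodule.mem_top : u ∈ LinearMap.eqLocus f g)

/-- Being an involution is a statement about generators, and it supplies the inverse of `σ`. -/
theorem sigmaLin_sigmaLin (u : V1) : sigmaLin (sigmaLin u) = u := by
  have : sigmaLin ∘ₗ sigmaLin = LinearMap.id := by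
    refine eq_of_eqOn_generators (fun n u v => ?_) (fun n u v => rfl) ?_ ?_ ?_ ?_
    · simp only [LinearMap.comp_apply, sigmaLin_modeV1]
    · simp only [LinearMap.comp_apply, sigmaLin_expV1_zero, LinearMap.id_apply]
    all_goals
      simp only [LinearMap.comp_apply, sigmaLin_expV1_one, sigmaLin_expV1_neg_one,
        sigmaLin_cartanV1, map_smul, map_add, V1_map_sub, LinearMap.id_apply]
      module
  exact LinearMap.congr_fun this u

/-- The automorphism `σ`. -/
def sigma : V1 ≃ₗ[ℂ] V1 :=
  LinearEquiv.ofLinearMap sigmaLin sigmaLin (LinearMap.ext sigmaLin_sigmaLin)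
    (LinearMap.ext sigmaLin_sigmaLin)

theorem isSigma_sigma : IsSigma sigma where
  aut :=
    { map_mode := fun n u v => ⟨modeV1 n u v, rfl,
        congrArg Subtype.val (sigmaLin_modeV1 n u v)⟩
      map_vacuum := ⟨expV1 0, coe_expV1_zero,
        (congrArg Subtype.val sigmaLin_expV1_zero).trans coe_expV1_zero⟩
      map_virasoro := ⟨virasoroV1, rfl, congrArg Subtype.val sigmaLin_virasoroV1⟩ }
  cartan := ⟨cartanV1, rfl, congrArg Subtype.val sigmaLin_cartanV1⟩
  add := ⟨expV1 1 + expV1 (-1), rfl, by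
    have : sigmaLin (expV1 1 + expV1 (-1)) = cartanV1 := by
      rw [map_add, sigmaLin_expV1_one, sigmaLin_expV1_neg_one]
      module
    exact congrArg Subtype.val this⟩
  sub := ⟨expV1 1 - expV1 (-1), rfl, by
    have : sigmaLin (expV1 1 - expV1 (-1)) = -(expV1 1 - expV1 (-1)) := by
      rw [V1_map_sub, sigmaLin_expV1_one, sigmaLin_expV1_neg_one]
      module
    exact congrArg Subtype.val this⟩

theorem IsSigma.map_modeV1 {σ : V1 ≃ₗ[ℂ] V1} (h : IsSigma σ) (n : ℤ) (u v : V1) :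
    σ (modeV1 n u v) = modeV1 n (σ u) (σ v) := by
  obtain ⟨w, hw, hw'⟩ := h.aut.map_mode n u v
  rw [← show w = modeV1 n u v from Subtype.ext hw]
  exact Subtype.ext hw'

theorem IsSigma.eq_sigma {σ : V1 ≃ₗ[ℂ] V1} (h : IsSigma σ) : σ = sigma := by
  obtain ⟨w0, h0, h0'⟩ := h.aut.map_vacuum
  obtain ⟨wc, hc, hc'⟩ := h.cartan
  obtain ⟨wa, ha, ha'⟩ := h.add
  obtain ⟨ws, hs, hs'⟩ := h.sub
  rw [show w0 = expV1 0 from Subtype.ext (h0.trans coe_expV1_zero.symm)] at h0'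
  rw [show wc = cartanV1 from Subtype.ext hc] at hc'
  rw [show wa = expV1 1 + expV1 (-1) from Subtype.ext ha] at ha'
  rw [show ws = expV1 1 - expV1 (-1) from Subtype.ext hs] at hs'
  replace h0' : σ (expV1 0) = expV1 0 := Subtype.ext (h0'.trans coe_expV1_zero.symm)
  replace hc' : σ cartanV1 = expV1 1 + expV1 (-1) := Subtype.ext hc'
  replace ha' : σ (expV1 1 + expV1 (-1)) = cartanV1 := Subtype.ext ha'
  replace hs' : σ (expV1 1 - expV1 (-1)) = -(expV1 1 - expV1 (-1)) := Subtype.ext hs'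
  rw [map_add] at ha'
  rw [show σ (expV1 1 - expV1 (-1)) = σ (expV1 1) - σ (expV1 (-1)) from map_sub σ _ _] at hs'
  -- The prescribed values on `e^α + e^{-α}` and `e^α - e^{-α}` determine those on `e^α` and
  -- `e^{-α}`; with the vacuum and `α(-1)` all generators are covered.
  have key : σ.toLinearMap = sigmaLin := by
    refine eq_of_eqOn_generators h.map_modeV1 sigmaLin_modeV1 (h0'.trans sigmaLin_expV1_zero.symm)
      ?_ ?_ (hc'.trans sigmaLin_cartanV1.symm)
    · rw [sigmaLin_expV1_one, LinearEquiv.coe_coe]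
      rw [show σ (expV1 1) = (1 / 2 : ℂ) • ((σ (expV1 1) + σ (expV1 (-1))) +
        (σ (expV1 1) - σ (expV1 (-1)))) by module, ha', hs']
      module
    · rw [sigmaLin_expV1_neg_one, LinearEquiv.coe_coe]
      rw [show σ (expV1 (-1)) = (1 / 2 : ℂ) • ((σ (expV1 1) + σ (expV1 (-1))) -
        (σ (expV1 1) - σ (expV1 (-1)))) by module, ha', hs']
      module
  exact LinearEquiv.toLinearMap_injective key

end Sigma

/-! ### Tensor products of Fock spaces -/

section Tensor

variable {ι κ υ : Type} [Fintype ι] [DecidableEq ι] [Fintype κ] [DecidableEq κ] [Fintype υ]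
  [DecidableEq υ]

theorem tensorMap_tmul (A : Matrix υ ι ℚ) (B : Matrix υ κ ℚ) (U : Submodule ℂ (Fock ι))
    (W : Submodule ℂ (Fock κ)) (u : U) (w : W) :
    tensorMap A B U W (u ⊗ₜ w) = inducedMap A (u : Fock ι) * inducedMap B (w : Fock κ) := rfl

theorem inducedMap_comp (A : Matrix υ ι ℚ) (P : Matrix κ υ ℚ) (u : Fock ι) :
    inducedMap P (inducedMap A u) = inducedMap (P * A) u := by
  induction u using fock_induction with
  | h0 => simp
  | hadd u v h h' => simp only [map_add, h, h']
  | hvec β p =>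
    rw [inducedMap_vec, inducedMap_vec, inducedMap_vec, Matrix.mulVec_mulVec]
    congr 1
    have : (polyMap P).comp (polyMap A) = polyMap (P * A) := by
      refine MvPolynomial.algHom_ext fun x => ?_
      rw [AlgHom.comp_apply, polyMap_X, polyMap_X, map_sum]
      simp only [map_mul, polyMap_X, Matrix.mul_apply, Rat.cast_sum, Rat.cast_mul, map_sum,
        Finset.mul_sum, Finset.sum_mul, MvPolynomial.algHom_C, MvPolynomial.algebraMap_eq]
      rw [Finset.sum_comm]
      refine Finset.sum_congr rfl fun i _ => Finset.sum_congr rfl fun j _ => ?_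
      ring
    exact congrArg (fun f => f p) this

/-- The comultiplication `h ↦ C h ⊗ 1 + 1 ⊗ D h` on `M(1)`. -/
def comulPoly (C : Matrix ι υ ℚ) (D : Matrix κ υ ℚ) :
    Heis υ →ₐ[ℂ] Fock ι ⊗[ℂ] Fock κ :=
  MvPolynomial.aeval (R := ℂ) (S₁ := Fock ι ⊗[ℂ] Fock κ) fun x => vec 0 (polyMap C (MvPolynomial.X x)) ⊗ₜ 1 +
    1 ⊗ₜ vec 0 (polyMap D (MvPolynomial.X x))

/-- The comultiplication on `M(1) ⊗ ℂ[ℚ ⊗ L]`. -/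
def comul (C : Matrix ι υ ℚ) (D : Matrix κ υ ℚ) : Fock υ →+ Fock ι ⊗[ℂ] Fock κ :=
  AddMonoidAlgebra.liftNC (comulPoly C D : Heis υ →+ Fock ι ⊗[ℂ] Fock κ) fun β =>
    vec (C.mulVec β.toAdd) 1 ⊗ₜ vec (D.mulVec β.toAdd) 1

theorem comul_vec (C : Matrix ι υ ℚ) (D : Matrix κ υ ℚ) (β : υ → ℚ) (p : Heis υ) :
    comul C D (vec β p) =
      comulPoly C D p * (vec (C.mulVec β) 1 ⊗ₜ vec (D.mulVec β) 1) :=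
  AddMonoidAlgebra.liftNC_single _ _ _ _

theorem comulPoly_linear {C : Matrix ι υ ℚ} {D : Matrix κ υ ℚ} (c : υ → ℂ) (m : ℕ) :
    comulPoly C D (∑ k, MvPolynomial.C (c k) * MvPolynomial.X (k, m)) =
      vec 0 (polyMap C (∑ k, MvPolynomial.C (c k) * MvPolynomial.X (k, m))) ⊗ₜ 1 +
        1 ⊗ₜ vec 0 (polyMap D (∑ k, MvPolynomial.C (c k) * MvPolynomial.X (k, m))) := by
  simp only [← MvPolynomial.smul_eq_C_mul, map_sum, map_smul]
  have h1 : ∀ f : υ → Heis ι, (vec 0 (∑ k, c k • f k) : Fock ι) = ∑ k, c k • vec 0 (f k) := by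
    intro f
    simp only [smul_vec]
    exact map_sum (AddMonoidAlgebra.singleAddHom (R := Heis ι) 0) _ _
  have h2 : ∀ f : υ → Heis κ, (vec 0 (∑ k, c k • f k) : Fock κ) = ∑ k, c k • vec 0 (f k) := by
    intro f
    simp only [smul_vec]
    exact map_sum (AddMonoidAlgebra.singleAddHom (R := Heis κ) 0) _ _
  rw [h1, h2, TensorProduct.sum_tmul, TensorProduct.tmul_sum, ← Finset.sum_add_distrib]
  refine Finset.sum_congr rfl fun k _ => ?_
  rw [comulPoly, MvPolynomial.aeval_X, smul_add, TensorProduct.smul_tmul', TensorProduct.tmul_smul]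

theorem polyMap_polyMap (A : Matrix υ ι ℚ) (C : Matrix κ υ ℚ) (p : Heis ι) :
    polyMap C (polyMap A p) = polyMap (C * A) p := by
  have h := inducedMap_comp A C (vec 0 p)
  rw [inducedMap_vec, inducedMap_vec, inducedMap_vec, Matrix.mulVec_zero, Matrix.mulVec_zero,
    Matrix.mulVec_zero] at h
  exact AddMonoidAlgebra.single_right_injective h

theorem polyMap_one (p : Heis ι) : polyMap (1 : Matrix ι ι ℚ) p = p := by
  have : polyMap (1 : Matrix ι ι ℚ) = AlgHom.id ℂ _ := by
    refine MvPolynomial.algHom_ext fun x => ?_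
    rw [polyMap_X, Finset.sum_eq_single x.1]
    · simp
    · intro k _ hk
      simp [Matrix.one_apply_ne hk]
    · simp
  rw [this]; rfl

theorem inducedMap_one (u : Fock ι) : inducedMap (1 : Matrix ι ι ℚ) u = u := by
  induction u using fock_induction with
  | h0 => simp
  | hadd u v h h' => simp only [map_add, h, h']
  | hvec β p => rw [inducedMap_vec, Matrix.one_mulVec, polyMap_one]

theorem polyMap_zero_X (x : ι × ℕ) : polyMap (0 : Matrix κ ι ℚ) (MvPolynomial.X x) = 0 := by
  rw [polyMap_X]
  simp

theorem comulPoly_left {A : Matrix υ ι ℚ} {C : Matrix ι υ ℚ} {D : Matrix κ υ ℚ} (hC : C * A = 1)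
    (hD : D * A = 0) (p : Heis ι) : comulPoly C D (polyMap A p) = vec 0 p ⊗ₜ 1 := by
  have : (comulPoly C D).comp (polyMap A) =
      (Algebra.TensorProduct.includeLeft : Fock ι →ₐ[ℂ] Fock ι ⊗[ℂ] Fock κ).comp
        (AddMonoidAlgebra.singleZeroAlgHom : Heis ι →ₐ[ℂ] Fock ι) := by
    refine MvPolynomial.algHom_ext fun x => ?_
    rw [AlgHom.comp_apply, polyMap_X, comulPoly_linear, ← polyMap_X, polyMap_polyMap,
      polyMap_polyMap, hC, hD, polyMap_one, polyMap_zero_X, vec_zero, TensorProduct.tmul_zero,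
      add_zero]
    rfl
  exact congrArg (fun f => f p) this

theorem comulPoly_right {B : Matrix υ κ ℚ} {C : Matrix ι υ ℚ} {D : Matrix κ υ ℚ} (hC : C * B = 0)
    (hD : D * B = 1) (p : Heis κ) : comulPoly C D (polyMap B p) = 1 ⊗ₜ vec 0 p := by
  have : (comulPoly C D).comp (polyMap B) =
      (Algebra.TensorProduct.includeRight : Fock κ →ₐ[ℂ] Fock ι ⊗[ℂ] Fock κ).comp
        (AddMonoidAlgebra.singleZeroAlgHom : Heis κ →ₐ[ℂ] Fock κ) := by
    refine MvPolynomial.algHom_ext fun x => ?_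
    rw [AlgHom.comp_apply, polyMap_X, comulPoly_linear, ← polyMap_X, polyMap_polyMap,
      polyMap_polyMap, hC, hD, polyMap_one, polyMap_zero_X, vec_zero, TensorProduct.zero_tmul,
      zero_add]
    rfl
  exact congrArg (fun f => f p) this

/-- `A` and `B` are complementary inclusions, with projections `C` and `D`. -/
structure IsSplit (A : Matrix υ ι ℚ) (B : Matrix υ κ ℚ) (C : Matrix ι υ ℚ) (D : Matrix κ υ ℚ) :
    Prop where
  CA : C * A = 1
  CB : C * B = 0
  DA : D * A = 0
  DB : D * B = 1
  sum : A * C + B * D = 1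

/-- Multiplication of the two images has a left inverse: the coproduct of the Hopf-like algebra
`M(1) ⊗ ℂ[ℚ ⊗ L]`, followed by the projections `C` and `D`. -/
theorem comul_mul {A : Matrix υ ι ℚ} {B : Matrix υ κ ℚ} {C : Matrix ι υ ℚ} {D : Matrix κ υ ℚ}
    (h : IsSplit A B C D) (u : Fock ι) (w : Fock κ) :
    comul C D (inducedMap A u * inducedMap B w) = u ⊗ₜ w := by
  induction u using fock_induction with
  | h0 => simp
  | hadd u u' hu hu' => rw [map_add, add_mul, map_add, hu, hu', TensorProduct.add_tmul]
  | hvec β p =>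
  induction w using fock_induction with
  | h0 => simp
  | hadd u u' hu hu' => rw [map_add, mul_add, map_add, hu, hu', TensorProduct.tmul_add]
  | hvec γ q =>
    rw [inducedMap_vec, inducedMap_vec, vec_mul_vec, comul_vec, map_mul, comulPoly_left h.CA h.DA,
      comulPoly_right h.CB h.DB, Matrix.mulVec_add, Matrix.mulVec_add, Matrix.mulVec_mulVec,
      Matrix.mulVec_mulVec, Matrix.mulVec_mulVec, Matrix.mulVec_mulVec, h.CA, h.CB, h.DA, h.DB,
      Matrix.one_mulVec, Matrix.one_mulVec, Matrix.zero_mulVec, Matrix.zero_mulVec, add_zero,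
      zero_add, Algebra.TensorProduct.tmul_mul_tmul, Algebra.TensorProduct.tmul_mul_tmul, mul_one,
      one_mul, vec_mul_vec, vec_mul_vec, zero_add, zero_add, mul_one, mul_one]

theorem flat_submodule {M : Type*} [AddCommGroup M] [Module ℂ M] (W : Submodule ℂ M) :
    Module.Flat ℂ W := inferInstance

instance flat_of_fock (W : Submodule ℂ (Fock κ)) : Module.Flat ℂ W :=
  flat_submodule (M := Fock κ) W

instance flat_fock : Module.Flat ℂ (Fock κ) :=
  .of_linearEquiv (Submodule.topEquiv (R := ℂ) (M := Fock κ)).symm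

/-- For the full Fock spaces `comul` is a left inverse. For subspaces one also needs that tensoring
inclusions over a field keeps them injective, which is where flatness enters. -/
theorem tensorMap_injective {A : Matrix υ ι ℚ} {B : Matrix υ κ ℚ} {C : Matrix ι υ ℚ}
    {D : Matrix κ υ ℚ} (h : IsSplit A B C D) (U : Submodule ℂ (Fock ι))
    (W : Submodule ℂ (Fock κ)) : Function.Injective (tensorMap A B U W) := by
  have h1 : ∀ x, comul C D (tensorMap A B U W x) = TensorProduct.map U.subtype W.subtype x := by
    intro x
    induction x using TensorProduct.induction_on with
    | zero => simp
    | add x y hx hy => rw [map_add, map_add, map_add, hx, hy]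
    | tmul u w => rw [tensorMap_tmul, comul_mul h]; rfl
  have h2 : Function.Injective (TensorProduct.map U.subtype W.subtype) :=
    TensorProduct.map_injective_of_flat_flat _ _ U.injective_subtype W.injective_subtype
  intro x y hxy
  exact h2 (by rw [← h1, ← h1, hxy])

/-- Each variable is the sum of its two projections, since `A C + B D = 1`, so it lies in the
subalgebra generated by the two images. -/
theorem productMap_polyMap_surjective {A : Matrix υ ι ℚ} {B : Matrix υ κ ℚ} {C : Matrix ι υ ℚ}
    {D : Matrix κ υ ℚ} (h : A * C + B * D = 1) :
    Function.Surjective (Algebra.TensorProduct.productMap (polyMap A) (polyMap B)) := by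
  have hX : ∀ x, MvPolynomial.X x ∈ (Algebra.TensorProduct.productMap (polyMap A) (polyMap B)).range := by
    intro x
    refine ⟨polyMap C (MvPolynomial.X x) ⊗ₜ 1 + 1 ⊗ₜ polyMap D (MvPolynomial.X x), ?_⟩
    change Algebra.TensorProduct.productMap (polyMap A) (polyMap B) _ = _
    rw [map_add, Algebra.TensorProduct.productMap_apply_tmul,
      Algebra.TensorProduct.productMap_apply_tmul, map_one, map_one, mul_one, one_mul,
      polyMap_polyMap, polyMap_polyMap]
    conv_rhs => rw [← polyMap_one (MvPolynomial.X x), ← h]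
    rw [polyMap_X, polyMap_X, polyMap_X, ← Finset.sum_add_distrib]
    simp [add_mul]
  intro p
  change p ∈ (Algebra.TensorProduct.productMap (polyMap A) (polyMap B)).range
  induction p using MvPolynomial.induction_on with
  | C c => exact Subalgebra.algebraMap_mem _ c
  | add p q hp hq => exact add_mem hp hq
  | mul_X p x hp => exact mul_mem hp (hX x)

theorem range_tensorMap {A : Matrix υ ι ℚ} {B : Matrix υ κ ℚ} {C : Matrix ι υ ℚ}
    {D : Matrix κ υ ℚ} (h : A * C + B * D = 1) {X : Set (ι → ℚ)} {Y : Set (κ → ℚ)}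
    {Z : Set (υ → ℚ)} (hZ : ∀ δ, δ ∈ Z ↔ ∃ β ∈ X, ∃ γ ∈ Y, δ = A.mulVec β + B.mulVec γ) :
    LinearMap.range (tensorMap A B (V X) (V Y)) = V Z := by
  apply le_antisymm
  · rintro _ ⟨x, rfl⟩
    induction x using TensorProduct.induction_on with
    | zero => rw [map_zero]; exact zero_mem _
    | add x y hx hy => rw [map_add]; exact add_mem hx hy
    | tmul u w =>
      obtain ⟨u, hu⟩ := u
      obtain ⟨w, hw⟩ := w
      rw [tensorMap_tmul]
      dsimp only
      induction hu using V_induction with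
      | h0 => rw [map_zero, zero_mul]; exact zero_mem _
      | hadd u v _ _ h h' => rw [map_add, add_mul]; exact add_mem h h'
      | hvec β hβ p =>
      induction hw using V_induction with
      | h0 => rw [map_zero, mul_zero]; exact zero_mem _
      | hadd u v _ _ h h' => rw [map_add, mul_add]; exact add_mem h h'
      | hvec γ hγ q =>
        rw [inducedMap_vec, inducedMap_vec, vec_mul_vec]
        exact vec_mem_V ((hZ _).2 ⟨β, hβ, γ, hγ, rfl⟩) _
  · intro z hz
    induction hz using V_induction with
    | h0 => exact zero_mem _
    | hadd u v _ _ h h' => exact add_mem h h'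
    | hvec δ hδ r =>
      obtain ⟨β, hβ, γ, hγ, rfl⟩ := (hZ δ).1 hδ
      obtain ⟨t, rfl⟩ := productMap_polyMap_surjective h r
      induction t using TensorProduct.induction_on with
      | zero => rw [map_zero, vec_zero]; exact zero_mem _
      | add x y hx hy => rw [map_add, vec_add]; exact add_mem hx hy
      | tmul p q =>
        refine ⟨(⟨vec β p, vec_mem_V hβ p⟩ : V X) ⊗ₜ (⟨vec γ q, vec_mem_V hγ q⟩ : V Y), ?_⟩
        rw [tensorMap_tmul, inducedMap_vec, inducedMap_vec, vec_mul_vec,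
          Algebra.TensorProduct.productMap_apply_tmul]

theorem isTensorModule_V {A : Matrix υ ι ℚ} {B : Matrix υ κ ℚ} {C : Matrix ι υ ℚ}
    {D : Matrix κ υ ℚ} (h : IsSplit A B C D) {G : Matrix ι ι ℚ} {H : Matrix κ κ ℚ}
    {K : Matrix υ υ ℚ} (hA : A.transpose * K * A = G) (hB : B.transpose * K * B = H)
    (hAB : A.transpose * K * B = 0) (hBA : B.transpose * K * A = 0)
    {X Y : Set (ι → ℚ)} {X' Y' : Set (κ → ℚ)} {Z : Set (υ → ℚ)}
    (hadd : ∀ β ∈ X, ∀ γ ∈ Y, β + γ ∈ Y) (hadd' : ∀ β ∈ X', ∀ γ ∈ Y', β + γ ∈ Y')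
    (hXY : ∀ β ∈ X, ∀ γ ∈ Y, ∃ r : ℤ, pairing G β γ = r)
    (hXY' : ∀ β ∈ X', ∀ γ ∈ Y', ∃ r : ℤ, pairing H β γ = r)
    (hZ : ∀ δ, δ ∈ Z ↔ ∃ β ∈ Y, ∃ γ ∈ Y', δ = A.mulVec β + B.mulVec γ) :
    IsTensorModule G H K A B (V X) (V Y) (V X') (V Y') (V Z) where
  injective := tensorMap_injective h _ _
  range_eq := range_tensorMap h.sum hZ
  left_mem _ _ hu _ hw := mode_mem_V hadd G _ hu hw
  right_mem _ _ hu _ hw := mode_mem_V hadd' H _ hu hw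
  finite_support _ _ _ _ _ _ _ _ _ := finite_support_tensor _ _ _ _ _ _ _ _ _
  mode_eq _ _ hu _ hu' _ hw _ hw' := mode_tensor hA hB hAB hBA hXY hXY' _ hu hw hu' hw'

end Tensor

/-! ### Automorphisms of the form `f ⊗ g` -/

section TensorAut

variable {ι κ υ : Type} [Fintype ι] [DecidableEq ι] [Fintype κ] [DecidableEq κ] [Fintype υ]
  [DecidableEq υ] {A : Matrix υ ι ℚ} {B : Matrix υ κ ℚ} {G : Matrix ι ι ℚ} {H : Matrix κ κ ℚ}
  {K : Matrix υ υ ℚ} {U : Submodule ℂ (Fock ι)} {U' : Submodule ℂ (Fock κ)}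
  {Z : Submodule ℂ (Fock υ)}

/-- `f` preserves all products. -/
def IsModeHom (G : Matrix ι ι ℚ) (f : U →ₗ[ℂ] U) : Prop :=
  ∀ (n : ℤ) (u v w : U), (w : Fock ι) = mode G n u v → (f w : Fock ι) = mode G n (f u) (f v)

/-- The identification of `U ⊗ U'` with a subspace of a larger Fock space. -/
def tensorEquiv (hi : Function.Injective (tensorMap A B U U'))
    (hr : LinearMap.range (tensorMap A B U U') = Z) : U ⊗[ℂ] U' ≃ₗ[ℂ] Z :=
  (LinearEquiv.ofInjective _ hi).trans (LinearEquiv.ofEq _ _ hr)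

/-- The automorphism `f ⊗ g`. -/
def tensorAut (hi : Function.Injective (tensorMap A B U U'))
    (hr : LinearMap.range (tensorMap A B U U') = Z) (f : U ≃ₗ[ℂ] U) (g : U' ≃ₗ[ℂ] U') :
    Z ≃ₗ[ℂ] Z :=
  (tensorEquiv hi hr).symm.trans ((TensorProduct.congr f g).trans (tensorEquiv hi hr))

variable (hi : Function.Injective (tensorMap A B U U'))
  (hr : LinearMap.range (tensorMap A B U U') = Z) (f : U ≃ₗ[ℂ] U) (g : U' ≃ₗ[ℂ] U')

theorem tensorAut_tensorEquiv (x : U ⊗[ℂ] U') :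
    tensorAut hi hr f g (tensorEquiv hi hr x) = tensorEquiv hi hr (TensorProduct.congr f g x) := by
  simp [tensorAut]

theorem tensorAut_apply {u : U} {u' : U'} {z : Z}
    (hz : (z : Fock υ) = inducedMap A (u : Fock ι) * inducedMap B (u' : Fock κ)) :
    (tensorAut hi hr f g z : Fock υ) =
      inducedMap A (f u : Fock ι) * inducedMap B (g u' : Fock κ) := by
  rw [show z = tensorEquiv hi hr (u ⊗ₜ u') from Subtype.ext hz, tensorAut_tensorEquiv]
  rfl

/-- A mode of a product of pure tensors is a finite sum of tensors of modes. The map `f ⊗ g` acts on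
each summand separately, and finiteness allows it to pass through the sum. -/
theorem isModeHom_tensorAut (h : IsTensorModule G H K A B U U U' U' Z)
    (hZ : ∀ n, ∀ u ∈ Z, ∀ v ∈ Z, mode K n u v ∈ Z) (hf : IsModeHom G f.toLinearMap)
    (hg : IsModeHom H g.toLinearMap) :
    IsModeHom K (tensorAut h.injective h.range_eq f g).toLinearMap := by
  set T := tensorEquiv h.injective h.range_eq
  set F := tensorAut h.injective h.range_eq f g
  have key : ∀ (n : ℤ) (x y : U ⊗[ℂ] U'),
      (F ⟨mode K n (T x) (T y), hZ n _ (T x).2 _ (T y).2⟩ : Fock υ) =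
        mode K n (F (T x)) (F (T y)) := by
    intro n x y
    induction x using TensorProduct.induction_on with
    | zero =>
      have : (⟨mode K n (T 0) (T y), hZ n _ (T 0).2 _ (T y).2⟩ : Z) = 0 :=
        Subtype.ext (by rw [map_zero]; exact mode_zero_left K n (T y : Fock υ))
      rw [this, map_zero, map_zero, map_zero]
      exact (mode_zero_left K n (F (T y) : Fock υ)).symm
    | add x x' hx hx' =>
      have : (⟨mode K n (T (x + x')) (T y), hZ n _ (T (x + x')).2 _ (T y).2⟩ : Z) =
          ⟨mode K n (T x) (T y), hZ n _ (T x).2 _ (T y).2⟩ +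
            ⟨mode K n (T x') (T y), hZ n _ (T x').2 _ (T y).2⟩ :=
        Subtype.ext (by rw [map_add]; exact mode_add_left _ _ _ _ _)
      rw [this, map_add, map_add, map_add, Submodule.coe_add, Submodule.coe_add, mode_add_left, hx,
        hx']
    | tmul u u' =>
    induction y using TensorProduct.induction_on with
    | zero =>
      have : (⟨mode K n (T (u ⊗ₜ u')) (T 0), hZ n _ (T (u ⊗ₜ u')).2 _ (T 0).2⟩ : Z) = 0 :=
        Subtype.ext (by rw [map_zero]; exact mode_zero_right K n (T (u ⊗ₜ u') : Fock υ))
      rw [this, map_zero, map_zero, map_zero]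
      exact (mode_zero_right K n (F (T (u ⊗ₜ u')) : Fock υ)).symm
    | add x x' hx hx' =>
      have : (⟨mode K n (T (u ⊗ₜ u')) (T (x + x')), hZ n _ (T (u ⊗ₜ u')).2 _ (T (x + x')).2⟩ : Z) =
          ⟨mode K n (T (u ⊗ₜ u')) (T x), hZ n _ (T (u ⊗ₜ u')).2 _ (T x).2⟩ +
            ⟨mode K n (T (u ⊗ₜ u')) (T x'), hZ n _ (T (u ⊗ₜ u')).2 _ (T x').2⟩ :=
        Subtype.ext (by rw [map_add]; exact mode_add_right _ _ _ _ _)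
      rw [this, map_add, map_add, map_add, Submodule.coe_add, Submodule.coe_add, mode_add_right, hx,
        hx']
    | tmul w w' =>
      let t : ℤ → Z := fun i => T ((⟨mode G i u w, h.left_mem i _ u.2 _ w.2⟩ : U) ⊗ₜ[ℂ]
        (⟨mode H (n - 1 - i) u' w', h.right_mem _ _ u'.2 _ w'.2⟩ : U'))
      have ht : (Function.support t).Finite := by
        refine (h.finite_support n _ u.2 _ u'.2 _ w.2 _ w'.2).subset fun i hi hc => hi ?_
        exact Subtype.ext hc
      have h1 : (⟨mode K n (T (u ⊗ₜ u')) (T (w ⊗ₜ w')), hZ n _ (T (u ⊗ₜ u')).2 _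
          (T (w ⊗ₜ w')).2⟩ : Z) = ∑ᶠ i, t i := by
        refine Subtype.ext ?_
        refine (h.mode_eq n _ u.2 _ u'.2 _ w.2 _ w'.2).trans ?_
        exact (Z.subtype.toAddMonoidHom.map_finsum ht).symm
      have h2 : ∀ (u : U) (u' : U'), (F (T (u ⊗ₜ u')) : Fock υ) =
          inducedMap A (f u : Fock ι) * inducedMap B (g u' : Fock κ) :=
        fun u u' => tensorAut_apply _ _ f g rfl
      rw [h1, h2, h2, h.mode_eq n _ (f u).2 _ (g u').2 _ (f w).2 _ (g w').2]
      refine ((Z.subtype ∘ₗ F.toLinearMap).toAddMonoidHom.map_finsum ht).trans ?_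
      refine finsum_congr fun i => ?_
      refine (h2 _ _).trans ?_
      have e1 := hf i u w ⟨mode G i u w, h.left_mem i _ u.2 _ w.2⟩ rfl
      have e2 := hg (n - 1 - i) u' w' ⟨mode H (n - 1 - i) u' w', h.right_mem _ _ u'.2 _ w'.2⟩ rfl
      rw [LinearEquiv.coe_coe] at e1 e2
      rw [e1, e2]
  intro n u v w hw
  obtain ⟨x, rfl⟩ := T.surjective u
  obtain ⟨y, rfl⟩ := T.surjective v
  rw [show w = ⟨mode K n (T x) (T y), hZ n _ (T x).2 _ (T y).2⟩ from Subtype.ext hw]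
  exact key n x y

theorem IsTensorModule.mul_mem {W : Submodule ℂ (Fock ι)} {W' : Submodule ℂ (Fock κ)}
    (h : IsTensorModule G H K A B U W U' W' Z) {u : Fock ι} {u' : Fock κ} (hu : u ∈ W)
    (hu' : u' ∈ W') : inducedMap A u * inducedMap B u' ∈ Z := by
  rw [← h.range_eq]
  exact ⟨(⟨u, hu⟩ : W) ⊗ₜ[ℂ] (⟨u', hu'⟩ : W'), tensorMap_tmul _ _ _ _ _ _⟩

end TensorAut

/-! ### `V_L` as a threefold tensor product, and `τ` -/

section Cube

/-- The inclusions of the first two summands of `ℤα₁ ⊕ ℤα₂ ⊕ ℤα₃`. -/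
def inclTwo : Matrix (Fin 3) (Fin 2) ℚ := !![1, 0; 0, 1; 0, 0]

/-- The first inclusion `ℤα → ℤα₁ ⊕ ℤα₂`. -/
def inclFst : Matrix (Fin 2) (Fin 1) ℚ := !![1; 0]

/-- The second inclusion `ℤα → ℤα₁ ⊕ ℤα₂`. -/
def inclSnd : Matrix (Fin 2) (Fin 1) ℚ := !![0; 1]

theorem inclA1_eq : inclA1 0 = inclTwo * inclFst ∧ inclA1 1 = inclTwo * inclSnd ∧
    inclA1 2 = !![0; 0; 1] := by
  refine ⟨?_, ?_, ?_⟩ <;>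
  · ext i j
    fin_cases i <;> fin_cases j <;> simp [inclA1, inclTwo, inclFst, inclSnd, Matrix.mul_apply]

theorem isSplit_two : IsSplit inclFst inclSnd inclFst.transpose inclSnd.transpose := by
  constructor <;>
  · ext i j
    fin_cases i <;> fin_cases j <;>
      simp [inclFst, inclSnd, Matrix.mul_apply, Matrix.vecMul, dotProduct, Matrix.transpose_apply]

theorem isSplit_three : IsSplit inclTwo (inclA1 2) inclTwo.transpose (inclA1 2).transpose := by
  rw [inclA1_eq.2.2]
  constructor <;>
  · ext i j
    fin_cases i <;> fin_cases j <;>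
      simp [inclTwo, Matrix.mul_apply, Fin.sum_univ_succ, Matrix.vecMul, dotProduct,
        Matrix.transpose_apply]

theorem exists_pairing_eq {ι : Type} [Fintype ι] [DecidableEq ι] {G : Matrix ι ι ℚ}
    (hG : ∀ i j, ∃ m : ℤ, G i j = m) {β γ : ι → ℚ} (hβ : β ∈ intLattice ι)
    (hγ : γ ∈ intLattice ι) : ∃ r : ℤ, pairing G β γ = r := by
  obtain ⟨k, rfl⟩ := mem_intLattice.1 hβ
  obtain ⟨l, rfl⟩ := mem_intLattice.1 hγ
  choose m hm using hG
  refine ⟨∑ i, k i * ∑ j, m i j * l j, ?_⟩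
  simp [pairing, dotProduct, Matrix.mulVec, hm]

theorem isTensorModule_intLattice {ι κ υ : Type} [Fintype ι] [DecidableEq ι] [Fintype κ]
    [DecidableEq κ] [Fintype υ] [DecidableEq υ] {A : Matrix υ ι ℚ} {B : Matrix υ κ ℚ}
    {C : Matrix ι υ ℚ} {D : Matrix κ υ ℚ} (h : IsSplit A B C D) {G : Matrix ι ι ℚ}
    {H : Matrix κ κ ℚ} {K : Matrix υ υ ℚ} (hA : A.transpose * K * A = G)
    (hB : B.transpose * K * B = H) (hAB : A.transpose * K * B = 0) (hBA : B.transpose * K * A = 0)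
    (hG : ∀ i j, ∃ m : ℤ, G i j = m) (hH : ∀ i j, ∃ m : ℤ, H i j = m) {Z : Set (υ → ℚ)}
    (hZ : ∀ δ, δ ∈ Z ↔ ∃ β ∈ (intLattice ι : Set (ι → ℚ)), ∃ γ ∈ (intLattice κ : Set (κ → ℚ)),
      δ = A.mulVec β + B.mulVec γ) :
    IsTensorModule G H K A B (V (intLattice ι)) (V (intLattice ι)) (V (intLattice κ))
      (V (intLattice κ)) (V Z) :=
  isTensorModule_V h hA hB hAB hBA (fun _ hβ _ hγ => add_mem hβ hγ)
    (fun _ hβ _ hγ => add_mem hβ hγ) (fun _ hβ _ hγ => exists_pairing_eq hG hβ hγ)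
    (fun _ hβ _ hγ => exists_pairing_eq hH hβ hγ) hZ

/-- Gram matrix of `ℤα₁ ⊕ ℤα₂`. -/
def gramTwo : Matrix (Fin 2) (Fin 2) ℚ := (2 : ℚ) • 1

theorem isTensorModule_two : IsTensorModule gramA1 gramA1 gramTwo inclFst inclSnd V1 V1 V1 V1
    (V (intLattice (Fin 2))) := by
  refine isTensorModule_intLattice isSplit_two ?_ ?_ ?_ ?_ ?_ ?_ ?_
  any_goals
    ext i j
    fin_cases i; fin_cases j
    simp [gramTwo, inclFst, inclSnd, gramA1, Matrix.mul_apply]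
  any_goals exact fun i j => ⟨2, by fin_cases i; fin_cases j; simp [gramA1]⟩
  intro δ
  rw [SetLike.mem_coe, mem_intLattice]
  constructor
  · rintro ⟨k, rfl⟩
    refine ⟨_, mem_intLattice_one.2 ⟨k 0, rfl⟩, _, mem_intLattice_one.2 ⟨k 1, rfl⟩, ?_⟩
    funext i
    fin_cases i <;> simp [inclFst, inclSnd, dotProduct]
  · rintro ⟨β, hβ, γ, hγ, rfl⟩
    obtain ⟨k, rfl⟩ := mem_intLattice_one.1 hβ
    obtain ⟨l, rfl⟩ := mem_intLattice_one.1 hγ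
    refine ⟨![k, l], ?_⟩
    funext i
    fin_cases i <;> simp [inclFst, inclSnd, dotProduct]

theorem isTensorModule_three : IsTensorModule gramTwo gramA1 gramL inclTwo (inclA1 2)
    (V (intLattice (Fin 2))) (V (intLattice (Fin 2))) V1 V1 VL := by
  refine isTensorModule_intLattice isSplit_three ?_ ?_ ?_ ?_ ?_ ?_ ?_
  any_goals rw [inclA1_eq.2.2]
  any_goals
    ext i j
    fin_cases i <;> fin_cases j <;>
    simp [gramTwo, gramL, inclTwo, gramA1, Matrix.mul_apply, Fin.sum_univ_succ]
  · exact fun i j => ⟨if i = j then 2 else 0, by simp [gramTwo, Matrix.one_apply]⟩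
  · exact fun i j => ⟨2, by fin_cases i; fin_cases j; simp [gramA1]⟩
  intro δ
  rw [SetLike.mem_coe, mem_intLattice]
  constructor
  · rintro ⟨k, rfl⟩
    refine ⟨_, mem_intLattice.2 ⟨![k 0, k 1], rfl⟩, _, mem_intLattice_one.2 ⟨k 2, rfl⟩, ?_⟩
    funext i
    fin_cases i <;> simp [inclTwo, dotProduct, Fin.sum_univ_succ]
  · rintro ⟨β, hβ, γ, hγ, rfl⟩
    obtain ⟨k, rfl⟩ := mem_intLattice.1 hβ
    obtain ⟨l, rfl⟩ := mem_intLattice_one.1 hγ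
    refine ⟨![k 0, k 1, l], ?_⟩
    funext i
    fin_cases i <;> simp [inclTwo, dotProduct, Fin.sum_univ_succ]

theorem tensorCube_eq (u v w : Fock (Fin 1)) : tensorCube u v w =
    inducedMap inclTwo (inducedMap inclFst u * inducedMap inclSnd v) *
      inducedMap (inclA1 2) w := by
  rw [tensorCube, map_mul, inducedMap_comp, inducedMap_comp, inclA1_eq.1, inclA1_eq.2.1]

theorem tensorCube_mem {u v w : Fock (Fin 1)} (hu : u ∈ V1) (hv : v ∈ V1) (hw : w ∈ V1) :
    tensorCube u v w ∈ VL := by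
  rw [tensorCube_eq]
  exact isTensorModule_three.mul_mem (isTensorModule_two.mul_mem hu hv) hw

/-- Pure tensors span, through the two-step identification `(V ⊗ V) ⊗ V`. Uniqueness of `τ` and all
identities for it reduce to this. -/
theorem VL_le_of_tensorCube_mem {W : Submodule ℂ (Fock (Fin 3))}
    (hW : ∀ u v w : V1, tensorCube u v w ∈ W) : VL ≤ W := by
  rw [← isTensorModule_three.range_eq]
  rintro _ ⟨x, rfl⟩
  induction x using TensorProduct.induction_on with
  | zero => rw [map_zero]; exact zero_mem _
  | add x y hx hy => rw [map_add]; exact add_mem hx hy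
  | tmul z w =>
    rw [tensorMap_tmul]
    obtain ⟨z, hz⟩ := z
    rw [← isTensorModule_two.range_eq] at hz
    obtain ⟨y, rfl⟩ := hz
    dsimp only
    clear hz
    induction y using TensorProduct.induction_on with
    | zero => rw [map_zero, map_zero, zero_mul]; exact zero_mem _
    | add x y hx hy => rw [map_add, map_add, add_mul]; exact add_mem hx hy
    | tmul u v =>
      have := hW u v w
      rwa [tensorCube_eq] at this

/-- `σ ⊗ σ ⊗ σ`. -/
def cubeAut (σ : V1 ≃ₗ[ℂ] V1) : VL ≃ₗ[ℂ] VL :=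
  tensorAut isTensorModule_three.injective isTensorModule_three.range_eq
    (tensorAut isTensorModule_two.injective isTensorModule_two.range_eq σ σ) σ

theorem coe_cubeAut (σ : V1 ≃ₗ[ℂ] V1) {u v w : V1} {x : VL}
    (hx : (x : Fock (Fin 3)) = tensorCube u v w) :
    (cubeAut σ x : Fock (Fin 3)) = tensorCube (σ u) (σ v) (σ w) := by
  have h1 : inducedMap inclFst (u : Fock (Fin 1)) * inducedMap inclSnd (v : Fock (Fin 1)) ∈
      V (intLattice (Fin 2)) := isTensorModule_two.mul_mem u.2 v.2
  rw [cubeAut, tensorAut_apply _ _ _ _ (u := ⟨_, h1⟩) (hx.trans (tensorCube_eq _ _ _)),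
    tensorAut_apply _ _ _ _ rfl, tensorCube_eq]

theorem isCube_cubeAut (σ : V1 ≃ₗ[ℂ] V1) : IsCube σ (cubeAut σ) :=
  fun u v w => ⟨⟨_, tensorCube_mem u.2 v.2 w.2⟩, rfl, coe_cubeAut σ rfl⟩

theorem VL_linearMap_ext {M : Type*} [AddCommMonoid M] [Module ℂ M] {f g : VL →ₗ[ℂ] M}
    (h : ∀ (u v w : V1) (x : VL), (x : Fock (Fin 3)) = tensorCube u v w → f x = g x) : f = g := by
  have key : VL ≤ (LinearMap.eqLocus f g).map VL.subtype :=
    VL_le_of_tensorCube_mem fun u v w =>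
      ⟨⟨_, tensorCube_mem u.2 v.2 w.2⟩, h u v w _ rfl, rfl⟩
  refine LinearMap.ext fun x => ?_
  obtain ⟨y, hy, hxy⟩ := key x.2
  rwa [← Subtype.ext (a1 := y) (a2 := x) hxy]

theorem IsCube.eq_cubeAut {σ : V1 ≃ₗ[ℂ] V1} {τ : VL ≃ₗ[ℂ] VL} (h : IsCube σ τ) :
    τ = cubeAut σ := by
  refine LinearEquiv.toLinearMap_injective (VL_linearMap_ext fun u v w x hx => ?_)
  obtain ⟨y, hy, hτ⟩ := h u v w
  rw [show x = y from Subtype.ext (hx.trans hy.symm)]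
  exact Subtype.ext (hτ.trans (coe_cubeAut σ hy).symm)

end Cube

/-! ### The sign character and its fixed vectors -/

section SignChar

variable {ι κ : Type} [Fintype ι] [DecidableEq ι] [Fintype κ] [DecidableEq κ]

/-- The character `β ↦ (-1)^(∑ β_i)`. -/
def signChar (β : ι → ℚ) : ℂ := Complex.exp (((∑ i, β i : ℚ) : ℂ) * (Real.pi * Complex.I))

theorem signChar_add (β γ : ι → ℚ) : signChar (β + γ) = signChar β * signChar γ := by
  rw [signChar, signChar, signChar, ← Complex.exp_add, ← add_mul]
  simp only [Pi.add_apply, Finset.sum_add_distrib, Rat.cast_add]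

theorem signChar_zero : signChar (0 : ι → ℚ) = 1 := by simp [signChar]

theorem signChar_eq_one_iff {k : ι → ℤ} :
    signChar (fun i => (k i : ℚ)) = 1 ↔ Even (∑ i, k i) := by
  have hpi : (Real.pi : ℂ) * Complex.I ≠ 0 :=
    mul_ne_zero (by exact_mod_cast Real.pi_ne_zero) Complex.I_ne_zero
  rw [signChar, Complex.exp_eq_one_iff]
  constructor
  · rintro ⟨n, hn⟩
    rw [show (n : ℂ) * (2 * Real.pi * Complex.I) = (n * 2 : ℂ) * (Real.pi * Complex.I) by ring] at hn
    have := mul_right_cancel₀ hpi hn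
    push_cast at this
    exact ⟨n, by rw [← mul_two]; exact_mod_cast this⟩
  · rintro ⟨n, hn⟩
    refine ⟨n, ?_⟩
    have : ((∑ i, (k i : ℚ) : ℚ) : ℂ) = n * 2 := by
      rw [← Int.cast_sum, hn]
      push_cast
      ring
    rw [this]
    ring

theorem coeff_twist (φ : (ι → ℚ) → ℂ) (u : Fock ι) (β : ι → ℚ) :
    (twist φ u).coeff β = φ β • u.coeff β := by
  induction u using fock_induction with
  | h0 => simp
  | hadd u v h h' => rw [map_add, AddMonoidAlgebra.coeff_add, AddMonoidAlgebra.coeff_add,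
      Finsupp.add_apply, Finsupp.add_apply, h, h', smul_add]
  | hvec γ p =>
    rw [twist_vec, AddMonoidAlgebra.coeff_single, AddMonoidAlgebra.coeff_single,
      Finsupp.single_apply, Finsupp.single_apply]
    split_ifs with h
    · rw [h]
    · rw [smul_zero]

theorem twist_eq_self_iff {φ : (ι → ℚ) → ℂ} {u : Fock ι} :
    twist φ u = u ↔ ∀ β, u.coeff β ≠ 0 → φ β = 1 := by
  constructor
  · intro h β hβ
    have h1 := coeff_twist φ u β
    rw [h] at h1
    have h2 : (φ β - 1) • u.coeff β = 0 := by rw [sub_smul, one_smul, ← h1, sub_self]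
    rcases smul_eq_zero.1 h2 with h3 | h3
    · exact sub_eq_zero.1 h3
    · exact absurd h3 hβ
  · intro h
    refine AddMonoidAlgebra.coeff_injective (Finsupp.ext fun β => ?_)
    rw [coeff_twist]
    by_cases hβ : u.coeff β = 0
    · rw [hβ, smul_zero]
    · rw [h β hβ, one_smul]

theorem twist_mul {φ : (ι → ℚ) → ℂ} (hφ : ∀ β γ, φ (β + γ) = φ β * φ γ) (u v : Fock ι) :
    twist φ (u * v) = twist φ u * twist φ v := by
  induction u using fock_induction with
  | h0 => simp
  | hadd u u' h h' => simp only [map_add, add_mul, h, h']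
  | hvec β p =>
  induction v using fock_induction with
  | h0 => simp
  | hadd u u' h h' => simp only [map_add, mul_add, h, h']
  | hvec γ q => rw [vec_mul_vec, twist_vec, twist_vec, twist_vec, vec_mul_vec, hφ,
      smul_mul_smul_comm]

theorem twist_inducedMap {A : Matrix κ ι ℚ} {φ : (ι → ℚ) → ℂ} {ψ : (κ → ℚ) → ℂ}
    (h : ∀ β, ψ (A.mulVec β) = φ β) (u : Fock ι) :
    twist ψ (inducedMap A u) = inducedMap A (twist φ u) := by
  induction u using fock_induction with
  | h0 => simp
  | hadd u v h h' => simp only [map_add, h, h']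
  | hvec β p => rw [inducedMap_vec, twist_vec, twist_vec, inducedMap_vec, h, map_smul]

theorem negLift_inducedMap (A : Matrix κ ι ℚ) (u : Fock ι) :
    negLift (inducedMap A u) = inducedMap A (negLift u) := by
  rw [negLift, negLift, inducedMap_comp, inducedMap_comp, Matrix.neg_mul, Matrix.mul_neg,
    Matrix.one_mul, Matrix.mul_one]

end SignChar

/-! ### `τ` carries `V_N` onto `V_L⁺` -/

section Tau

/-- The automorphism `e^{kα} ↦ (-1)^k e^{kα}` of `V_{ℤα}`. -/
def signV1 : V1 →ₗ[ℂ] V1 := (twist signChar).restrict fun _ hu => twist_mem_V _ hu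

theorem signV1_modeV1 (n : ℤ) (u v : V1) :
    signV1 (modeV1 n u v) = modeV1 n (signV1 u) (signV1 v) :=
  Subtype.ext (mode_twist _ signChar_add _ _ _).symm

theorem signV1_of_vec_zero {p : Heis (Fin 1)} {u : V1} (h : (u : Fock (Fin 1)) = vec 0 p) :
    signV1 u = u := by
  refine Subtype.ext ?_
  change twist _ (u : Fock (Fin 1)) = u
  rw [h, twist_vec, signChar_zero, one_smul]

theorem signV1_expV1 {k : ℤ} (hk : signChar (fun _ : Fin 1 => (k : ℚ)) = -1) :
    signV1 (expV1 k) = (-1 : ℂ) • expV1 k := by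
  refine Subtype.ext ?_
  change twist _ (vec _ 1) = (-1 : ℂ) • vec _ 1
  rw [twist_vec, smul_vec, hk]

theorem signV1_expV1_one : signV1 (expV1 1) = (-1 : ℂ) • expV1 1 :=
  signV1_expV1 (by simp [signChar, Complex.exp_pi_mul_I])

theorem signV1_expV1_neg_one : signV1 (expV1 (-1)) = (-1 : ℂ) • expV1 (-1) :=
  signV1_expV1 (by simp [signChar, Complex.exp_neg, Complex.exp_pi_mul_I])

/-- Both sides preserve products, so the generators decide. For instance `α(-1)` is fixed by the
sign twist, and its image `e^α + e^{-α}` is fixed by the lift of `-1`. -/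
theorem negV1_sigma (u : V1) : negV1 (sigma u) = sigma (signV1 u) := by
  have key : negV1 ∘ₗ sigmaLin = sigmaLin ∘ₗ signV1 := by
    refine eq_of_eqOn_generators (fun n u v => ?_) (fun n u v => ?_) ?_ ?_ ?_ ?_
    · simp only [LinearMap.comp_apply, sigmaLin_modeV1, negV1_modeV1]
    · simp only [LinearMap.comp_apply, sigmaLin_modeV1, signV1_modeV1]
    · rw [LinearMap.comp_apply, LinearMap.comp_apply, signV1_of_vec_zero coe_expV1_zero,
        sigmaLin_expV1_zero, negV1_expV1, neg_zero]
    · rw [LinearMap.comp_apply, LinearMap.comp_apply, signV1_expV1_one, map_smul,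
        sigmaLin_expV1_one, map_smul, V1_map_sub, V1_map_sub, negV1_expV1, negV1_expV1,
        negV1_cartanV1, neg_neg]
      module
    · rw [LinearMap.comp_apply, LinearMap.comp_apply, signV1_expV1_neg_one, map_smul,
        sigmaLin_expV1_neg_one, map_smul, V1_map_sub, map_add, negV1_expV1, negV1_expV1,
        negV1_cartanV1, neg_neg]
      module
    · rw [LinearMap.comp_apply, LinearMap.comp_apply, signV1_of_vec_zero rfl, sigmaLin_cartanV1,
        map_add, negV1_expV1, negV1_expV1, neg_neg, add_comm]
  exact LinearMap.congr_fun key u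

theorem isModeHom_sigma : IsModeHom gramA1 sigma.toLinearMap := by
  intro n u v w hw
  rw [show w = modeV1 n u v from Subtype.ext hw]
  exact congrArg Subtype.val (sigmaLin_modeV1 n u v)

theorem isModeHom_cubeAut_sigma : IsModeHom gramL (cubeAut sigma).toLinearMap :=
  isModeHom_tensorAut _ _ isTensorModule_three (fun n _ hu _ hv => mode_mem_lattice _ n hu hv)
    (isModeHom_tensorAut _ _ isTensorModule_two (fun n _ hu _ hv => mode_mem_lattice _ n hu hv)
      isModeHom_sigma isModeHom_sigma) isModeHom_sigma

theorem inducedMap_vacuum {ι κ : Type} [Fintype ι] [DecidableEq ι] [Fintype κ] [DecidableEq κ]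
    (A : Matrix κ ι ℚ) : inducedMap A vacuum = vacuum := by
  rw [vacuum, inducedMap_vec, Matrix.mulVec_zero, map_one]
  rfl

theorem vacuum_eq_one {ι : Type} : (vacuum : Fock ι) = 1 := rfl

theorem tensorCube_vacuum : tensorCube vacuum vacuum vacuum = vacuum := by
  rw [tensorCube, inducedMap_vacuum, inducedMap_vacuum, inducedMap_vacuum, vacuum_eq_one, mul_one,
    mul_one]

theorem polyMap_inclA1_X (i : Fin 3) (m : ℕ) :
    polyMap (inclA1 i) (MvPolynomial.X (0, m)) = MvPolynomial.X (i, m) := by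
  rw [polyMap_X, Finset.sum_eq_single i]
  · simp [inclA1]
  · intro k _ hk
    simp [inclA1, hk]
  · simp

theorem inducedMap_inclA1_virasoro (i : Fin 3) : inducedMap (inclA1 i) (virasoro gramA1) =
    vec 0 (MvPolynomial.C (1 / 4) * (MvPolynomial.X (i, 0) * MvPolynomial.X (i, 0))) := by
  rw [virasoro_gramA1, inducedMap_vec, Matrix.mulVec_zero, map_mul, map_mul, polyMap_inclA1_X,
    ← MvPolynomial.algebraMap_eq, AlgHom.commutes]
  rfl

theorem gramL_inv : gramL⁻¹ = (1 / 2 : ℚ) • 1 := by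
  refine Matrix.inv_eq_left_inv ?_
  rw [gramL, smul_mul_smul_comm, one_mul]
  norm_num

/-- The three summands of `L` are orthogonal, so the Virasoro elements add. Each is fixed by `σ`,
hence the sum by `τ`. -/
theorem virasoro_gramL : virasoro gramL = tensorCube (virasoro gramA1) vacuum vacuum +
    tensorCube vacuum (virasoro gramA1) vacuum + tensorCube vacuum vacuum (virasoro gramA1) := by
  rw [tensorCube, tensorCube, tensorCube]
  simp only [inducedMap_inclA1_virasoro, inducedMap_vacuum]
  rw [vacuum_eq_one, mul_one, mul_one, one_mul, mul_one, one_mul, one_mul, ← vec_add, ← vec_add,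
    virasoro, gramL_inv]
  congr 1
  simp only [Fin.sum_univ_three, Matrix.smul_apply, Matrix.one_apply, Fin.isValue]
  have h : (MvPolynomial.C (1 / 4 : ℂ) : Heis (Fin 3)) =
      MvPolynomial.C (1 / 2) * MvPolynomial.C (1 / 2) := by
    rw [← map_mul]; norm_num
  rw [h]
  simp
  ring

theorem isVOAIso_cubeAut_sigma : IsVOAIso gramL gramL (cubeAut sigma) where
  map_mode n u v := ⟨⟨_, mode_mem_lattice gramL n u.2 v.2⟩, rfl,
    isModeHom_cubeAut_sigma n u v _ rfl⟩
  map_vacuum := by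
    have h : (tensorCube (expV1 0) (expV1 0) (expV1 0) : Fock (Fin 3)) = vacuum := by
      rw [coe_expV1_zero, tensorCube_vacuum]
    refine ⟨⟨_, tensorCube_mem (expV1 0).2 (expV1 0).2 (expV1 0).2⟩, h, ?_⟩
    rw [coe_cubeAut sigma rfl, show sigma (expV1 0) = expV1 0 from sigmaLin_expV1_zero, h]
  map_virasoro := by
    have h0 : sigma (expV1 0) = expV1 0 := sigmaLin_expV1_zero
    have hω : sigma virasoroV1 = virasoroV1 := sigmaLin_virasoroV1
    let x : V1 → V1 → V1 → VL := fun u v w => ⟨_, tensorCube_mem u.2 v.2 w.2⟩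
    have hx : ∀ u v w, (cubeAut sigma (x u v w) : Fock (Fin 3)) =
      tensorCube (sigma u) (sigma v) (sigma w) := fun u v w => coe_cubeAut sigma rfl
    refine ⟨x virasoroV1 (expV1 0) (expV1 0) + x (expV1 0) virasoroV1 (expV1 0) +
      x (expV1 0) (expV1 0) virasoroV1, ?_, ?_⟩
    · rw [virasoro_gramL, ← coe_expV1_zero]
      rfl
    · rw [map_add, map_add, Submodule.coe_add, Submodule.coe_add, hx, hx, hx, h0, hω,
        virasoro_gramL, ← coe_expV1_zero]
      rfl

theorem signChar_inclA1 (i : Fin 3) (β : Fin 1 → ℚ) :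
    signChar ((inclA1 i).mulVec β) = signChar β := by
  rw [signChar, signChar]
  congr 3
  fin_cases i <;> simp [inclA1, Matrix.mulVec, dotProduct]

theorem twist_tensorCube (u v w : Fock (Fin 1)) : twist signChar (tensorCube u v w) =
    tensorCube (twist signChar u) (twist signChar v) (twist signChar w) := by
  simp only [tensorCube, twist_mul signChar_add, twist_inducedMap (signChar_inclA1 _)]

theorem negLift_tensorCube (u v w : Fock (Fin 1)) : negLift (tensorCube u v w) =
    tensorCube (negLift u) (negLift v) (negLift w) := by
  simp only [tensorCube, map_mul, negLift_inducedMap]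

/-- The automorphism `e^β ↦ (-1)^(∑ β_i) e^β` of `V_L`. -/
def signVL : VL →ₗ[ℂ] VL := (twist signChar).restrict fun _ hu => twist_mem_V _ hu

/-- The lift of `-1` on `V_L`. -/
def negVL : VL →ₗ[ℂ] VL :=
  (negLift (ι := Fin 3)).toLinearMap.restrict
    fun _ hu => negLift_mem_V (fun _ hβ => neg_mem hβ) hu

theorem coe_signVL (u : VL) : (signVL u : Fock (Fin 3)) = twist signChar (u : Fock (Fin 3)) := rfl

theorem coe_negVL (u : VL) : (negVL u : Fock (Fin 3)) = negLift (u : Fock (Fin 3)) := rfl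

theorem negVL_cubeAut_sigma (x : VL) :
    negVL (cubeAut sigma x) = cubeAut sigma (signVL x) := by
  have key : negVL ∘ₗ (cubeAut sigma).toLinearMap = (cubeAut sigma).toLinearMap ∘ₗ signVL := by
    refine VL_linearMap_ext fun u v w x hx => Subtype.ext ?_
    have h1 : (signVL x : Fock (Fin 3)) = tensorCube (signV1 u) (signV1 v) (signV1 w) := by
      rw [coe_signVL, hx, twist_tensorCube]
      rfl
    rw [LinearMap.comp_apply, LinearMap.comp_apply, LinearEquiv.coe_coe, coe_cubeAut sigma h1,
      coe_negVL, coe_cubeAut sigma hx, negLift_tensorCube, ← coe_negV1, ← coe_negV1, ← coe_negV1,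
      negV1_sigma, negV1_sigma, negV1_sigma]
  exact LinearMap.congr_fun key x

theorem mem_latN {β : Fin 3 → ℚ} :
    β ∈ latN ↔ ∃ k : Fin 3 → ℤ, β = (fun i => (k i : ℚ)) ∧ Even (∑ i, k i) := by
  constructor
  · intro h
    induction h using AddSubgroup.closure_induction with
    | mem x hx =>
      obtain ⟨i, j, rfl | rfl⟩ := hx
      · refine ⟨Pi.single i 1 + Pi.single j 1, ?_, ?_⟩
        · funext l; simp [Pi.single_apply]
        · simp [Finset.sum_add_distrib]
      · refine ⟨Pi.single i 1 - Pi.single j 1, ?_, ?_⟩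
        · funext l; simp [Pi.single_apply]
        · simp [Finset.sum_sub_distrib]
    | zero => exact ⟨0, by funext; simp, by simp⟩
    | add x y _ _ hx hy =>
      obtain ⟨k, rfl, hk⟩ := hx
      obtain ⟨l, rfl, hl⟩ := hy
      exact ⟨k + l, by funext; simp, by simpa [Finset.sum_add_distrib] using hk.add hl⟩
    | neg x _ hx =>
      obtain ⟨k, rfl, hk⟩ := hx
      exact ⟨-k, by funext; simp, by simpa using hk.neg⟩
  · rintro ⟨k, rfl, m, hm⟩
    -- With `2m` the coordinate sum, `k = m (2α₁) + k₁ (α₂ - α₁) + k₂ (α₃ - α₁)`, where `k₁` and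
    -- `k₂` are the last two coordinates.
    have e : (fun i => (k i : ℚ)) = m • (Pi.single 0 1 + Pi.single 0 1 : Fin 3 → ℚ) +
        k 1 • (Pi.single 1 1 - Pi.single 0 1) + k 2 • (Pi.single 2 1 - Pi.single 0 1) := by
      rw [Fin.sum_univ_three] at hm
      have : (k 0 : ℚ) = m + m - k 1 - k 2 := by
        have : k 0 = m + m - k 1 - k 2 := by omega
        exact_mod_cast this
      funext i
      fin_cases i
      · simp [this]; ring
      · simp
      · simp
    rw [e]
    have hs : ∀ {x}, (∃ i j : Fin 3, x = Pi.single i 1 + Pi.single j 1 ∨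
        x = Pi.single i 1 - Pi.single j 1) → x ∈ latN := fun h => AddSubgroup.subset_closure h
    exact add_mem (add_mem (zsmul_mem (hs ⟨0, 0, Or.inl rfl⟩) _)
      (zsmul_mem (hs ⟨1, 0, Or.inr rfl⟩) _)) (zsmul_mem (hs ⟨2, 0, Or.inr rfl⟩) _)

theorem latN_le : latN ≤ intLattice (Fin 3) := fun β hβ => by
  obtain ⟨k, hk, -⟩ := mem_latN.1 hβ
  exact mem_intLattice.2 ⟨k, hk⟩

theorem VN_le_VL : VN ≤ VL := fun _ hu β hβ => latN_le (hu β hβ)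

theorem mem_VN_iff {u : Fock (Fin 3)} (hu : u ∈ VL) : u ∈ VN ↔ twist signChar u = u := by
  rw [twist_eq_self_iff]
  constructor
  · intro h β hβ
    obtain ⟨k, rfl, hk⟩ := mem_latN.1 (h β hβ)
    exact signChar_eq_one_iff.2 hk
  · intro h β hβ
    obtain ⟨k, rfl⟩ := mem_intLattice.1 (hu β hβ)
    exact mem_latN.2 ⟨k, rfl, signChar_eq_one_iff.1 (h _ hβ)⟩

theorem mem_plus {ι : Type} [Fintype ι] [DecidableEq ι] {U : Submodule ℂ (Fock ι)} {u : Fock ι} :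
    u ∈ plus U ↔ u ∈ U ∧ negLift u = u := Iff.rfl

theorem mem_minus {ι : Type} [Fintype ι] [DecidableEq ι] {U : Submodule ℂ (Fock ι)} {u : Fock ι} :
    u ∈ minus U ↔ u ∈ U ∧ negLift u = -u := Iff.rfl

/-- An invertible map conjugating one operator into another carries the fixed space of the first
onto that of the second; here `V_N` is the fixed space of the sign twist. -/
theorem map_cubeAut_sigma_VN :
    (VN.comap VL.subtype).map (VL.subtype ∘ₗ (cubeAut sigma).toLinearMap) = plus VL := by
  ext x
  rw [Submodule.mem_map, mem_plus]
  constructor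
  · rintro ⟨y, hy, rfl⟩
    have hy' : signVL y = y := Subtype.ext ((mem_VN_iff y.2).1 hy)
    have h := negVL_cubeAut_sigma y
    rw [hy'] at h
    exact ⟨(cubeAut sigma y).2, congrArg Subtype.val h⟩
  · rintro ⟨hx, hx'⟩
    obtain ⟨y, hy⟩ := (cubeAut sigma).surjective ⟨x, hx⟩
    refine ⟨y, ?_, congrArg Subtype.val hy⟩
    have h := negVL_cubeAut_sigma y
    rw [hy, show negVL ⟨x, hx⟩ = ⟨x, hx⟩ from Subtype.ext hx', ← hy] at h
    have h' := (cubeAut sigma).injective h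
    exact (mem_VN_iff y.2).2 (congrArg Subtype.val h').symm

theorem existsUnique_isSigma : ∃! σ : V1 ≃ₗ[ℂ] V1, IsSigma σ :=
  ⟨sigma, isSigma_sigma, fun _ h => h.eq_sigma⟩

theorem IsSigma.cube {σ : V1 ≃ₗ[ℂ] V1} (hσ : IsSigma σ) :
    (∃! τ : VL ≃ₗ[ℂ] VL, IsCube σ τ) ∧
      ∀ τ : VL ≃ₗ[ℂ] VL, IsCube σ τ → IsVOAIso gramL gramL τ ∧
        (VN.comap VL.subtype).map (VL.subtype ∘ₗ τ.toLinearMap) = plus VL := by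
  refine ⟨⟨cubeAut σ, isCube_cubeAut σ, fun _ h => h.eq_cubeAut⟩, fun τ h => ?_⟩
  rw [h.eq_cubeAut, hσ.eq_sigma]
  exact ⟨isVOAIso_cubeAut_sigma, map_cubeAut_sigma_VN⟩

end Tau

/-! ### Virasoro elements and isomorphisms induced by isometries -/

section Quadratic

variable {ι κ : Type} [Fintype ι] [DecidableEq ι] [Fintype κ] [DecidableEq κ]

/-- The vector `½ ∑ M_ij α_i(-1) α_j(-1)`. -/
def quadVec (M : Matrix ι ι ℚ) : Fock ι :=
  vec 0 (MvPolynomial.C (1 / 2 : ℂ) * ∑ i, ∑ j, MvPolynomial.C ((M i j : ℚ) : ℂ) *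
    (MvPolynomial.X (i, 0) * MvPolynomial.X (j, 0)))

theorem virasoro_eq_quadVec (G : Matrix ι ι ℚ) : virasoro G = quadVec G⁻¹ := rfl

theorem quadVec_add (M M' : Matrix ι ι ℚ) : quadVec (M + M') = quadVec M + quadVec M' := by
  rw [quadVec, quadVec, quadVec, ← vec_add, ← mul_add, ← Finset.sum_add_distrib]
  simp only [Matrix.add_apply, Rat.cast_add, map_add, add_mul, Finset.sum_add_distrib]

theorem inducedMap_quadVec (A : Matrix κ ι ℚ) (M : Matrix ι ι ℚ) :
    inducedMap A (quadVec M) = quadVec (A * M * A.transpose) := by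
  rw [quadVec, inducedMap_vec, Matrix.mulVec_zero, quadVec, map_mul]
  congr 2
  · exact MvPolynomial.aeval_C _ _
  have hC : ∀ c : ℂ, polyMap A (MvPolynomial.C c) = MvPolynomial.C c :=
    fun c => MvPolynomial.aeval_C _ _
  simp only [map_sum, map_mul, hC, polyMap_X, Matrix.mul_apply, Matrix.transpose_apply,
    Rat.cast_sum, Rat.cast_mul, Finset.sum_mul, Finset.mul_sum]
  simp only [Finset.sum_comm (s := (Finset.univ : Finset ι)) (t := (Finset.univ : Finset κ))]
  rw [Finset.sum_comm]
  refine Finset.sum_congr rfl fun k _ => Finset.sum_congr rfl fun l _ => ?_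
  rw [Finset.sum_comm]
  refine Finset.sum_congr rfl fun i _ => Finset.sum_congr rfl fun j _ => ?_
  ring

/-- Quadratic vectors transform by `M ↦ A M Aᵀ`, while `G = Aᵀ K A` gives `G⁻¹ = A⁻¹ K⁻¹ A⁻ᵀ`. -/
theorem inducedMap_virasoro {A : Matrix κ ι ℚ} {B : Matrix ι κ ℚ} (hAB : A * B = 1)
    (hBA : B * A = 1) {G : Matrix ι ι ℚ} {K : Matrix κ κ ℚ} (hK : IsUnit K.det)
    (hA : A.transpose * K * A = G) : inducedMap A (virasoro G) = virasoro K := by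
  have hG : G⁻¹ = B * K⁻¹ * B.transpose := by
    refine Matrix.inv_eq_right_inv ?_
    rw [← hA, show A.transpose * K * A * (B * K⁻¹ * B.transpose) =
      A.transpose * (K * (A * B) * K⁻¹) * B.transpose by simp only [Matrix.mul_assoc], hAB,
      Matrix.mul_one, Matrix.mul_nonsing_inv _ hK, Matrix.mul_one, ← Matrix.transpose_mul, hBA,
      Matrix.transpose_one]
  rw [virasoro_eq_quadVec, inducedMap_quadVec, hG, virasoro_eq_quadVec]
  congr 1
  rw [show A * (B * K⁻¹ * B.transpose) * A.transpose =
    A * B * K⁻¹ * (B.transpose * A.transpose) by simp only [Matrix.mul_assoc], hAB,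
    ← Matrix.transpose_mul, hAB, Matrix.one_mul, Matrix.transpose_one, Matrix.mul_one]

theorem mem_closure_range_transpose (A : Matrix κ ι ℚ) {β : κ → ℚ} :
    β ∈ AddSubgroup.closure (Set.range A.transpose) ↔
      ∃ γ ∈ intLattice ι, β = A.mulVec γ := by
  have : AddSubgroup.closure (Set.range A.transpose) =
      (intLattice ι).map A.mulVecLin.toAddMonoidHom := by
    rw [intLattice, AddMonoidHom.map_closure, ← Set.range_comp]
    congr 2
    funext i
    exact (Matrix.mulVec_single_one A i).symm
  rw [this, AddSubgroup.mem_map]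
  exact ⟨fun ⟨γ, h, e⟩ => ⟨γ, h, e.symm⟩, fun ⟨γ, h, e⟩ => ⟨γ, h, e.symm⟩⟩

/-- The isomorphism of vertex operator algebras induced by an isometry of lattices. -/
theorem exists_isVOAIso {A : Matrix κ ι ℚ} {B : Matrix ι κ ℚ} (hAB : A * B = 1)
    (hBA : B * A = 1) {G : Matrix ι ι ℚ} {K : Matrix κ κ ℚ} (hK : IsUnit K.det)
    (hA : A.transpose * K * A = G) {Λ : AddSubgroup (ι → ℚ)} {Λ' : AddSubgroup (κ → ℚ)}
    (h : ∀ β ∈ Λ, A.mulVec β ∈ Λ') (h' : ∀ β ∈ Λ', B.mulVec β ∈ Λ) :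
    ∃ f : V (Λ : Set (ι → ℚ)) ≃ₗ[ℂ] V (Λ' : Set (κ → ℚ)),
      (∀ u, (f u : Fock κ) = inducedMap A (u : Fock ι)) ∧ IsVOAIso G K f := by
  let F : V (Λ : Set (ι → ℚ)) →ₗ[ℂ] V (Λ' : Set (κ → ℚ)) :=
    (inducedMap A).toLinearMap.restrict fun u hu => inducedMap_mem_V A h hu
  let F' : V (Λ' : Set (κ → ℚ)) →ₗ[ℂ] V (Λ : Set (ι → ℚ)) :=
    (inducedMap B).toLinearMap.restrict fun u hu => inducedMap_mem_V B h' hu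
  have e1 : ∀ u : Fock κ, inducedMap A (inducedMap B u) = u := fun u => by
    rw [inducedMap_comp, hAB, inducedMap_one]
  have e2 : ∀ u : Fock ι, inducedMap B (inducedMap A u) = u := fun u => by
    rw [inducedMap_comp, hBA, inducedMap_one]
  refine ⟨LinearEquiv.ofLinearMap F F' (LinearMap.ext fun u => Subtype.ext (e1 u))
    (LinearMap.ext fun u => Subtype.ext (e2 u)), fun u => rfl, ?_, ?_, ?_⟩
  · exact fun n u v => ⟨⟨_, mode_mem_lattice G n u.2 v.2⟩, rfl, (mode_inducedMap hA n _ _).symm⟩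
  · exact ⟨⟨vacuum, vec_zero_mem _⟩, rfl, inducedMap_vacuum A⟩
  · exact ⟨⟨virasoro G, vec_zero_mem _⟩, rfl, inducedMap_virasoro hAB hBA hK hA⟩

end Quadratic

/-! ### The lattices `N`, `E`, `F` and `D` -/

section Lattices

theorem isUnit_det_gramL : IsUnit gramL.det := by
  rw [gramL, Matrix.det_smul, Matrix.det_one]
  norm_num

theorem gram_basisN : basisN.transpose * gramL * basisN = gramSqrtTwoA 3 := by
  ext i j
  fin_cases i <;> fin_cases j <;>
  · simp [gramSqrtTwoA, gramL, basisN, CartanMatrix.A, Matrix.mul_apply, Fin.sum_univ_three]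
    try norm_num

theorem gram_basisE : basisE.transpose * gramL * basisE = gramSqrtTwoA 2 := by
  ext i j
  fin_cases i <;> fin_cases j <;>
  · simp [gramSqrtTwoA, gramL, basisE, CartanMatrix.A, Matrix.mul_apply, Fin.sum_univ_three]
    try norm_num

theorem gram_basisF : basisF.transpose * gramL * basisF = gramF := by
  ext i j
  fin_cases i; fin_cases j
  simp [gramF, gramL, basisF, Matrix.mul_apply, Fin.sum_univ_three]
  norm_num

theorem gram_basisE_basisF : basisE.transpose * gramL * basisF = 0 := by
  ext i j
  fin_cases i <;> fin_cases j <;>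
  simp [gramL, basisE, basisF, Matrix.mul_apply, Fin.sum_univ_three]

theorem gram_basisF_basisE : basisF.transpose * gramL * basisE = 0 := by
  ext i j
  fin_cases i; fin_cases j <;>
  simp [gramL, basisE, basisF, Matrix.mul_apply, Fin.sum_univ_three]

/-- The inverse of `basisN`. -/
def basisNInv : Matrix (Fin 3) (Fin 3) ℚ := !![1/2, 1/2, 1/2; 0, 0, 1; -1/2, 1/2, 1/2]

theorem basisN_mul_inv : basisN * basisNInv = 1 := by
  ext i j
  fin_cases i <;> fin_cases j <;>
  · simp [basisN, basisNInv, Matrix.mul_apply, Fin.sum_univ_three]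
    try norm_num

theorem exists_isVOAIso_VN : ∃ f : V (intLattice (Fin 3)) ≃ₗ[ℂ] VN,
    (∀ u, (f u : Fock (Fin 3)) = inducedMap basisN (u : Fock (Fin 3))) ∧
      IsVOAIso (gramSqrtTwoA 3) gramL f := by
  refine exists_isVOAIso basisN_mul_inv (mul_eq_one_comm.1 basisN_mul_inv) isUnit_det_gramL
    gram_basisN ?_ ?_
  · intro β hβ
    obtain ⟨k, rfl⟩ := mem_intLattice.1 hβ
    refine mem_latN.2 ⟨![k 0 - k 2, k 0 - k 1 + k 2, k 1], ?_, k 0, ?_⟩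
    · funext i
      fin_cases i <;> simp [basisN, Matrix.mulVec, dotProduct, Fin.sum_univ_three] <;> ring
    · simp [Fin.sum_univ_three]
      ring
  · intro β hβ
    obtain ⟨k, rfl, m, hm⟩ := mem_latN.1 hβ
    rw [Fin.sum_univ_three] at hm
    have hm' : (k 0 : ℚ) = m + m - k 1 - k 2 := by
      rw [show k 0 = m + m - k 1 - k 2 by omega]
      push_cast
      ring
    -- These are the coordinates in the basis `√2β_i`; the first and third are integral because the
    -- coordinate sum is `2m`.
    refine mem_intLattice.2 ⟨![m, k 2, m - k 0], ?_⟩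
    funext i
    fin_cases i <;>
    · simp [basisNInv, Matrix.mulVec, dotProduct, Fin.sum_univ_three, hm']
      try ring

theorem gramSqrtTwoA_two_inv : (gramSqrtTwoA 2)⁻¹ = !![1/3, 1/6; 1/6, 1/3] := by
  refine Matrix.inv_eq_left_inv ?_
  ext i j
  fin_cases i <;> fin_cases j <;>
  · simp [gramSqrtTwoA, CartanMatrix.A, Matrix.mul_apply]
    norm_num

theorem gramF_inv : gramF⁻¹ = !![1/6] := by
  refine Matrix.inv_eq_left_inv ?_
  ext i j
  fin_cases i; fin_cases j
  simp [gramF, Matrix.mul_apply]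

theorem inducedMap_virasoro_add :
    inducedMap basisE (virasoro (gramSqrtTwoA 2)) + inducedMap basisF (virasoro gramF) =
      virasoro gramL := by
  rw [virasoro_eq_quadVec, virasoro_eq_quadVec, inducedMap_quadVec, inducedMap_quadVec,
    ← quadVec_add, virasoro_eq_quadVec, gramSqrtTwoA_two_inv, gramF_inv, gramL_inv]
  congr 1
  ext i j
  fin_cases i <;> fin_cases j <;>
  · simp [basisE, basisF, Matrix.vecMul, dotProduct, Matrix.transpose_apply]
    try norm_num

/-- The two complementary matrices are the orthogonal projections onto the spans of `E` and `F`,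
that is `G⁻¹ Aᵀ K` for the respective Gram matrix and basis. -/
theorem isSplit_basis :
    IsSplit basisE basisF !![2/3, 1/3, 1/3; 1/3, -1/3, 2/3] !![-1/3, 1/3, 1/3] := by
  constructor <;>
  · ext i j
    fin_cases i <;> fin_cases j <;>
    · simp [basisE, basisF, Matrix.mul_apply, Fin.sum_univ_three]
      try norm_num

theorem mem_latD {δ : Fin 3 → ℚ} : δ ∈ latD ↔ ∃ β ∈ intLattice (Fin 2),
    ∃ γ ∈ intLattice (Fin 1), δ = basisE.mulVec β + basisF.mulVec γ := by
  rw [latD, AddSubgroup.mem_sup]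
  constructor
  · rintro ⟨x, hx, y, hy, rfl⟩
    obtain ⟨β, hβ, rfl⟩ := (mem_closure_range_transpose _).1 hx
    obtain ⟨γ, hγ, rfl⟩ := (mem_closure_range_transpose _).1 hy
    exact ⟨β, hβ, γ, hγ, rfl⟩
  · rintro ⟨β, hβ, γ, hγ, rfl⟩
    exact ⟨_, (mem_closure_range_transpose _).2 ⟨β, hβ, rfl⟩, _,
      (mem_closure_range_transpose _).2 ⟨γ, hγ, rfl⟩, rfl⟩

/-- This decomposition of `α₂` along `E ⊥ F` determines which cosets of `E` and `F` occur in `D +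
α₂`. -/
theorem single_eq : (Pi.single 1 1 : Fin 3 → ℚ) =
    basisE.mulVec ![1 / 3, -1 / 3] + basisF.mulVec ![1 / 3] := by
  funext i
  fin_cases i <;>
  · simp [basisE, basisF]
    try norm_num

theorem mem_coset {ι : Type} {Λ : AddSubgroup (ι → ℚ)} {x y : ι → ℚ} :
    y ∈ coset Λ x ↔ y - x ∈ Λ := Iff.rfl

theorem mem_coset_latD {δ : Fin 3 → ℚ} : δ ∈ coset latD (Pi.single 1 1) ↔
    ∃ β ∈ coset (intLattice (Fin 2)) ![1 / 3, -1 / 3],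
      ∃ γ ∈ coset (intLattice (Fin 1)) ![1 / 3], δ = basisE.mulVec β + basisF.mulVec γ := by
  rw [mem_coset, mem_latD, single_eq]
  constructor
  · rintro ⟨β, hβ, γ, hγ, h⟩
    refine ⟨β + ![1 / 3, -1 / 3], ?_, γ + ![1 / 3], ?_, ?_⟩
    · rwa [mem_coset, add_sub_cancel_right]
    · rwa [mem_coset, add_sub_cancel_right]
    · rw [Matrix.mulVec_add, Matrix.mulVec_add, add_add_add_comm, ← h, sub_add_cancel]
  · rintro ⟨β, hβ, γ, hγ, rfl⟩
    refine ⟨_, hβ, _, hγ, ?_⟩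
    rw [Matrix.mulVec_sub, Matrix.mulVec_sub]
    abel

theorem gramSqrtTwoA_two_int (i j : Fin 2) : ∃ m : ℤ, gramSqrtTwoA 2 i j = m :=
  ⟨2 * CartanMatrix.A 2 i j, by simp [gramSqrtTwoA]⟩

theorem gramF_int (i j : Fin 1) : ∃ m : ℤ, gramF i j = m :=
  ⟨6, by fin_cases i; fin_cases j; simp [gramF]⟩

theorem isTensorModule_VD :
    IsTensorModule (gramSqrtTwoA 2) gramF gramL basisE basisF VE VE VF VF VD :=
  isTensorModule_intLattice isSplit_basis gram_basisE gram_basisF gram_basisE_basisF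
    gram_basisF_basisE gramSqrtTwoA_two_int gramF_int fun _ => mem_latD

theorem coset_add_mem {ι : Type} {Λ : AddSubgroup (ι → ℚ)} {x β γ : ι → ℚ} (hβ : β ∈ Λ)
    (hγ : γ ∈ coset Λ x) : β + γ ∈ coset Λ x := by
  rw [mem_coset, add_sub_assoc]
  exact add_mem hβ hγ

/-- The hypothesis on `x` puts it into the dual lattice. Hence all powers of `z` between the lattice
and the coset are integral, as `mode_tensor` demands. -/
theorem exists_pairing_coset_eq {ι : Type} [Fintype ι] [DecidableEq ι] {G : Matrix ι ι ℚ}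
    (hG : ∀ i j, ∃ m : ℤ, G i j = m) {x : ι → ℚ} (hx : ∀ i, ∃ m : ℤ, G.mulVec x i = m)
    {β γ : ι → ℚ} (hβ : β ∈ intLattice ι) (hγ : γ ∈ coset (intLattice ι) x) :
    ∃ r : ℤ, pairing G β γ = r := by
  obtain ⟨r, hr⟩ := exists_pairing_eq hG hβ hγ
  obtain ⟨k, rfl⟩ := mem_intLattice.1 hβ
  choose m hm using hx
  refine ⟨r + ∑ i, k i * m i, ?_⟩
  rw [Int.cast_add, ← hr, show γ = (γ - x) + x by abel, pairing_add_right, sub_add_cancel]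
  congr 1
  simp [pairing, dotProduct, hm]

theorem isTensorModule_VDa :
    IsTensorModule (gramSqrtTwoA 2) gramF gramL basisE basisF VE VEa VF VFa VDa := by
  refine isTensorModule_V isSplit_basis gram_basisE gram_basisF gram_basisE_basisF
    gram_basisF_basisE (fun _ hβ _ hγ => coset_add_mem hβ hγ)
    (fun _ hβ _ hγ => coset_add_mem hβ hγ)
    (fun _ hβ _ hγ => exists_pairing_coset_eq gramSqrtTwoA_two_int ?_ hβ hγ)
    (fun _ hβ _ hγ => exists_pairing_coset_eq gramF_int ?_ hβ hγ) fun _ => mem_coset_latD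
  -- The pairings of `√2(β₁ - β₂)/3` with `√2β₁` and `√2β₂` are `2` and `-2`.
  · refine fun i => ⟨![2, -2] i, ?_⟩
    fin_cases i <;>
    · simp [gramSqrtTwoA, CartanMatrix.A, Matrix.mulVec, dotProduct]
      norm_num
  · refine fun i => ⟨2, ?_⟩
    fin_cases i
    simp [gramF, Matrix.mulVec, dotProduct]
    norm_num

end Lattices

/-! ### Fixed points over a sublattice and a pair of opposite cosets -/

section Restriction

variable {ι : Type} [Fintype ι] [DecidableEq ι]

open scoped Classical in
/-- The projection of the Fock space onto `V_X`. -/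
def proj (X : Set (ι → ℚ)) : Fock ι →ₗ[ℂ] Fock ι := twist fun β => if β ∈ X then 1 else 0

open scoped Classical in
theorem coeff_proj (X : Set (ι → ℚ)) (u : Fock ι) (β : ι → ℚ) :
    (proj X u).coeff β = if β ∈ X then u.coeff β else 0 := by
  rw [proj, coeff_twist]
  split_ifs
  · rw [one_smul]
  · rw [zero_smul]

theorem proj_mem (X : Set (ι → ℚ)) (u : Fock ι) : proj X u ∈ V X := by
  intro β hβ
  rw [coeff_proj] at hβ
  by_contra h
  exact hβ (if_neg h)

theorem proj_eq_self {X : Set (ι → ℚ)} {u : Fock ι} (hu : u ∈ V X) : proj X u = u := by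
  refine AddMonoidAlgebra.coeff_injective (Finsupp.ext fun β => ?_)
  rw [coeff_proj]
  split_ifs with h
  · rfl
  · by_contra hne
    exact h (hu β (Ne.symm hne))

theorem proj_eq_zero {X Y : Set (ι → ℚ)} (h : ∀ β ∈ Y, β ∉ X) {u : Fock ι} (hu : u ∈ V Y) :
    proj X u = 0 := by
  refine AddMonoidAlgebra.coeff_injective (Finsupp.ext fun β => ?_)
  rw [coeff_proj]
  split_ifs with h'
  · by_contra hne
    exact h β (hu β hne) h'
  · rfl

/-- Adding an element of `Y` neither enters nor leaves `X`, so projecting to `V_X` commutes with the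
action of `V_Y`. -/
theorem mode_proj (G : Matrix ι ι ℚ) (n : ℤ) {X Y : Set (ι → ℚ)}
    (h : ∀ β ∈ Y, ∀ γ, β + γ ∈ X ↔ γ ∈ X) {u : Fock ι} (hu : u ∈ V Y) (v : Fock ι) :
    mode G n u (proj X v) = proj X (mode G n u v) := by
  induction hu using V_induction with
  | h0 => simp [mode_zero_left]
  | hadd u u' _ _ h h' => simp only [map_add, mode_add_left, h, h']
  | hvec β hβ p =>
  induction v using fock_induction with
  | h0 => simp [mode_zero_right]
  | hadd u u' h h' => simp only [map_add, mode_add_right, h, h']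
  | hvec γ q =>
    have hγ := h β hβ γ
    rw [proj, mode_vec, twist_vec, twist_vec, ← smul_vec, mode_smul_right, mode_vec, smul_vec]
    by_cases hx : γ ∈ X
    · rw [if_pos hx, if_pos (hγ.2 hx)]
    · rw [if_neg hx, if_neg (hx ∘ hγ.1)]

theorem negLift_proj {X : Set (ι → ℚ)} (u : Fock ι) :
    negLift (proj X u) = proj (-X) (negLift u) := by
  rw [proj, proj, negLift]
  refine (twist_inducedMap (fun β => ?_) u).symm
  rw [Matrix.neg_mulVec, Matrix.one_mulVec, Set.mem_neg, neg_neg]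

theorem proj_add_proj_add_proj {X Y Z W : Set (ι → ℚ)} (hW : ∀ β ∈ W, β ∈ X ∨ β ∈ Y ∨ β ∈ Z)
    (hXY : ∀ β ∈ X, β ∉ Y) (hXZ : ∀ β ∈ X, β ∉ Z) (hYZ : ∀ β ∈ Y, β ∉ Z) {u : Fock ι}
    (hu : u ∈ V W) : proj X u + proj Y u + proj Z u = u := by
  refine AddMonoidAlgebra.coeff_injective (Finsupp.ext fun β => ?_)
  rw [AddMonoidAlgebra.coeff_add, AddMonoidAlgebra.coeff_add, Finsupp.add_apply,
    Finsupp.add_apply, coeff_proj, coeff_proj, coeff_proj]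
  by_cases h0 : u.coeff β = 0
  · simp [h0]
  rcases hW β (hu β h0) with h | h | h
  · rw [if_pos h, if_neg (hXY β h), if_neg (hXZ β h), add_zero, add_zero]
  · rw [if_neg fun h' => hXY β h' h, if_pos h, if_neg (hYZ β h), zero_add, add_zero]
  · rw [if_neg fun h' => hXZ β h' h, if_neg fun h' => hYZ β h' h, if_pos h, zero_add, zero_add]

theorem V_mono {X Y : Set (ι → ℚ)} (h : X ⊆ Y) : V X ≤ V Y := fun _ hu β hβ => h (hu β hβ)

/-- `u ↦ u + θ u`, where `θ` is the lift of `-1`. -/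
def negSum : Fock ι →ₗ[ℂ] Fock ι := LinearMap.id + (negLift (ι := ι)).toLinearMap

theorem negSum_apply (u : Fock ι) : negSum u = u + negLift u := rfl

theorem negLift_negSum (u : Fock ι) : negLift (negSum u) = negSum u := by
  rw [negSum_apply, map_add, negLift_negLift, add_comm]

/-- If a lattice `Λ'` is the disjoint union of a sublattice `Λ` and of two cosets `X` and `-X`,
then `V_{Λ'}⁺ ≅ V_Λ⁺ ⊕ V_X` as `V_Λ⁺`-modules. -/
theorem exists_plus_equiv (G : Matrix ι ι ℚ) {Λ Λ' : AddSubgroup (ι → ℚ)} {X : Set (ι → ℚ)}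
    (hΛ : Λ ≤ Λ') (hX : ∀ β ∈ X, β ∈ Λ') (hcover : ∀ β ∈ Λ', β ∈ Λ ∨ β ∈ X ∨ β ∈ -X)
    (hΛX : ∀ β ∈ Λ, β ∉ X) (hXX : ∀ β ∈ X, β ∉ -X) (hadd : ∀ β ∈ Λ, ∀ γ, β + γ ∈ X ↔ γ ∈ X) :
    ∃ f : plus (V (Λ' : Set (ι → ℚ))) ≃ₗ[ℂ] plus (V (Λ : Set (ι → ℚ))) × V X,
      ∀ (n : ℤ), ∀ a ∈ plus (V (Λ : Set (ι → ℚ))), ∀ v : plus (V (Λ' : Set (ι → ℚ))),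
        ∃ w : plus (V (Λ' : Set (ι → ℚ))), (w : Fock ι) = mode G n a v ∧
          ((f w).1 : Fock ι) = mode G n a (f v).1 ∧ ((f w).2 : Fock ι) = mode G n a (f v).2 := by
  have hnegΛ : -(Λ : Set (ι → ℚ)) = Λ := by ext β; simp
  have hΛnX : ∀ β ∈ (Λ : Set (ι → ℚ)), β ∉ -X := fun β hβ h => hΛX (-β) (neg_mem hβ) h
  have hneg : ∀ {w : Fock ι}, w ∈ V X → negLift w ∈ V (-X) := fun {w} hw => by
    rw [← proj_eq_self hw, negLift_proj]
    exact proj_mem _ _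
  have hmem1 : ∀ u ∈ plus (V (Λ' : Set (ι → ℚ))), proj (Λ : Set (ι → ℚ)) u ∈
      plus (V (Λ : Set (ι → ℚ))) := fun u hu =>
    ⟨proj_mem _ _, by
      change negLift _ = _
      rw [negLift_proj, hnegΛ, (mem_plus.1 hu).2]
      rfl⟩
  have hVX : V X ≤ V (Λ' : Set (ι → ℚ)) := V_mono hX
  let F : plus (V (Λ' : Set (ι → ℚ))) →ₗ[ℂ] plus (V (Λ : Set (ι → ℚ))) × V X :=
    ((proj (Λ : Set (ι → ℚ))).restrict hmem1).prod
      ((proj X).restrict fun u _ => proj_mem X u)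
  have hmem2 : ∀ v ∈ plus (V (Λ : Set (ι → ℚ))), v ∈ plus (V (Λ' : Set (ι → ℚ))) :=
    fun v hv => ⟨V_mono hΛ hv.1, hv.2⟩
  have hmem3 : ∀ w ∈ V X, negSum w ∈ plus (V (Λ' : Set (ι → ℚ))) := fun w hw =>
    mem_plus.2 ⟨add_mem (hVX hw) (negLift_mem_V (fun _ hβ => neg_mem hβ) (hVX hw)),
      negLift_negSum w⟩
  -- The inverse is `(v, w) ↦ v + w + θ w`: in a fixed vector the component in `V_{-X}` is the image
  -- under `θ` of the component in `V_X`.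
  let F' : plus (V (Λ : Set (ι → ℚ))) × V X →ₗ[ℂ] plus (V (Λ' : Set (ι → ℚ))) :=
    ((LinearMap.id (R := ℂ) (M := Fock ι)).restrict hmem2).coprod (negSum.restrict hmem3)
  have e1 : F ∘ₗ F' = LinearMap.id := by
    refine LinearMap.ext fun ⟨v, w⟩ => Prod.ext (Subtype.ext ?_) (Subtype.ext ?_)
    · change proj (Λ : Set (ι → ℚ)) ((v : Fock ι) + (w + negLift (w : Fock ι))) = v
      rw [map_add, map_add, proj_eq_self v.2.1, proj_eq_zero (fun β hβ h => hΛX β h hβ) w.2,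
        proj_eq_zero (fun β hβ h => hΛnX β h hβ) (hneg w.2), add_zero, add_zero]
    · change proj X ((v : Fock ι) + (w + negLift (w : Fock ι))) = w
      rw [map_add, map_add, proj_eq_self w.2, proj_eq_zero hΛX v.2.1,
        proj_eq_zero (fun β hβ h => hXX β h hβ) (hneg w.2), add_zero, zero_add]
  have e2 : F' ∘ₗ F = LinearMap.id := by
    refine LinearMap.ext fun u => Subtype.ext ?_
    change proj (Λ : Set (ι → ℚ)) (u : Fock ι) + (proj X (u : Fock ι) +
      negLift (proj X (u : Fock ι))) = u
    rw [negLift_proj, (mem_plus.1 u.2).2, ← add_assoc]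
    exact proj_add_proj_add_proj hcover hΛX hΛnX hXX u.2.1
  refine ⟨LinearEquiv.ofLinearMap F F' e1 e2, fun n a ha v => ?_⟩
  refine ⟨⟨mode G n a v, mode_mem_lattice G n (V_mono hΛ ha.1) v.2.1, ?_⟩, rfl, ?_, ?_⟩
  · change negLift (mode G n a v) = _
    rw [← mode_negLift, (mem_plus.1 ha).2, (mem_plus.1 v.2).2]
    rfl
  · exact (mode_proj G n (fun β hβ γ => add_mem_cancel_left hβ) ha.1 _).symm
  · exact (mode_proj G n hadd ha.1 _).symm

end Restriction

/-! ### Eigenspaces of the lift of `-1` on a tensor product -/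

section Even

variable {ι κ υ : Type} [Fintype ι] [DecidableEq ι] [Fintype κ] [DecidableEq κ] [Fintype υ]
  [DecidableEq υ]

/-- The projection `V_X → V_X⁺`. -/
def plusProj {X : Set (ι → ℚ)} (hX : ∀ β ∈ X, -β ∈ X) : V X →ₗ[ℂ] plus (V X) :=
  ((1 / 2 : ℂ) • (LinearMap.id + (negLift (ι := ι)).toLinearMap)).restrict fun u hu => by
    refine ⟨Submodule.smul_mem _ _ (add_mem hu (negLift_mem_V hX hu)), ?_⟩
    change negLift ((1 / 2 : ℂ) • (u + negLift u)) = (1 / 2 : ℂ) • (u + negLift u)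
    rw [map_smul, map_add, negLift_negLift, add_comm]

/-- The projection `V_X → V_X⁻`. -/
def minusProj {X : Set (ι → ℚ)} (hX : ∀ β ∈ X, -β ∈ X) : V X →ₗ[ℂ] minus (V X) :=
  ((1 / 2 : ℂ) • (LinearMap.id + (-1 : ℂ) • (negLift (ι := ι)).toLinearMap)).restrict
    fun u hu => by
      refine ⟨Submodule.smul_mem _ _ (add_mem hu (Submodule.smul_mem _ _ (negLift_mem_V hX hu))), ?_⟩
      change negLift ((1 / 2 : ℂ) • (u + (-1 : ℂ) • negLift u)) =
        -((1 / 2 : ℂ) • (u + (-1 : ℂ) • negLift u))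
      rw [map_smul, map_add, map_smul, negLift_negLift]
      module

theorem plus_le (U : Submodule ℂ (Fock ι)) : plus U ≤ U := inf_le_left

theorem minus_le (U : Submodule ℂ (Fock ι)) : minus U ≤ U := inf_le_left

variable {X : Set (ι → ℚ)} (hX : ∀ β ∈ X, -β ∈ X)

theorem coe_plusProj (u : V X) : (plusProj hX u : Fock ι) =
    (1 / 2 : ℂ) • ((u : Fock ι) + negLift (u : Fock ι)) := rfl

theorem coe_minusProj (u : V X) : (minusProj hX u : Fock ι) =
    (1 / 2 : ℂ) • ((u : Fock ι) + (-1 : ℂ) • negLift (u : Fock ι)) := rfl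

theorem plusProj_of_plus (u : plus (V X)) : plusProj hX (Submodule.inclusion (plus_le _) u) = u := by
  refine Subtype.ext ?_
  rw [coe_plusProj, Submodule.coe_inclusion, (mem_plus.1 u.2).2]
  module

theorem plusProj_of_minus (u : minus (V X)) :
    plusProj hX (Submodule.inclusion (minus_le _) u) = 0 := by
  refine Subtype.ext ?_
  rw [coe_plusProj, Submodule.coe_inclusion, (mem_minus.1 u.2).2, add_neg_cancel, smul_zero]
  rfl

theorem minusProj_of_minus (u : minus (V X)) :
    minusProj hX (Submodule.inclusion (minus_le _) u) = u := by
  refine Subtype.ext ?_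
  rw [coe_minusProj, Submodule.coe_inclusion, (mem_minus.1 u.2).2]
  module

theorem minusProj_of_plus (u : plus (V X)) :
    minusProj hX (Submodule.inclusion (plus_le _) u) = 0 := by
  refine Subtype.ext ?_
  rw [coe_minusProj, Submodule.coe_inclusion, (mem_plus.1 u.2).2, neg_one_smul, add_neg_cancel,
    smul_zero]
  rfl

/-- `(U⁺ ⊗ W⁺) ⊕ (U⁻ ⊗ W⁻) → U ⊗ W`. -/
def evenIncl (U : Submodule ℂ (Fock ι)) (W : Submodule ℂ (Fock κ)) :
    (plus U ⊗[ℂ] plus W) × (minus U ⊗[ℂ] minus W) →ₗ[ℂ] U ⊗[ℂ] W :=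
  (TensorProduct.map (Submodule.inclusion (plus_le U)) (Submodule.inclusion (plus_le W))).coprod
    (TensorProduct.map (Submodule.inclusion (minus_le U)) (Submodule.inclusion (minus_le W)))

variable {Y : Set (κ → ℚ)} (hY : ∀ β ∈ Y, -β ∈ Y)

/-- `V_X ⊗ V_Y → (V_X⁺ ⊗ V_Y⁺) ⊕ (V_X⁻ ⊗ V_Y⁻)`. -/
def evenProj : V X ⊗[ℂ] V Y →ₗ[ℂ] (plus (V X) ⊗[ℂ] plus (V Y)) × (minus (V X) ⊗[ℂ] minus (V Y)) :=
  (TensorProduct.map (plusProj hX) (plusProj hY)).prod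
    (TensorProduct.map (minusProj hX) (minusProj hY))

theorem evenProj_evenIncl (x) : evenProj hX hY (evenIncl (V X) (V Y) x) = x := by
  have : evenProj hX hY ∘ₗ evenIncl (V X) (V Y) = LinearMap.id := by
    refine LinearMap.prod_ext (TensorProduct.ext' fun u v => ?_) (TensorProduct.ext' fun u v => ?_)
    · simp [evenProj, evenIncl, plusProj_of_plus, minusProj_of_plus]
    · simp [evenProj, evenIncl, plusProj_of_minus, minusProj_of_minus]
  exact LinearMap.congr_fun this x

/-- A quarter of `(u + θu)(v + θv) + (u - θu)(v - θv)` is half of `uv + θu θv`, so keeping the parts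
of equal sign is averaging over `θ ⊗ θ`. -/
theorem tensorMap_evenProj (A : Matrix υ ι ℚ) (B : Matrix υ κ ℚ) (t : V X ⊗[ℂ] V Y) :
    tensorMap A B (V X) (V Y) (evenIncl _ _ (evenProj hX hY t)) =
      (1 / 2 : ℂ) • (tensorMap A B (V X) (V Y) t + negLift (tensorMap A B (V X) (V Y) t)) := by
  induction t using TensorProduct.induction_on with
  | zero => simp
  | add t t' h h' => rw [map_add, map_add, map_add, h, h', map_add, map_add]; module
  | tmul u v =>
    have e : evenIncl (V X) (V Y) (evenProj hX hY (u ⊗ₜ v)) =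
        Submodule.inclusion (plus_le _) (plusProj hX u) ⊗ₜ
          Submodule.inclusion (plus_le _) (plusProj hY v) +
        Submodule.inclusion (minus_le _) (minusProj hX u) ⊗ₜ
          Submodule.inclusion (minus_le _) (minusProj hY v) := rfl
    rw [e, map_add, tensorMap_tmul, tensorMap_tmul, tensorMap_tmul]
    simp only [Submodule.coe_inclusion, coe_plusProj, coe_minusProj, map_mul, negLift_inducedMap]
    simp only [map_smul, map_add, mul_add, add_mul, smul_mul_assoc,
      mul_smul_comm]
    module

/-- `V_Z⁺ = (V_X⁺ ⊗ V_Y⁺) ⊕ (V_X⁻ ⊗ V_Y⁻)` if `V_Z = V_X ⊗ V_Y`. -/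
theorem plus_decomposition {X : Set (ι → ℚ)} (hX : ∀ β ∈ X, -β ∈ X) {Y : Set (κ → ℚ)}
    (hY : ∀ β ∈ Y, -β ∈ Y) {A : Matrix υ ι ℚ} {B : Matrix υ κ ℚ} {Z : Submodule ℂ (Fock υ)}
    (hi : Function.Injective (tensorMap A B (V X) (V Y)))
    (hr : LinearMap.range (tensorMap A B (V X) (V Y)) = Z)
    {f : (plus (V X) ⊗[ℂ] plus (V Y)) × (minus (V X) ⊗[ℂ] minus (V Y)) →ₗ[ℂ] Fock υ}
    (hf : f = (tensorMap A B (plus (V X)) (plus (V Y))).coprod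
      (tensorMap A B (minus (V X)) (minus (V Y)))) :
    Function.Injective f ∧ LinearMap.range f = plus Z := by
  have hf' : ∀ x, f x = tensorMap A B (V X) (V Y) (evenIncl _ _ x) := by
    have : f = tensorMap A B (V X) (V Y) ∘ₗ evenIncl _ _ := by
      rw [hf]
      exact LinearMap.prod_ext (TensorProduct.ext' fun u v => by simp [evenIncl, tensorMap_tmul])
        (TensorProduct.ext' fun u v => by simp [evenIncl, tensorMap_tmul])
    exact LinearMap.congr_fun this
  have hfix : ∀ x, negLift (f x) = f x := by
    -- On the image the averaging acts as the identity, which forces `θ` to fix it.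
    intro x
    have h := tensorMap_evenProj hX hY A B (evenIncl _ _ x)
    rw [evenProj_evenIncl, ← hf'] at h
    have h2 : negLift (f x) = (2 : ℂ) • ((1 / 2 : ℂ) • (f x + negLift (f x))) + (-1 : ℂ) • f x := by
      module
    rw [← h] at h2
    rw [h2]
    module
  refine ⟨fun x y hxy => ?_, le_antisymm ?_ fun z hz => ?_⟩
  · rw [hf', hf'] at hxy
    rw [← evenProj_evenIncl hX hY x, hi hxy, evenProj_evenIncl]
  · rintro _ ⟨x, rfl⟩
    refine ⟨?_, hfix x⟩
    rw [hf', ← hr]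
    exact ⟨_, rfl⟩
  · obtain ⟨hz, hz'⟩ := mem_plus.1 hz
    rw [← hr] at hz
    obtain ⟨t, rfl⟩ := hz
    refine ⟨evenProj hX hY t, ?_⟩
    rw [hf', tensorMap_evenProj, hz']
    module

end Even

/-! ### The cosets of `D` in `L`, and the decomposition of `V_L⁺` -/

section Final

theorem evenMap_decomposition :
    Function.Injective evenMap ∧ LinearMap.range evenMap = plus VD :=
  plus_decomposition (fun _ hβ => neg_mem hβ) (fun _ hβ => neg_mem hβ) isTensorModule_VD.injective
    isTensorModule_VD.range_eq rfl

/-- The form `k₀ - k₁ - k₂` vanishes on `E` and takes the value `-3` at `γ`, so `D` is its kernel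
modulo 3 on `L`. -/
theorem mem_latD_int {k : Fin 3 → ℤ} : (fun i => (k i : ℚ)) ∈ latD ↔ (3 : ℤ) ∣ k 0 - k 1 - k 2 := by
  rw [mem_latD]
  constructor
  · rintro ⟨β, hβ, γ, hγ, h⟩
    obtain ⟨m, rfl⟩ := mem_intLattice.1 hβ
    obtain ⟨l, rfl⟩ := mem_intLattice_one.1 hγ
    have h0 := congrFun h 0
    have h1 := congrFun h 1
    have h2 := congrFun h 2
    simp [basisE, basisF, dotProduct] at h0 h1 h2
    refine ⟨-l, ?_⟩
    have : ((k 0 - k 1 - k 2 : ℤ) : ℚ) = ((3 * -l : ℤ) : ℚ) := by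
      push_cast
      rw [h0, h1, h2]
      ring
    exact_mod_cast this
  · rintro ⟨t, ht⟩
    -- The form takes the value `3t`, so the coefficient of `γ` is `-t`; the first and third
    -- coordinates then determine those of `√2β₁` and `√2β₂`.
    refine ⟨_, mem_intLattice.2 ⟨![k 0 - t, k 2 + t], rfl⟩, _, mem_intLattice_one.2 ⟨-t, rfl⟩, ?_⟩
    have h1 : (k 1 : ℚ) = k 0 - k 2 - 3 * t := by
      rw [show k 1 = k 0 - k 2 - 3 * t by omega]
      push_cast
      ring
    funext i
    fin_cases i <;>
    · simp [basisE, basisF, dotProduct, h1]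
      try ring

theorem mem_coset_latD_int {k : Fin 3 → ℤ} :
    (fun i => (k i : ℚ)) ∈ coset latD (Pi.single 1 1) ↔ (3 : ℤ) ∣ k 0 - k 1 - k 2 + 1 := by
  have h : (fun i => (k i : ℚ)) - Pi.single 1 1 =
      fun i => ((k - Pi.single 1 1 : Fin 3 → ℤ) i : ℚ) := by
    funext i
    simp [Pi.single_apply]
  rw [mem_coset, h, mem_latD_int]
  have e : (k - Pi.single 1 1 : Fin 3 → ℤ) 0 - (k - Pi.single 1 1 : Fin 3 → ℤ) 1 -
      (k - Pi.single 1 1 : Fin 3 → ℤ) 2 = k 0 - k 1 - k 2 + 1 := by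
    simp
    ring
  rw [e]

theorem latD_le : latD ≤ intLattice (Fin 3) := by
  intro δ hδ
  obtain ⟨β, hβ, γ, hγ, rfl⟩ := mem_latD.1 hδ
  obtain ⟨m, rfl⟩ := mem_intLattice.1 hβ
  obtain ⟨l, rfl⟩ := mem_intLattice_one.1 hγ
  refine mem_intLattice.2 ⟨![m 0 - l, m 0 - m 1 + l, m 1 + l], ?_⟩
  funext i
  fin_cases i <;>
  · simp [basisE, basisF, dotProduct]
    try ring

theorem exists_plus_VL_equiv :
    ∃ f : plus VL ≃ₗ[ℂ] plus VD × VDa, ∀ (n : ℤ), ∀ a ∈ plus VD, ∀ v : plus VL,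
      ∃ w : plus VL, (w : Fock (Fin 3)) = mode gramL n a v ∧
        ((f w).1 : Fock (Fin 3)) = mode gramL n a (f v).1 ∧
        ((f w).2 : Fock (Fin 3)) = mode gramL n a (f v).2 := by
  have hX : ∀ β ∈ coset latD (Pi.single 1 1), β ∈ intLattice (Fin 3) := by
    intro β hβ
    rw [← sub_add_cancel β (Pi.single 1 1)]
    exact add_mem (latD_le hβ) (AddSubgroup.subset_closure ⟨1, rfl⟩)
  have hneg : ∀ k : Fin 3 → ℤ, -(fun i => (k i : ℚ)) = fun i => ((-k : Fin 3 → ℤ) i : ℚ) :=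
    fun k => by funext i; simp
  -- On `L` the three cosets `D`, `D + α₂` and `-(D + α₂)` are the residue classes `0`, `-1` and `1`
  -- modulo 3 of `k₀ - k₁ - k₂`, so the covering and disjointness conditions are arithmetic.
  refine exists_plus_equiv gramL latD_le hX ?_ ?_ ?_ ?_
  · intro β hβ
    obtain ⟨k, rfl⟩ := mem_intLattice.1 hβ
    rw [Set.mem_neg, hneg, mem_coset_latD_int, mem_coset_latD_int, mem_latD_int]
    simp only [Pi.neg_apply]
    omega
  · intro β hβ
    obtain ⟨k, rfl⟩ := mem_intLattice.1 (latD_le hβ)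
    rw [mem_latD_int] at hβ
    rw [mem_coset_latD_int]
    omega
  · intro β hβ
    obtain ⟨k, rfl⟩ := mem_intLattice.1 (hX β hβ)
    rw [mem_coset_latD_int] at hβ
    rw [Set.mem_neg, hneg, mem_coset_latD_int]
    simp only [Pi.neg_apply]
    omega
  · intro β hβ γ
    rw [mem_coset, mem_coset, add_sub_assoc]
    exact add_mem_cancel_left hβ

theorem exists_equiv_plus_VL :
    ∃ Ψ : (((plus VE ⊗[ℂ] plus VF) × (minus VE ⊗[ℂ] minus VF)) × (VEa ⊗[ℂ] VFa))
        ≃ₗ[ℂ] plus VL,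
      ∀ (n : ℤ), ∀ a ∈ plus VD, ∀ x, ∃ y,
        (Ψ y : Fock (Fin 3)) = mode gramL n a (Ψ x) ∧
        evenMap y.1 = mode gramL n a (evenMap x.1) ∧
        cosetMap y.2 = mode gramL n a (cosetMap x.2) := by
  obtain ⟨f, hf⟩ := exists_plus_VL_equiv
  obtain ⟨hi, hr⟩ := evenMap_decomposition
  let e₁ := (LinearEquiv.ofInjective evenMap hi).trans (LinearEquiv.ofEq _ _ hr)
  let e₂ : VEa ⊗[ℂ] VFa ≃ₗ[ℂ] VDa :=
    tensorEquiv isTensorModule_VDa.injective isTensorModule_VDa.range_eq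
  let Ψ := (LinearEquiv.prodCongr e₁ e₂).trans f.symm
  -- In these terms the two components of `Ψ x` under `f` are `evenMap x.1` and `cosetMap x.2`, so
  -- equivariance of `f` is all that remains to be used.
  have hΨ : ∀ x, f (Ψ x) = (e₁ x.1, e₂ x.2) := fun x => f.apply_symm_apply _
  refine ⟨Ψ, fun n a ha x => ?_⟩
  obtain ⟨w, hw, h1, h2⟩ := hf n a ha (Ψ x)
  obtain ⟨y, rfl⟩ := Ψ.surjective w
  rw [hΨ, hΨ] at h1 h2
  exact ⟨y, hw, h1, h2⟩

end Final

end LatticeVOA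

end

open LatticeVOA
theorem lemma3p2 :
    -- `N ≅ √2 A₃`, and this isometry induces an isomorphism from `V_{√2 A₃}` onto `V_N ⊆ V_L`
    (basisN.transpose * gramL * basisN = gramSqrtTwoA 3 ∧ VN ≤ VL ∧
      ∃ f : V (intLattice (Fin 3)) ≃ₗ[ℂ] VN,
        (∀ u, (f u : Fock (Fin 3)) = inducedMap basisN (u : Fock (Fin 3))) ∧
        IsVOAIso (gramSqrtTwoA 3) gramL f) ∧
    -- `σ` and `τ = σ ⊗ σ ⊗ σ` exist and are unique, `τ` is an automorphism of `V_L`,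
    -- and `τ(V_N) = V_L⁺`
    (∃! σ : V1 ≃ₗ[ℂ] V1, IsSigma σ) ∧
    (∀ σ : V1 ≃ₗ[ℂ] V1, IsSigma σ →
      (∃! τ : VL ≃ₗ[ℂ] VL, IsCube σ τ) ∧
      ∀ τ : VL ≃ₗ[ℂ] VL, IsCube σ τ →
        IsVOAIso gramL gramL τ ∧
        (VN.comap VL.subtype).map (VL.subtype ∘ₗ τ.toLinearMap) = plus VL) ∧
    -- `E ≅ √2 A₂`, `F = ℤγ`, `⟨γ, γ⟩ = 6`, `E ⊥ F`, `V_D = V_E ⊗ V_F`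
    (basisE.transpose * gramL * basisE = gramSqrtTwoA 2 ∧
      basisF.transpose * gramL * basisF = gramF ∧
      basisE.transpose * gramL * basisF = 0 ∧
      inducedMap basisE (virasoro (gramSqrtTwoA 2)) + inducedMap basisF (virasoro gramF) = virasoro gramL ∧
      IsTensorModule (gramSqrtTwoA 2) gramF gramL basisE basisF VE VE VF VF VD) ∧
    -- `V_L⁺ ≅ V_D⁺ ⊕ V_{D+α₂}` as `V_D⁺`-modules
    (∃ f : plus VL ≃ₗ[ℂ] plus VD × VDa, ∀ (n : ℤ), ∀ a ∈ plus VD, ∀ v : plus VL,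
      ∃ w : plus VL, (w : Fock (Fin 3)) = mode gramL n a v ∧
        ((f w).1 : Fock (Fin 3)) = mode gramL n a (f v).1 ∧
        ((f w).2 : Fock (Fin 3)) = mode gramL n a (f v).2) ∧
    -- `V_D⁺ = (V_E⁺ ⊗ V_F⁺) ⊕ (V_E⁻ ⊗ V_F⁻)`
    (Function.Injective evenMap ∧ LinearMap.range evenMap = plus VD) ∧
    -- `V_{D+α₂} = V_{E+√2(β₁-β₂)/3} ⊗ V_{F+γ/3}` as modules for `V_D = V_E ⊗ V_F`
    IsTensorModule (gramSqrtTwoA 2) gramF gramL basisE basisF VE VEa VF VFa VDa ∧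
    -- altogether, as `V_D⁺`-modules:
    -- `V_L⁺ ≅ (V_E⁺ ⊗ V_F⁺) ⊕ (V_E⁻ ⊗ V_F⁻) ⊕ (V_{E+√2(β₁-β₂)/3} ⊗ V_{F+γ/3})`
    (∃ Ψ : (((plus VE ⊗[ℂ] plus VF) × (minus VE ⊗[ℂ] minus VF)) × (VEa ⊗[ℂ] VFa))
        ≃ₗ[ℂ] plus VL,
      ∀ (n : ℤ), ∀ a ∈ plus VD, ∀ x, ∃ y,
        (Ψ y : Fock (Fin 3)) = mode gramL n a (Ψ x) ∧
        evenMap y.1 = mode gramL n a (evenMap x.1) ∧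
        cosetMap y.2 = mode gramL n a (cosetMap x.2)) :=
  ⟨⟨gram_basisN, VN_le_VL, exists_isVOAIso_VN⟩, existsUnique_isSigma, fun _ hσ => hσ.cube,
    ⟨gram_basisE, gram_basisF, gram_basisE_basisF, inducedMap_virasoro_add, isTensorModule_VD⟩,
    exists_plus_VL_equiv, evenMap_decomposition, isTensorModule_VDa, exists_equiv_plus_VL⟩
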